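/- Let $G$ be a compact Lie group and $K\subset G$ a closed subgroup such that $G/K$ is connected and effective, with Lie algebras $\mathfrak k\subset\mathfrak g$. Let $\mathfrak g=\mathfrak k\oplus\mathfrak p$, where $\mathfrak p$ is orthogonal to $\mathfrak k$ for the Killing form $B$ of $\mathfrak g$, and suppose that $\mathfrak p=\mathfrak p_1\oplus\mathfrak p_2$ with $\mathfrak p_1,\mathfrak p_2$ irreducible and inequivalent $\mathrm{Ad}(K)$-representations. Suppose that there is an intermediate closed subgroup $K<H<G$ with Lie algebra $\mathfrak h=\mathfrak k\oplus\mathfrak p_1$. Let $Q$ be an $\mathrm{Ad}(K)$-invariant scalar product on $\mathfrak p$ whose restrictions to $\mathfrak p_1$ and to $\mathfrak p_2$ are negative multiples of $B$. Then the $G$-invariant Riemannian metrics on $G/K$ are $g=x_1Q|_{\mathfrak p_1}\oplus x_2Q|_{\mathfrak p_2}$ with $x_1,x_2>0$, and we write $y=x_1/x_2$. Suppose that $G/K$ carries, up to scaling, exactly two $G$-invariant Einstein metrics, and let $0<y_1<y_2$ be the corresponding values of $y$ (so $g$ is Einstein if and only if $y\in\{y_1,y_2\}$). Let $g_0$ be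 a $G$-invariant metric with $y(0)>y_2$. Then there is $T\in(0,\infty)$ and a solution $g(t)=x_1(t)Q|_{\mathfrak p_1}\oplus x_2(t)Q|_{\mathfrak p_2}$, $t\in[0,T)$, of the Ricci flow $\partial_t g=-2\,\mathrm{Ric}(g)$ with $g(0)=g_0$ such that: 1. $[0,T)$ is maximal: $|\mathrm{Rm}(g(t))|_{g(t)}$ is unbounded as $t\to T$, and every $G$-invariant solution on an interval $[0,T')$ with initial metric $g_0$ satisfies $T'\le T$ and agrees with $g(t)$ on $[0,T')$ (so the solution is unique); 2. as $t\to T$, $G/K$ shrinks to a point, that is, $x_1(t)\to0$ and $x_2(t)\to0$, and $y(t)=x_1(t)/x_2(t)\to y_2$. Moreover there is no ancient $G$-invariant solution with this initial metric: no solution $g(t)$ of the Ricci flow by $G$-invariant metrics is defined on an interval $(-\infty,T')$ with $T'>0$ and satisfies $g(0)=g_0$. -/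

import Mathlib

open Set Filter Topology
open scoped Manifold ContDiff

noncomputable section

/-! ### Curvature of an invariant metric on a reductive homogeneous space

For a reductive decomposition `𝔤 = 𝔨 ⊕ 𝔭`, the tangent space of `G/K` at the base point is `𝔭`, and
`G`-invariant tensors on `G/K` are the same thing as their values at the base point, i.e. as
`Ad(K)`-invariant tensors on `𝔭`.  The curvature at the base point is given by Nomizu's formulas. -/

namespace HomRicci

section Algebra

/-- A scalar product (positive definite symmetric bilinear form) on a real vector space. -/
structure ScalarProduct (V : Type*) [AddCommGroup V] [Module ℝ V] where
  form : LinearMap.BilinForm ℝ V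
  symm : ∀ X Y, form X Y = form Y X
  pos : ∀ X, X ≠ 0 → 0 < form X X

theorem ScalarProduct.nondegenerate {V : Type*} [AddCommGroup V] [Module ℝ V]
    (g : ScalarProduct V) : g.form.Nondegenerate := by
  constructor
  · intro X hX
    by_contra h
    exact (g.pos X h).ne' (hX X)
  · intro X hX
    by_contra h
    exact (g.pos X h).ne' (hX X)

variable {L : Type*} [LieRing L] [LieAlgebra ℝ L] {p k : Submodule ℝ L}

/-- The `𝔭`-component `[X, Y]_𝔭` of the bracket of `X, Y ∈ 𝔭`. -/
def brP (h : IsCompl p k) : p →ₗ[ℝ] p →ₗ[ℝ] p :=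
  LinearMap.mk₂ ℝ (fun X Y => p.projectionOnto k h ⁅(X : L), (Y : L)⁆)
    (by intros; simp) (by intros; simp) (by intros; simp) (by intros; simp)

/-- The isotropy term `[[X, Y]_𝔨, Z]` (projected to `𝔭`, where it lies in the reductive case). -/
def isotropyTerm (h : IsCompl p k) (X Y Z : p) : p :=
  p.projectionOnto k h ⁅(k.projectionOnto p h.symm ⁅(X : L), (Y : L)⁆ : L), (Z : L)⁆

variable [FiniteDimensional ℝ L]

/-- The functional `Z ↦ ½ (g([X,Y]_𝔭, Z) + g([Z,X]_𝔭, Y) + g([Z,Y]_𝔭, X))` of Koszul's formula. -/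
def koszul (h : IsCompl p k) (g : ScalarProduct p) : p →ₗ[ℝ] p →ₗ[ℝ] Module.Dual ℝ p :=
  LinearMap.mk₂ ℝ
    (fun X Y => (1 / 2 : ℝ) • (g.form (brP h X Y) + (g.form.flip Y) ∘ₗ ((brP h).flip X) +
      (g.form.flip X) ∘ₗ ((brP h).flip Y)))
    (by intros; ext; simp; ring) (by intros; ext; simp; ring)
    (by intros; ext; simp; ring) (by intros; ext; simp; ring)

/-- The Nomizu map `Λ(X)Y` of the Levi-Civita connection of the invariant metric `g`:
`g(Λ(X)Y, Z) = ½ (g([X,Y]_𝔭, Z) + g([Z,X]_𝔭, Y) + g([Z,Y]_𝔭, X))`. -/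
def nomizu (h : IsCompl p k) (g : ScalarProduct p) : p →ₗ[ℝ] p →ₗ[ℝ] p :=
  (koszul h g).compr₂ (LinearMap.BilinForm.toDual g.form g.nondegenerate).symm.toLinearMap

/-- The curvature tensor at the base point,
`R(X,Y)Z = Λ(X)Λ(Y)Z - Λ(Y)Λ(X)Z - Λ([X,Y]_𝔭)Z - [[X,Y]_𝔨, Z]`. -/
def curvature (h : IsCompl p k) (g : ScalarProduct p) (X Y Z : p) : p :=
  nomizu h g X (nomizu h g Y Z) - nomizu h g Y (nomizu h g X Z) - nomizu h g (brP h X Y) Z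
    - isotropyTerm h X Y Z

/-- The endomorphism `Z ↦ R(Z,X)Y`. -/
def curvatureEnd (h : IsCompl p k) (g : ScalarProduct p) (X Y : p) : p →ₗ[ℝ] p where
  toFun Z := curvature h g Z X Y
  map_add' Z Z' := by simp [curvature, isotropyTerm]; abel
  map_smul' c Z := by simp [curvature, isotropyTerm, smul_sub]

/-- The Ricci tensor `Ric(X,Y) = tr (Z ↦ R(Z,X)Y)`. -/
def ricci (h : IsCompl p k) (g : ScalarProduct p) (X Y : p) : ℝ :=
  LinearMap.trace ℝ p (curvatureEnd h g X Y)

/-- `g` is Einstein: `Ric(g) = c g` for a real constant `c`. -/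
def IsEinstein (h : IsCompl p k) (g : ScalarProduct p) : Prop :=
  ∃ c : ℝ, ∀ X Y, ricci h g X Y = c * g.form X Y

/-- `|Rm(g)| ≤ M`, where `|Rm(g)|` is the maximum of `|g(R(X,Y)Z,W)|` over vectors of `g`-length at
most one (a norm equivalent to the Euclidean norm of the curvature tensor, with constants which
depend on the dimension only; by homogeneity the base point suffices). -/
def CurvatureBoundedBy (h : IsCompl p k) (g : ScalarProduct p) (M : ℝ) : Prop :=
  ∀ X Y Z W : p, g.form X X ≤ 1 → g.form Y Y ≤ 1 → g.form Z Z ≤ 1 → g.form W W ≤ 1 →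
    |g.form (curvature h g X Y Z) W| ≤ M

end Algebra

/-! ### Lie groups, the isotropy representation and invariant metrics -/

section Group

variable {E : Type*} [NormedAddCommGroup E] [NormedSpace ℝ E]
  {G : Type*} [TopologicalSpace G] [ChartedSpace E G] [Group G]

instance [LieGroup 𝓘(ℝ, E) ∞ G] : LieGroup 𝓘(ℝ, E) (minSmoothness ℝ 3) G :=
  LieGroup.of_le (n := ∞) (by
    rw [minSmoothness_of_isRCLikeNormedField]
    exact ENat.LEInfty.out)

instance [FiniteDimensional ℝ E] : FiniteDimensional ℝ (GroupLieAlgebra 𝓘(ℝ, E) G) :=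
  inferInstanceAs (FiniteDimensional ℝ E)

/-- The adjoint representation: `Ad(a)` is the derivative at `1` of `x ↦ a x a⁻¹`. -/
def Ad (a : G) : GroupLieAlgebra 𝓘(ℝ, E) G →ₗ[ℝ] GroupLieAlgebra 𝓘(ℝ, E) G :=
  (mfderiv 𝓘(ℝ, E) 𝓘(ℝ, E) (fun x : G => a * x * a⁻¹) 1 : E →L[ℝ] E).toLinearMap

/-- The Lie algebra of a subgroup `K` of `G`, as a subspace of the Lie algebra of `G`: the initial
velocities of the smooth curves in `G` that start at `1` and stay in `K`. -/
def lieAlgebraOf (K : Subgroup G) : Submodule ℝ (GroupLieAlgebra 𝓘(ℝ, E) G) :=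
  Submodule.span ℝ {X | ∃ c : ℝ → G, ContMDiff 𝓘(ℝ, ℝ) 𝓘(ℝ, E) ∞ c ∧ c 0 = 1 ∧ (∀ t, c t ∈ K) ∧
    (mfderiv 𝓘(ℝ, ℝ) 𝓘(ℝ, E) c 0 : ℝ →L[ℝ] E) 1 = X}

/-- The subspace `V` is invariant under `Ad(K)`. -/
def IsAdInvariant (K : Subgroup G) (V : Submodule ℝ (GroupLieAlgebra 𝓘(ℝ, E) G)) : Prop :=
  ∀ a ∈ K, ∀ X ∈ V, Ad a X ∈ V

/-- `V` is an irreducible (real) representation of `K`. -/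
def IsAdIrreducible (K : Subgroup G) (V : Submodule ℝ (GroupLieAlgebra 𝓘(ℝ, E) G)) : Prop :=
  IsAdInvariant K V ∧ V ≠ ⊥ ∧ ∀ W ≤ V, IsAdInvariant K W → W = ⊥ ∨ W = V

/-- `V` and `W` are equivalent representations of `K`. -/
def AdEquivalent (K : Subgroup G) (V W : Submodule ℝ (GroupLieAlgebra 𝓘(ℝ, E) G)) : Prop :=
  ∃ φ : V ≃ₗ[ℝ] W, ∀ a ∈ K, ∀ X Y : V,
    (Y : GroupLieAlgebra 𝓘(ℝ, E) G) = Ad a (X : GroupLieAlgebra 𝓘(ℝ, E) G) →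
    (φ Y : GroupLieAlgebra 𝓘(ℝ, E) G) = Ad a (φ X : GroupLieAlgebra 𝓘(ℝ, E) G)

/-- An `Ad(K)`-invariant scalar product on `𝔭`, i.e. a `G`-invariant Riemannian metric on `G/K`. -/
structure InvariantMetric (K : Subgroup G) (p : Submodule ℝ (GroupLieAlgebra 𝓘(ℝ, E) G))
    extends ScalarProduct p where
  invariant : ∀ a ∈ K, ∀ X X' Y Y' : p,
    (X' : GroupLieAlgebra 𝓘(ℝ, E) G) = Ad a (X : GroupLieAlgebra 𝓘(ℝ, E) G) →
    (Y' : GroupLieAlgebra 𝓘(ℝ, E) G) = Ad a (Y : GroupLieAlgebra 𝓘(ℝ, E) G) →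
    form X' Y' = form X Y

/-- The compact connected effective homogeneous spaces `G/K` whose isotropy representation is a sum
`𝔭 = 𝔭₁ ⊕ 𝔭₂` of two inequivalent irreducible summands, with an intermediate Lie group
`K < H < G` whose Lie algebra is `𝔥 = 𝔨 ⊕ 𝔭₁`.  Here `𝔭` is a complement of `𝔨` in `𝔤` that is
orthogonal to `𝔨` for the Killing form of `𝔤`. -/
structure IsTwoSummandSpace [LieGroup 𝓘(ℝ, E) ∞ G] [CompleteSpace E] (K H : Subgroup G)
    (p₁ p₂ : Submodule ℝ (GroupLieAlgebra 𝓘(ℝ, E) G)) : Prop where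
  compact : CompactSpace G
  isClosed_K : IsClosed (K : Set G)
  connected : ConnectedSpace (G ⧸ K)
  effective : K.normalCore = ⊥
  disjoint : Disjoint p₁ p₂
  isCompl : IsCompl (p₁ ⊔ p₂) (lieAlgebraOf K)
  orthogonal : ∀ X ∈ p₁ ⊔ p₂, ∀ Z ∈ (lieAlgebraOf K : Submodule ℝ (GroupLieAlgebra 𝓘(ℝ, E) G)),
    killingForm ℝ (GroupLieAlgebra 𝓘(ℝ, E) G) X Z = 0
  irreducible₁ : IsAdIrreducible K p₁
  irreducible₂ : IsAdIrreducible K p₂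
  inequivalent : ¬ AdEquivalent K p₁ p₂
  isClosed_H : IsClosed (H : Set G)
  lt_H : K < H
  H_lt : H < ⊤
  lieAlgebra_H : (lieAlgebraOf H : Submodule ℝ (GroupLieAlgebra 𝓘(ℝ, E) G)) = lieAlgebraOf K ⊔ p₁

variable {K : Subgroup G} {p₁ p₂ : Submodule ℝ (GroupLieAlgebra 𝓘(ℝ, E) G)}

/-- The restrictions of `Q` to `𝔭₁` and to `𝔭₂` are negative multiples of the Killing form:
`-B = b₁ Q` on `𝔭₁` and `-B = b₂ Q` on `𝔭₂`, with `b₁, b₂ > 0`. -/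
def IsBackground [LieGroup 𝓘(ℝ, E) ∞ G] [CompleteSpace E]
    (Q : InvariantMetric K (p₁ ⊔ p₂)) : Prop :=
  ∃ b₁ b₂ : ℝ, 0 < b₁ ∧ 0 < b₂ ∧
    (∀ X Y : ↥(p₁ ⊔ p₂), (X : GroupLieAlgebra 𝓘(ℝ, E) G) ∈ p₁ →
      (Y : GroupLieAlgebra 𝓘(ℝ, E) G) ∈ p₁ →
      -killingForm ℝ (GroupLieAlgebra 𝓘(ℝ, E) G) X Y = b₁ * Q.form X Y) ∧
    (∀ X Y : ↥(p₁ ⊔ p₂), (X : GroupLieAlgebra 𝓘(ℝ, E) G) ∈ p₂ →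
      (Y : GroupLieAlgebra 𝓘(ℝ, E) G) ∈ p₂ →
      -killingForm ℝ (GroupLieAlgebra 𝓘(ℝ, E) G) X Y = b₂ * Q.form X Y)

/-- `g = x₁ Q|𝔭₁ ⊕ x₂ Q|𝔭₂` with `x₁, x₂ > 0`. -/
def IsDiagonal (Q g : InvariantMetric K (p₁ ⊔ p₂)) (x₁ x₂ : ℝ) : Prop :=
  0 < x₁ ∧ 0 < x₂ ∧
    (∀ X Y : ↥(p₁ ⊔ p₂), (X : GroupLieAlgebra 𝓘(ℝ, E) G) ∈ p₁ →
      (Y : GroupLieAlgebra 𝓘(ℝ, E) G) ∈ p₁ → g.form X Y = x₁ * Q.form X Y) ∧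
    (∀ X Y : ↥(p₁ ⊔ p₂), (X : GroupLieAlgebra 𝓘(ℝ, E) G) ∈ p₂ →
      (Y : GroupLieAlgebra 𝓘(ℝ, E) G) ∈ p₂ → g.form X Y = x₂ * Q.form X Y) ∧
    (∀ X Y : ↥(p₁ ⊔ p₂), (X : GroupLieAlgebra 𝓘(ℝ, E) G) ∈ p₁ →
      (Y : GroupLieAlgebra 𝓘(ℝ, E) G) ∈ p₂ → g.form X Y = 0)

variable [FiniteDimensional ℝ E] [LieGroup 𝓘(ℝ, E) ∞ G]
  {p : Submodule ℝ (GroupLieAlgebra 𝓘(ℝ, E) G)}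

/-- The family `g(t)` of `G`-invariant metrics solves the Ricci flow `∂g/∂t = -2 Ric(g)` on the
interval `J` (with one-sided derivatives at an endpoint that belongs to `J`). -/
def IsRicciFlowOn (h : IsCompl p (lieAlgebraOf K)) (g : ℝ → InvariantMetric K p) (J : Set ℝ) :
    Prop :=
  ∀ t ∈ J, ∀ X Y : p, HasDerivWithinAt (fun s => (g s).form X Y)
    (-2 * ricci h (g t).toScalarProduct X Y) J t

end Group

end HomRicci

end

/-! Write `y = x₁ / x₂`. By Schur's lemma every invariant metric and every Ricci tensor is diagonal
(`exists_isDiagonal`, `exists_form_eq`), so the Ricci flow is a planar system. Since `𝔨 ⊕ 𝔭₁` is a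
subalgebra, `[𝔭₁, 𝔭₁]_𝔭 ⊆ 𝔭₁`, and the Nomizu formulas give `Ric = (A + B y²) Q` on `𝔭₁` and `(C - D
y) Q` on `𝔭₂` with `B, D ≥ 0` (`exists_ricci_eq`). The Einstein equation is then the quadratic `(B +
D) y² - C y + A = 0`. Its roots being exactly `y₁ < y₂`, one gets `B + D > 0`, `A = (B + D) y₁ y₂`,
`C = (B + D) (y₁ + y₂)`, and the flow satisfies `y' = -2 (B + D) (y - y₁) (y - y₂) / x₂`.

Forward in time, `y > y₂` decreases. The quantity `r = (y - y₂) / (y - y₁)` lies in `(0, 1)`, and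
`x₂` is an explicit function `c (1 - r)^θ r^γ` of it. In the variable `s = r^γ` the flow is a
regular scalar equation whose speed lies between positive constants, so `s` reaches `0` at a finite
time `T`; there `x₂ → 0`, `y → y₂` and hence `x₁ → 0` (`exists_shrinking`). On a unit vector of `𝔭₁`
the Ricci curvature is at least `A / x₁`, which is unbounded because `A > 0`. Solutions are unique
since the vector field is locally Lipschitz, and none continues past `T`, where its `x₁` would have
to vanish.

Backward in time, `y` stays above `y(0)` while `x₂` grows at most linearly, so the divergence of `∫
dt / x₂` forces `y` to infinity at a finite negative time (`not_ancient`).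

The hypotheses speak of `Ad(K)` and of curves in `K` and `H`, whereas the curvature computation
needs brackets. The bridge is that the derivative of `Ad` is the bracket, obtained from second
derivatives of the multiplication in a chart (`hasDerivAt_Ad`). -/

noncomputable section

/-! ### Second derivatives of a local group law -/

namespace HomRicci

section LocalGroup

variable {E : Type*} [NormedAddCommGroup E] [NormedSpace ℝ E]

/-- The mixed second derivative `∂ₓ∂_y m` of a function of two variables on the diagonal. -/
def mixedDeriv (m : E × E → E) (e X Y : E) : E :=
  fderiv ℝ (fderiv ℝ m) (e, e) (X, 0) (0, Y)

variable {m : E × E → E} {e : E}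

theorem fderiv_snd_eq (hm : DifferentiableAt ℝ m (e, e)) (h₂ : ∀ᶠ w in 𝓝 e, m (e, w) = w)
    (Y : E) : fderiv ℝ m (e, e) (0, Y) = Y := by
  have h := hm.hasFDerivAt.comp e (hasFDerivAt_prodMk_right e e)
  have h' : HasFDerivAt (m ∘ fun w => (e, w)) (ContinuousLinearMap.id ℝ E) e :=
    (hasFDerivAt_id e).congr_of_eventuallyEq h₂
  simpa using congrArg (fun L : E →L[ℝ] E => L Y) (h.unique h')

theorem fderiv_fst_eq (hm : DifferentiableAt ℝ m (e, e)) (h₁ : ∀ᶠ u in 𝓝 e, m (u, e) = u)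
    (Y : E) : fderiv ℝ m (e, e) (Y, 0) = Y := by
  have h := HasFDerivAt.comp (f := fun u => (u, e)) e hm.hasFDerivAt (hasFDerivAt_prodMk_left e e)
  have h' : HasFDerivAt (m ∘ fun w => (w, e)) (ContinuousLinearMap.id ℝ E) e :=
    (hasFDerivAt_id e).congr_of_eventuallyEq h₁
  simpa using congrArg (fun L : E →L[ℝ] E => L Y) (h.unique h')

theorem hasFDerivAt_fderiv (hm : ContDiffAt ℝ 2 m (e, e)) :
    HasFDerivAt (fderiv ℝ m) (fderiv ℝ (fderiv ℝ m) (e, e)) (e, e) :=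
  ((hm.fderiv_right (m := 1) (by norm_num)).differentiableAt (by norm_num)).hasFDerivAt

theorem hasFDerivAt_partial_snd (hm : ContDiffAt ℝ 2 m (e, e)) (Y : E) :
    HasFDerivAt (fun u => fderiv ℝ m (u, e) (0, Y))
      (((fderiv ℝ (fderiv ℝ m) (e, e)).comp (ContinuousLinearMap.inl ℝ E E)).flip (0, Y)) e := by
  have h := HasFDerivAt.comp (f := fun u => (u, e)) e (hasFDerivAt_fderiv hm)
    (hasFDerivAt_prodMk_left e e)
  exact h.clm_apply (hasFDerivAt_const ((0 : E), Y) e) |>.congr_fderiv (by ext; simp)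

theorem eventually_differentiableAt {F F' : Type*} [NormedAddCommGroup F] [NormedSpace ℝ F]
    [NormedAddCommGroup F'] [NormedSpace ℝ F'] {f : F → F'} {x : F} (hf : ContDiffAt ℝ 2 f x) :
    ∀ᶠ y in 𝓝 x, DifferentiableAt ℝ f y := by
  filter_upwards [hf.eventually (by simp)] with y hy using hy.differentiableAt (by norm_num)

/-- A local homomorphism preserves the bracket defined by the mixed second derivatives. -/
theorem mixedDeriv_sub_map (hm : ContDiffAt ℝ 2 m (e, e)) (h₁ : ∀ᶠ u in 𝓝 e, m (u, e) = u)
    (h₂ : ∀ᶠ w in 𝓝 e, m (e, w) = w) {κ : E → E} (hκ : ContDiffAt ℝ 2 κ e) (hκe : κ e = e)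
    (hom : ∀ᶠ q in 𝓝 (e, e), κ (m q) = m (κ q.1, κ q.2)) (X Y : E) :
    fderiv ℝ κ e (mixedDeriv m e X Y - mixedDeriv m e Y X) =
      mixedDeriv m e (fderiv ℝ κ e X) (fderiv ℝ κ e Y) -
        mixedDeriv m e (fderiv ℝ κ e Y) (fderiv ℝ κ e X) := by
  have hκd : DifferentiableAt ℝ κ e := hκ.differentiableAt (by norm_num)
  have hκ' : HasFDerivAt (fderiv ℝ κ) (fderiv ℝ (fderiv ℝ κ) e) e :=
    ((hκ.fderiv_right (m := 1) (by norm_num)).differentiableAt (by norm_num)).hasFDerivAt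
  have cont_l : Tendsto (fun u : E => (u, e)) (𝓝 e) (𝓝 (e, e)) :=
    (Continuous.prodMk_left e).tendsto e
  -- Differentiate `κ (m (u, w)) = m (κ u, κ w)` in `w` and then in `u` at `e`. The extra term, the
  -- second derivative of `κ`, is symmetric and disappears after antisymmetrizing.
  have key : ∀ X Y, fderiv ℝ (fderiv ℝ κ) e X Y + fderiv ℝ κ e (mixedDeriv m e X Y) =
      mixedDeriv m e (fderiv ℝ κ e X) (fderiv ℝ κ e Y) := by
    intro X Y
    have first : ∀ᶠ u in 𝓝 e, fderiv ℝ κ u (fderiv ℝ m (u, e) (0, Y)) =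
        fderiv ℝ m (κ u, e) (0, fderiv ℝ κ e Y) := by
      have hc : Tendsto (fun u => (κ u, e)) (𝓝 e) (𝓝 (e, e)) := by
        have := (hκd.continuousAt.prodMk (continuousAt_const (y := e)))
        simpa [ContinuousAt, hκe] using this
      filter_upwards [hom.curry_nhds, h₁, eventually_differentiableAt hκ,
        cont_l.eventually (eventually_differentiableAt hm),
        hc.eventually (eventually_differentiableAt hm)] with u hu hu₁ hκu hmu hmκ
      have hκu' : DifferentiableAt ℝ κ (m (u, e)) := by rwa [hu₁]
      have l := hκu'.hasFDerivAt.comp e (hmu.hasFDerivAt.comp e (hasFDerivAt_prodMk_right u e))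
      have hmκ' : DifferentiableAt ℝ m (κ u, κ e) := by rwa [hκe]
      have r := hmκ'.hasFDerivAt.comp e
        ((hasFDerivAt_prodMk_right (κ u) (κ e)).comp e hκd.hasFDerivAt)
      have := congrArg (fun L : E →L[ℝ] E => L Y) (l.unique (r.congr_of_eventuallyEq hu))
      simpa [hu₁, hκe] using this
    have l := hκ'.clm_apply (hasFDerivAt_partial_snd hm Y)
    have r : HasFDerivAt (fun u => fderiv ℝ m (κ u, e) (0, fderiv ℝ κ e Y)) _ e :=
      HasFDerivAt.comp (g := fun u => fderiv ℝ m (u, e) (0, fderiv ℝ κ e Y)) e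
        (by rw [hκe]; exact hasFDerivAt_partial_snd hm _) hκd.hasFDerivAt
    have := congrArg (fun L : E →L[ℝ] E => L X) (l.unique (r.congr_of_eventuallyEq first))
    simp [fderiv_snd_eq (hm.differentiableAt (by norm_num)) h₂] at this
    rw [add_comm]
    exact this
  rw [map_sub, ← key X Y, ← key Y X,
    (hκ.isSymmSndFDerivAt (by simp)).eq X Y]
  abel

/-- The derivative of the adjoint representation is the bracket, in local coordinates. -/
theorem hasFDerivAt_conj (hm : ContDiffAt ℝ 2 m (e, e)) (h₁ : ∀ᶠ u in 𝓝 e, m (u, e) = u)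
    {C : E × E → E} (hC : ContDiffAt ℝ 2 C (e, e))
    (hC₁ : ∀ᶠ u in 𝓝 e, C (u, e) = e) (hC₂ : ∀ᶠ w in 𝓝 e, C (e, w) = w)
    (hom : ∀ᶠ q in 𝓝 (e, e), m (C q, q.1) = m q) (Y : E) :
    ∃ L : E →L[ℝ] E, HasFDerivAt (fun u => fderiv ℝ C (u, e) (0, Y)) L e ∧
      ∀ X, L X = mixedDeriv m e X Y - mixedDeriv m e Y X := by
  refine ⟨_, hasFDerivAt_partial_snd hC Y, fun X => ?_⟩
  have cont_l : Tendsto (fun u : E => (u, e)) (𝓝 e) (𝓝 (e, e)) :=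
    (Continuous.prodMk_left e).tendsto e
  have cont_r : Tendsto (fun u : E => (e, u)) (𝓝 e) (𝓝 (e, e)) :=
    (Continuous.prodMk_right e).tendsto e
  -- The identity `(a x a⁻¹) a = a x` is differentiated in `x` first and in `a` afterwards; in this
  -- form no derivative of the inversion is needed.
  have first : ∀ᶠ u in 𝓝 e, fderiv ℝ m (e, u) (fderiv ℝ C (u, e) (0, Y), 0) =
      fderiv ℝ m (u, e) (0, Y) := by
    filter_upwards [hom.curry_nhds, hC₁, cont_l.eventually (eventually_differentiableAt hC),
      cont_l.eventually (eventually_differentiableAt hm),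
      cont_r.eventually (eventually_differentiableAt hm)] with u hu hu₁ hCu hmu hmu'
    have hmu'' : DifferentiableAt ℝ m (C (u, e), u) := by rwa [hu₁]
    have l := hmu''.hasFDerivAt.comp e ((hasFDerivAt_prodMk_left (C (u, e)) u).comp e
      (hCu.hasFDerivAt.comp e (hasFDerivAt_prodMk_right u e)))
    have r := hmu.hasFDerivAt.comp e (hasFDerivAt_prodMk_right u e)
    have := congrArg (fun L : E →L[ℝ] E => L Y) (l.unique (r.congr_of_eventuallyEq hu))
    simpa [hu₁] using this
  have hl := ((hasFDerivAt_fderiv hm).comp e (hasFDerivAt_prodMk_right e e)).clm_apply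
    ((hasFDerivAt_partial_snd hC Y).prodMk (hasFDerivAt_const (0 : E) e))
  have := congrArg (fun L : E →L[ℝ] E => L X)
    (hl.unique ((hasFDerivAt_partial_snd hm Y).congr_of_eventuallyEq first))
  simp [fderiv_snd_eq (hC.differentiableAt (by norm_num)) hC₂,
    fderiv_fst_eq (hm.differentiableAt (by norm_num)) h₁] at this
  simp only [mixedDeriv]
  rw [← this, (hm.isSymmSndFDerivAt (by simp)).eq (Y, 0) (0, X)]
  simp

end LocalGroup
end HomRicci

/-! ### Bracket and adjoint representation in a chart at the identity -/

namespace HomRicci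
section LieGroupCoordinates

open VectorField

variable {E : Type*} [NormedAddCommGroup E] [NormedSpace ℝ E]
  {G : Type*} [TopologicalSpace G] [ChartedSpace E G] [Group G]

variable (E G) in
/-- The preferred chart of a Lie group at the identity. -/
abbrev oneChart : PartialEquiv G E := extChartAt 𝓘(ℝ, E) (1 : G)

variable (E G) in
/-- The multiplication in the preferred chart at the identity. -/
def localMul (q : E × E) : E :=
  oneChart E G ((oneChart E G).symm q.1 * (oneChart E G).symm q.2)

/-- The map `f : G → G` in the preferred chart at the identity. -/
def inOneChart (f : G → G) (u : E) : E := oneChart E G (f ((oneChart E G).symm u))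

theorem oneChart_symm_one : (oneChart E G).symm (oneChart E G 1) = 1 :=
  extChartAt_to_inv (I := 𝓘(ℝ, E)) (1 : G)

theorem eventually_mem_target : ∀ᶠ u in 𝓝 (oneChart E G 1), u ∈ (oneChart E G).target :=
  extChartAt_target_mem_nhds (I := 𝓘(ℝ, E)) (1 : G)

theorem eventually_mem_source : ∀ᶠ g in 𝓝 (1 : G), g ∈ (oneChart E G).source :=
  extChartAt_source_mem_nhds (I := 𝓘(ℝ, E)) (1 : G)

theorem localMul_one_right : ∀ᶠ u in 𝓝 (oneChart E G 1), localMul E G (u, oneChart E G 1) = u := by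
  filter_upwards [eventually_mem_target] with u hu
  simp only [localMul, oneChart_symm_one, mul_one]
  exact (oneChart E G).right_inv hu

theorem localMul_one_left : ∀ᶠ u in 𝓝 (oneChart E G 1), localMul E G (oneChart E G 1, u) = u := by
  filter_upwards [eventually_mem_target] with u hu
  simp only [localMul, oneChart_symm_one, one_mul]
  exact (oneChart E G).right_inv hu

theorem tendsto_oneChart_symm : Tendsto (oneChart E G).symm (𝓝 (oneChart E G 1)) (𝓝 1) := by
  have := continuousAt_extChartAt_symm (I := 𝓘(ℝ, E)) (1 : G)
  rwa [ContinuousAt, extChartAt_to_inv] at this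

theorem mfderiv_one_eq_fderiv {f : G → G} (hf : ContMDiffAt 𝓘(ℝ, E) 𝓘(ℝ, E) ∞ f 1)
    (hf1 : f 1 = 1) :
    (mfderiv 𝓘(ℝ, E) 𝓘(ℝ, E) f 1 : E →L[ℝ] E) = fderiv ℝ (inOneChart f) (oneChart E G 1) := by
  have := hf.mdifferentiableAt (by simp)
  simp only [mfderiv, this, writtenInExtChartAt, hf1]
  simp
  rfl

theorem lieBracket_of_hasFDerivAt {V W : E → E} {V' W' : E →L[ℝ] E} {x : E}
    (hV : HasFDerivAt V V' x) (hW : HasFDerivAt W W' x) :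
    lieBracket ℝ V W x = W' (V x) - V' (W x) := by
  rw [lieBracket, hV.fderiv, hW.fderiv]

variable [LieGroup 𝓘(ℝ, E) ∞ G]

theorem contMDiffAt_oneChart_symm : ContMDiffAt 𝓘(ℝ, E) 𝓘(ℝ, E) ∞ (oneChart E G).symm
    (oneChart E G 1) :=
  have : IsManifold 𝓘(ℝ, E) ∞ G := inferInstance
  (contMDiffOn_extChartAt_symm (I := 𝓘(ℝ, E)) (n := ∞) (1 : G)).contMDiffAt
    (extChartAt_target_mem_nhds (I := 𝓘(ℝ, E)) (1 : G))

theorem contMDiffAt_oneChart : ContMDiffAt 𝓘(ℝ, E) 𝓘(ℝ, E) ∞ (oneChart E G) 1 :=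
  have : IsManifold 𝓘(ℝ, E) ∞ G := inferInstance
  contMDiffAt_extChartAt

theorem contDiffAt_in_chart₂ {f : G × G → G}
    (hf : ContMDiffAt (𝓘(ℝ, E).prod 𝓘(ℝ, E)) 𝓘(ℝ, E) ∞ f (1, 1)) (hf1 : f (1, 1) = 1) :
    ContDiffAt ℝ 2 (fun q : E × E => oneChart E G (f ((oneChart E G).symm q.1,
      (oneChart E G).symm q.2))) (oneChart E G 1, oneChart E G 1) := by
  have hs := contMDiffAt_oneChart_symm (E := E) (G := G)
  have h1 : ContMDiffAt 𝓘(ℝ, E × E) 𝓘(ℝ, E) ∞ (fun q : E × E => (oneChart E G).symm q.1)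
      (oneChart E G 1, oneChart E G 1) :=
    hs.comp (oneChart E G 1, oneChart E G 1) contDiff_fst.contMDiff.contMDiffAt
  have h2 : ContMDiffAt 𝓘(ℝ, E × E) 𝓘(ℝ, E) ∞ (fun q : E × E => (oneChart E G).symm q.2)
      (oneChart E G 1, oneChart E G 1) :=
    hs.comp (oneChart E G 1, oneChart E G 1) contDiff_snd.contMDiff.contMDiffAt
  have h3 := ContMDiffAt.comp_of_eq (x := (oneChart E G 1, oneChart E G 1)) hf (h1.prodMk h2)
    (by simp only [oneChart_symm_one])
  have h4 := ContMDiffAt.comp_of_eq (x := (oneChart E G 1, oneChart E G 1))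
    (contMDiffAt_oneChart (E := E) (G := G)) h3
    (by simp only [Function.comp, oneChart_symm_one, hf1])
  exact h4.contDiffAt.of_le ENat.LEInfty.out

theorem contDiffAt_inOneChart {f : G → G}
    (hf : ContMDiffAt 𝓘(ℝ, E) 𝓘(ℝ, E) ∞ f 1) (hf1 : f 1 = 1) :
    ContDiffAt ℝ 2 (inOneChart (E := E) f) (oneChart E G 1) := by
  have h3 := ContMDiffAt.comp_of_eq (x := oneChart E G 1) hf
    (contMDiffAt_oneChart_symm (E := E) (G := G)) oneChart_symm_one
  have h4 := ContMDiffAt.comp_of_eq (x := oneChart E G 1)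
    (contMDiffAt_oneChart (E := E) (G := G)) h3
    (by simp only [Function.comp, oneChart_symm_one, hf1])
  exact h4.contDiffAt.of_le ENat.LEInfty.out

theorem contDiffAt_localMul : ContDiffAt ℝ 2 (localMul E G) (oneChart E G 1, oneChart E G 1) :=
  contDiffAt_in_chart₂ (f := fun q : G × G => q.1 * q.2)
    (contMDiff_mul 𝓘(ℝ, E) ∞).contMDiffAt (one_mul 1)

/-- The value of a left-invariant field at a point is the derivative at `1` of left translation by
that point, which in the chart is a partial derivative of the multiplication. The derivative of the
field at the identity is therefore a `mixedDeriv`. -/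
theorem mulInvariantVectorField_inOneChart (X : E) :
    ∀ᶠ u in 𝓝 (oneChart E G 1),
      mpullbackWithin 𝓘(ℝ, E) 𝓘(ℝ, E) (oneChart E G).symm
        (mulInvariantVectorField (I := 𝓘(ℝ, E)) (G := G) X) (range 𝓘(ℝ, E)) u =
      fderiv ℝ (localMul E G) (u, oneChart E G 1) (0, X) := by
  have : IsManifold 𝓘(ℝ, E) ∞ G := inferInstance
  have : IsManifold 𝓘(ℝ, E) 1 G := IsManifold.of_le (n := ∞) ENat.LEInfty.out
  have cont_l : Tendsto (fun u : E => (u, oneChart E G 1)) (𝓝 (oneChart E G 1)) (𝓝 _) :=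
    (Continuous.prodMk_left (oneChart E G 1)).tendsto (oneChart E G 1)
  filter_upwards [eventually_mem_target,
    cont_l.eventually (eventually_differentiableAt contDiffAt_localMul)] with u hu hmu
  have hinv : (mfderivWithin 𝓘(ℝ, E) 𝓘(ℝ, E) (oneChart E G).symm (range 𝓘(ℝ, E)) u).inverse =
      mfderiv 𝓘(ℝ, E) 𝓘(ℝ, E) (oneChart E G) ((oneChart E G).symm u) :=
    ContinuousLinearMap.inverse_eq (mfderivWithin_extChartAt_symm_comp_mfderiv_extChartAt hu)
      (mfderiv_extChartAt_comp_mfderivWithin_extChartAt_symm hu)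
  rw [mpullbackWithin_apply, hinv]
  set g := (oneChart E G).symm u with hg
  have hgs : g ∈ (oneChart E G).source := (oneChart E G).map_target hu
  have hgs' : g * 1 ∈ (chartAt E (1 : G)).source := by
    rw [mul_one]; rwa [extChartAt_source] at hgs
  have hL : MDifferentiableAt 𝓘(ℝ, E) 𝓘(ℝ, E) (g * · : G → G) 1 :=
    (contMDiff_mul_left (I := 𝓘(ℝ, E)) (n := ∞)).contMDiffAt.mdifferentiableAt (by simp)
  have hφ : MDifferentiableAt 𝓘(ℝ, E) 𝓘(ℝ, E) (oneChart E G) (g * 1) :=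
    mdifferentiableAt_extChartAt hgs'
  have hcomp := mfderiv_comp (1 : G) hφ hL
  have h1 : mfderiv 𝓘(ℝ, E) 𝓘(ℝ, E) (oneChart E G ∘ (g * ·)) 1 =
      fderiv ℝ (fun w => localMul E G (u, w)) (oneChart E G 1) := by
    have := hφ.comp (1 : G) hL
    simp only [mfderiv, this, writtenInExtChartAt]
    simp
    rfl
  have h2 := HasFDerivAt.comp (f := fun w => (u, w)) _ hmu.hasFDerivAt
    (hasFDerivAt_prodMk_right u (oneChart E G 1))
  have hg1 : g * 1 = g := mul_one g
  have h3 : fderiv ℝ (fun w => localMul E G (u, w)) (oneChart E G 1) X =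
      (mfderiv 𝓘(ℝ, E) 𝓘(ℝ, E) (oneChart E G) (g * 1) : E →L[ℝ] E)
        ((mfderiv 𝓘(ℝ, E) 𝓘(ℝ, E) (g * · : G → G) 1 : E →L[ℝ] E) X) :=
    congrArg (fun L : E →L[ℝ] E => L X) (h1.symm.trans hcomp)
  have h5 : (mfderiv 𝓘(ℝ, E) 𝓘(ℝ, E) (oneChart E G) (g * 1) : E →L[ℝ] E) =
      mfderiv 𝓘(ℝ, E) 𝓘(ℝ, E) (oneChart E G) g := by
    rw [hg1]
  rw [h5] at h3
  refine h3.symm.trans ?_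
  have h4 := congrArg (fun L : E →L[ℝ] E => L X) h2.fderiv
  refine Eq.trans h4 ?_
  simp

/-- The bracket is that of left-invariant fields. Read in the chart, whose derivative at `1` is the
identity, it is `W' V - V' W` for the fields of `mulInvariantVectorField_inOneChart`. -/
theorem bracket_eq_mixedDeriv (X Y : GroupLieAlgebra 𝓘(ℝ, E) G) :
    (⁅X, Y⁆ : GroupLieAlgebra 𝓘(ℝ, E) G) =
      mixedDeriv (localMul E G) (oneChart E G 1) X Y -
        mixedDeriv (localMul E G) (oneChart E G 1) Y X := by
  have : IsManifold 𝓘(ℝ, E) ∞ G := inferInstance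
  have : IsManifold 𝓘(ℝ, E) 1 G := IsManifold.of_le (n := ∞) ENat.LEInfty.out
  rw [GroupLieAlgebra.bracket_def, mlieBracket, mlieBracketWithin_apply]
  have h1 : (mfderiv 𝓘(ℝ, E) 𝓘(ℝ, E) (oneChart E G) (1 : G) : E →L[ℝ] E) =
      ContinuousLinearMap.id ℝ E := by
    have := mdifferentiableAt_extChartAt (I := 𝓘(ℝ, E)) (mem_chart_source E (1 : G))
    simp only [mfderiv, this, writtenInExtChartAt]
    simp
    refine HasFDerivAt.fderiv ((hasFDerivAt_id _).congr_of_eventuallyEq ?_)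
    filter_upwards [eventually_mem_target (E := E) (G := G)] with u hu
    exact (oneChart E G).right_inv hu
  have h2 : ((mfderiv 𝓘(ℝ, E) 𝓘(ℝ, E) (oneChart E G) (1 : G)).inverse : E →L[ℝ] E) =
      ContinuousLinearMap.id ℝ E :=
    (congrArg (ContinuousLinearMap.inverse (R := ℝ) (M := E) (M₂ := E)) h1).trans
      ContinuousLinearMap.inverse_id
  have V := mulInvariantVectorField_inOneChart (E := E) (G := G)
  have hm := contDiffAt_localMul (E := E) (G := G)
  have hV : ∀ X : E, HasFDerivAt _ _ _ := fun X =>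
    (hasFDerivAt_partial_snd hm X).congr_of_eventuallyEq (V X)
  simp only [modelWithCornersSelf_coe, range_id] at V hV
  refine (congrArg (fun L : E →L[ℝ] E => L _) h2).trans ?_
  simp only [preimage_univ, univ_inter, modelWithCornersSelf_coe, range_id]
  refine (congrFun (lieBracketWithin_univ (𝕜 := ℝ) (E := E)) (oneChart E G 1)).trans ?_
  have hself : ∀ X : E, mpullbackWithin 𝓘(ℝ, E) 𝓘(ℝ, E) (oneChart E G).symm
      (mulInvariantVectorField (I := 𝓘(ℝ, E)) (G := G) X) univ (oneChart E G 1) = X := fun X =>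
    (V X).self_of_nhds.trans
      (fderiv_snd_eq (hm.differentiableAt (by norm_num)) localMul_one_left X)
  refine (lieBracket_of_hasFDerivAt (hV X) (hV Y)).trans ?_
  refine (congrArg₂ (fun a b : E =>
    fderiv ℝ (fderiv ℝ (localMul E G)) (oneChart E G 1, oneChart E G 1) (a, 0) (0, Y) -
    fderiv ℝ (fderiv ℝ (localMul E G)) (oneChart E G 1, oneChart E G 1) (b, 0) (0, X))
    (hself X) (hself Y))

/-- Conjugation by `a`. -/
def conjMap (a x : G) : G := a * x * a⁻¹

theorem contMDiff_conjMap (a : G) : ContMDiff 𝓘(ℝ, E) 𝓘(ℝ, E) ∞ (conjMap a) :=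
  (contMDiff_mul_right (I := 𝓘(ℝ, E)) (n := ∞) (a := a⁻¹)).comp
    (contMDiff_mul_left (I := 𝓘(ℝ, E)) (n := ∞) (a := a))

omit [TopologicalSpace G] in
theorem conjMap_one (a : G) : conjMap a 1 = 1 := by simp [conjMap]

theorem Ad_eq_fderiv (a : G) (X : GroupLieAlgebra 𝓘(ℝ, E) G) :
    Ad a X = fderiv ℝ (inOneChart (E := E) (conjMap a)) (oneChart E G 1) X := by
  have := mfderiv_one_eq_fderiv (contMDiff_conjMap (E := E) a).contMDiffAt (conjMap_one a)
  exact congrArg (fun L : E →L[ℝ] E => L X) this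

omit [LieGroup 𝓘(ℝ, E) ∞ G] in
theorem inOneChart_one {f : G → G} (hf1 : f 1 = 1) :
    inOneChart (E := E) f (oneChart E G 1) = oneChart E G 1 := by
  rw [inOneChart, oneChart_symm_one, hf1]

omit [LieGroup 𝓘(ℝ, E) ∞ G] in
theorem tendsto_comp_symm {f : G → G} (hf : ContMDiff 𝓘(ℝ, E) 𝓘(ℝ, E) ∞ f) (hf1 : f 1 = 1) :
    Tendsto (fun u => f ((oneChart E G).symm u)) (𝓝 (oneChart E G 1)) (𝓝 1) := by
  have h := hf.continuous.tendsto 1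
  rw [hf1] at h
  exact h.comp tendsto_oneChart_symm

theorem Ad_mul (a b : G) (X : GroupLieAlgebra 𝓘(ℝ, E) G) : Ad (a * b) X = Ad a (Ad b X) := by
  have ha := (contDiffAt_inOneChart (contMDiff_conjMap (E := E) a).contMDiffAt
    (conjMap_one a)).differentiableAt (by norm_num)
  have hb := (contDiffAt_inOneChart (contMDiff_conjMap (E := E) b).contMDiffAt
    (conjMap_one b)).differentiableAt (by norm_num)
  rw [Ad_eq_fderiv, Ad_eq_fderiv, Ad_eq_fderiv]
  have hb1 := inOneChart_one (E := E) (conjMap_one b)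
  rw [← hb1] at ha
  have hab := ha.hasFDerivAt.comp _ hb.hasFDerivAt
  have heq : inOneChart (E := E) (conjMap (a * b)) =ᶠ[𝓝 (oneChart E G 1)]
      inOneChart (conjMap a) ∘ inOneChart (conjMap b) := by
    filter_upwards [(tendsto_comp_symm (contMDiff_conjMap (E := E) b) (conjMap_one b)).eventually
      (eventually_mem_source (E := E))] with u hu
    simp only [inOneChart, Function.comp]
    rw [(oneChart E G).left_inv hu]
    simp only [conjMap]
    congr 1
    group
  rw [(hab.congr_of_eventuallyEq heq).fderiv, hb1]
  rfl

theorem Ad_one (X : GroupLieAlgebra 𝓘(ℝ, E) G) : Ad (1 : G) X = X := by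
  rw [Ad_eq_fderiv]
  have : HasFDerivAt (inOneChart (E := E) (conjMap (1 : G))) (ContinuousLinearMap.id ℝ E)
      (oneChart E G 1) := by
    refine (hasFDerivAt_id _).congr_of_eventuallyEq ?_
    filter_upwards [eventually_mem_target (E := E) (G := G)] with u hu
    simp only [inOneChart, conjMap, one_mul, inv_one, mul_one]
    exact (oneChart E G).right_inv hu
  rw [this.fderiv]
  rfl

theorem Ad_inv_Ad (a : G) (X : GroupLieAlgebra 𝓘(ℝ, E) G) : Ad a⁻¹ (Ad a X) = X := by
  rw [← Ad_mul, inv_mul_cancel, Ad_one]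

theorem Ad_Ad_inv (a : G) (X : GroupLieAlgebra 𝓘(ℝ, E) G) : Ad a (Ad a⁻¹ X) = X := by
  rw [← Ad_mul, mul_inv_cancel, Ad_one]

omit [LieGroup 𝓘(ℝ, E) ∞ G] in
theorem tendsto_symm_fst_snd : Tendsto (fun q : E × E => ((oneChart E G).symm q.1,
    (oneChart E G).symm q.2)) (𝓝 (oneChart E G 1, oneChart E G 1)) (𝓝 (1, 1)) := by
  rw [nhds_prod_eq, nhds_prod_eq]
  exact (tendsto_oneChart_symm.comp tendsto_fst).prodMk (tendsto_oneChart_symm.comp tendsto_snd)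

/-- `Ad(a)` preserves the bracket. -/
theorem Ad_lie (a : G) (X Y : GroupLieAlgebra 𝓘(ℝ, E) G) : Ad a ⁅X, Y⁆ = ⁅Ad a X, Ad a Y⁆ := by
  rw [Ad_eq_fderiv, bracket_eq_mixedDeriv X Y, bracket_eq_mixedDeriv (Ad a X), Ad_eq_fderiv a X,
    Ad_eq_fderiv a Y]
  refine mixedDeriv_sub_map contDiffAt_localMul localMul_one_right localMul_one_left
    (contDiffAt_inOneChart (contMDiff_conjMap (E := E) a).contMDiffAt (conjMap_one a))
    (inOneChart_one (conjMap_one a)) ?_ X Y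
  have hs := eventually_mem_source (E := E) (G := G)
  have hmul : Tendsto (fun q : G × G => q.1 * q.2) (𝓝 (1, 1)) (𝓝 1) := by
    have : Continuous fun q : G × G => q.1 * q.2 := (contMDiff_mul 𝓘(ℝ, E) ∞).continuous
    simpa using this.tendsto (1, 1)
  have hc := tendsto_comp_symm (contMDiff_conjMap (E := E) a) (conjMap_one a)
  have c1 := (continuous_fst (X := E) (Y := E)).tendsto (oneChart E G 1, oneChart E G 1)
  have c2 := (continuous_snd (X := E) (Y := E)).tendsto (oneChart E G 1, oneChart E G 1)
  filter_upwards [(hmul.comp tendsto_symm_fst_snd).eventually hs, (hc.comp c1).eventually hs,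
    (hc.comp c2).eventually hs] with q h1 h2 h3
  simp only [Function.comp] at h1 h2 h3
  simp only [inOneChart, localMul]
  rw [(oneChart E G).left_inv h1, (oneChart E G).left_inv h2, (oneChart E G).left_inv h3]
  simp only [conjMap]
  congr 1
  group

/-- The conjugation `(a, x) ↦ a x a⁻¹` in the preferred chart at the identity. -/
def localConj (q : E × E) : E :=
  oneChart E G (conjMap ((oneChart E G).symm q.1) ((oneChart E G).symm q.2))

theorem contMDiff_conjMap₂ :
    ContMDiff (𝓘(ℝ, E).prod 𝓘(ℝ, E)) 𝓘(ℝ, E) ∞ (fun q : G × G => conjMap q.1 q.2) :=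
  (contMDiff_fst.mul contMDiff_snd).mul contMDiff_fst.inv

/-- The derivative of `Ad` at the identity is the bracket. -/
theorem hasDerivAt_Ad {c : ℝ → G} (hc : ContMDiff 𝓘(ℝ, ℝ) 𝓘(ℝ, E) ∞ c) (hc0 : c 0 = 1)
    {X : GroupLieAlgebra 𝓘(ℝ, E) G} (hX : (mfderiv 𝓘(ℝ, ℝ) 𝓘(ℝ, E) c 0 : ℝ →L[ℝ] E) 1 = X)
    (Y : GroupLieAlgebra 𝓘(ℝ, E) G) :
    HasDerivAt (F := E) (fun t => Ad (E := E) (c t) Y) (⁅X, Y⁆ : GroupLieAlgebra 𝓘(ℝ, E) G) 0 := by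
  have hs := eventually_mem_source (E := E) (G := G)
  have hC : ContDiffAt ℝ 2 (localConj (E := E) (G := G)) (oneChart E G 1, oneChart E G 1) :=
    contDiffAt_in_chart₂ contMDiff_conjMap₂.contMDiffAt (by simp [conjMap])
  have hC₁ : ∀ᶠ u in 𝓝 (oneChart E G 1), localConj (G := G) (u, oneChart E G 1) =
      oneChart E G 1 := Eventually.of_forall fun u => by
    simp only [localConj, oneChart_symm_one, conjMap_one]
  have hC₂ : ∀ᶠ w in 𝓝 (oneChart E G 1), localConj (G := G) (oneChart E G 1, w) = w := by
    filter_upwards [eventually_mem_target (E := E) (G := G)] with u hu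
    simp only [localConj, oneChart_symm_one, conjMap, one_mul, inv_one, mul_one]
    exact (oneChart E G).right_inv hu
  have hom : ∀ᶠ q in 𝓝 (oneChart E G 1, oneChart E G 1),
      localMul E G (localConj (G := G) q, q.1) = localMul E G q := by
    have hconj : Tendsto (fun q : G × G => conjMap q.1 q.2) (𝓝 (1, 1)) (𝓝 1) := by
      have : Continuous fun q : G × G => conjMap q.1 q.2 := (contMDiff_conjMap₂ (E := E)).continuous
      simpa [conjMap] using this.tendsto (1, 1)
    filter_upwards [(hconj.comp tendsto_symm_fst_snd).eventually hs] with q h1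
    simp only [Function.comp] at h1
    simp only [localMul, localConj]
    rw [(oneChart E G).left_inv h1]
    simp [conjMap]
  obtain ⟨L, hL, hLX⟩ := hasFDerivAt_conj contDiffAt_localMul localMul_one_right hC hC₁ hC₂ hom Y
  have hcd : HasDerivAt (F := E) (fun t => oneChart E G (c t)) X 0 := by
    have hcm : MDifferentiableAt 𝓘(ℝ, ℝ) 𝓘(ℝ, E) c 0 :=
      hc.contMDiffAt.mdifferentiableAt (by simp)
    have h := hcm.hasMFDerivAt.2
    simp only [writtenInExtChartAt, hc0] at h
    simp only [modelWithCornersSelf_coe, range_id] at h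
    have h' : HasFDerivAt (fun t => oneChart E G (c t))
      (mfderiv 𝓘(ℝ, ℝ) 𝓘(ℝ, E) c 0 : ℝ →L[ℝ] E) 0 := hasFDerivWithinAt_univ.1 h
    exact hX ▸ HasFDerivAt.hasDerivAt (𝕜 := ℝ) (F := E) h'
  have hb : (⁅X, Y⁆ : GroupLieAlgebra 𝓘(ℝ, E) G) = L X :=
    (bracket_eq_mixedDeriv X Y).trans (hLX X).symm
  rw [hb]
  have hL' : HasFDerivAt (fun u => fderiv ℝ (localConj (G := G)) (u, oneChart E G 1) (0, Y)) L
      (oneChart E G (c 0)) := by rwa [hc0]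
  refine (hL'.comp_hasDerivAt (0 : ℝ) hcd).congr_of_eventuallyEq ?_
  have hct : Tendsto c (𝓝 0) (𝓝 1) := by simpa [hc0] using hc.continuous.tendsto 0
  have hpair : Tendsto (fun t => (oneChart E G (c t), oneChart E G 1)) (𝓝 0)
      (𝓝 (oneChart E G 1, oneChart E G 1)) := by
    have := hcd.continuousAt.tendsto
    rw [hc0] at this
    exact this.prodMk_nhds tendsto_const_nhds
  filter_upwards [hct.eventually hs, hpair.eventually (eventually_differentiableAt hC)] with t ht hd
  refine (Ad_eq_fderiv (c t) Y).trans ?_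
  have h := HasFDerivAt.comp (f := fun w => (oneChart E G (c t), w)) _ hd.hasFDerivAt
    (hasFDerivAt_prodMk_right (oneChart E G (c t)) (oneChart E G 1))
  have heq : inOneChart (E := E) (conjMap (c t)) =
      localConj (G := G) ∘ fun w => (oneChart E G (c t), w) := by
    ext w
    simp only [inOneChart, localConj, Function.comp]
    rw [(oneChart E G).left_inv ht]
  rw [heq]
  exact congrArg (fun L : E →L[ℝ] E => L Y) h.fderiv

end LieGroupCoordinates
end HomRicci

/-! ### From `Ad`-invariance to infinitesimal invariance -/

namespace HomRicci
section AdInvariance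

theorem hasDerivAt_mem {V : Type*} [NormedAddCommGroup V] [NormedSpace ℝ V]
    [FiniteDimensional ℝ V] (W : Submodule ℝ V) {f : ℝ → V} {f' : V} {t : ℝ}
    (hf : HasDerivAt f f' t) (hW : ∀ s, f s ∈ W) : f' ∈ W := by
  refine W.closed_of_finiteDimensional.mem_of_tendsto hf.tendsto_slope
    (Eventually.of_forall fun s => ?_)
  rw [slope_def_module]
  exact W.smul_mem _ (W.sub_mem (hW s) (hW t))

theorem hasDerivAt_bilin {V : Type*} [NormedAddCommGroup V] [NormedSpace ℝ V]
    [FiniteDimensional ℝ V] (f : V →ₗ[ℝ] V →ₗ[ℝ] ℝ) {u v : ℝ → V} {u' v' : V} {t : ℝ}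
    (hu : HasDerivAt u u' t) (hv : HasDerivAt v v' t) :
    HasDerivAt (fun s => f (u s) (v s)) (f u' (v t) + f (u t) v') t := by
  let F : V →L[ℝ] V →L[ℝ] ℝ :=
    LinearMap.toContinuousLinearMap (LinearMap.toContinuousLinearMap.toLinearMap ∘ₗ f)
  have := (F.hasFDerivAt.comp_hasDerivAt t hu).clm_apply hv
  exact this

variable {E : Type*} [NormedAddCommGroup E] [NormedSpace ℝ E]
  {G : Type*} [TopologicalSpace G] [ChartedSpace E G] [Group G] [LieGroup 𝓘(ℝ, E) ∞ G]
  {K : Subgroup G} {W p : Submodule ℝ (GroupLieAlgebra 𝓘(ℝ, E) G)}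

/-- Conjugation by an element of the subgroup maps curves in it to curves in it and velocities by
`Ad`. Applied to `H` together with `IsAdInvariant.lie_mem`, this shows that `𝔥` is closed under
brackets. -/
theorem Ad_mem_lieAlgebraOf : IsAdInvariant K (lieAlgebraOf (E := E) K) := by
  intro a ha X hX
  have : lieAlgebraOf (E := E) K ≤ (lieAlgebraOf K).comap (Ad a) := by
    refine Submodule.span_le.2 ?_
    rintro X ⟨c, hc, hc0, hcK, hcX⟩
    refine Submodule.subset_span ⟨fun t => conjMap a (c t), (contMDiff_conjMap a).comp hc, ?_,
      fun t => ?_, ?_⟩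
    · change conjMap a (c 0) = 1
      rw [hc0, conjMap_one]
    · exact K.mul_mem (K.mul_mem ha (hcK t)) (K.inv_mem ha)
    · have h1 : MDifferentiableAt 𝓘(ℝ, E) 𝓘(ℝ, E) (conjMap a) (c 0) :=
        (contMDiff_conjMap a).contMDiffAt.mdifferentiableAt (by simp)
      have h2 : MDifferentiableAt 𝓘(ℝ, ℝ) 𝓘(ℝ, E) c 0 :=
        hc.contMDiffAt.mdifferentiableAt (by simp)
      have h3 := mfderiv_comp (0 : ℝ) h1 h2
      have h4 : (mfderiv 𝓘(ℝ, E) 𝓘(ℝ, E) (conjMap a) (c 0) : E →L[ℝ] E) =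
        mfderiv 𝓘(ℝ, E) 𝓘(ℝ, E) (conjMap a) (1 : G) := by rw [hc0]
      refine (congrArg (fun L : ℝ →L[ℝ] E => L 1) h3).trans ?_
      refine (congrArg (fun L : E →L[ℝ] E =>
        L ((mfderiv 𝓘(ℝ, ℝ) 𝓘(ℝ, E) c 0 : ℝ →L[ℝ] E) 1)) h4).trans ?_
      rw [hcX]
      rfl
  exact this hX

omit [LieGroup 𝓘(ℝ, E) ∞ G] in
theorem IsAdInvariant.sup {V : Submodule ℝ (GroupLieAlgebra 𝓘(ℝ, E) G)}
    (hV : IsAdInvariant K V) (hW : IsAdInvariant K W) : IsAdInvariant K (V ⊔ W) := by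
  intro a ha X hX
  obtain ⟨Y, hY, Z, hZ, rfl⟩ := Submodule.mem_sup.1 hX
  rw [map_add]
  exact Submodule.add_mem_sup (hV a ha Y hY) (hW a ha Z hZ)

/-- To prove a linear property of the elements of the Lie algebra of `K`, it suffices to prove it
for velocities of curves in `K`. -/
theorem lieAlgebraOf_induction {P : GroupLieAlgebra 𝓘(ℝ, E) G → Prop}
    (hcurve : ∀ (X : GroupLieAlgebra 𝓘(ℝ, E) G) (c : ℝ → G), (∀ t, c t ∈ K) →
      (∀ Y : GroupLieAlgebra 𝓘(ℝ, E) G, HasDerivAt (F := E) (fun t => Ad (E := E) (c t) Y)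
        (⁅X, Y⁆ : GroupLieAlgebra 𝓘(ℝ, E) G) 0) → c 0 = 1 → P X)
    (zero : P 0) (add : ∀ X Y, P X → P Y → P (X + Y)) (smul : ∀ (r : ℝ) X, P X → P (r • X))
    {X : GroupLieAlgebra 𝓘(ℝ, E) G} (hX : X ∈ lieAlgebraOf K) : P X := by
  induction hX using Submodule.span_induction with
  | mem X hX =>
    obtain ⟨c, hc, hc0, hcK, hcX⟩ := hX
    exact hcurve X c hcK (fun Y => hasDerivAt_Ad hc hc0 hcX Y) hc0
  | zero => exact zero
  | add X Y _ _ hX hY => exact add X Y hX hY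
  | smul r X _ hX => exact smul r X hX

variable [CompleteSpace E] [FiniteDimensional ℝ E]

/-- For a velocity `X` of a curve `c` in `K`, the bracket is the derivative of `Ad (c t) Y`, a curve
in `W`; subspaces of a finite-dimensional space are closed. -/
theorem IsAdInvariant.lie_mem (hW : IsAdInvariant K W) {X Y : GroupLieAlgebra 𝓘(ℝ, E) G}
    (hX : X ∈ lieAlgebraOf K) (hY : Y ∈ W) : ⁅X, Y⁆ ∈ W := by
  refine lieAlgebraOf_induction (P := fun X => ⁅X, Y⁆ ∈ W) ?_ ?_ ?_ ?_ hX
  · exact fun X c hcK hd _ => hasDerivAt_mem (V := E) W (hd Y) fun s => hW _ (hcK s) Y hY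
  · simp
  · intro X X' hX hX'
    rw [add_lie]
    exact W.add_mem hX hX'
  · intro r X hX
    rw [smul_lie]
    exact W.smul_mem r hX

/-- An invariant metric is infinitesimally invariant. -/
theorem InvariantMetric.skew (hp : IsAdInvariant K p) (g : InvariantMetric K p)
    {Z : GroupLieAlgebra 𝓘(ℝ, E) G} (hZ : Z ∈ lieAlgebraOf K) (X Y X' Y' : p)
    (hX' : (X' : GroupLieAlgebra 𝓘(ℝ, E) G) = ⁅Z, (X : GroupLieAlgebra 𝓘(ℝ, E) G)⁆)
    (hY' : (Y' : GroupLieAlgebra 𝓘(ℝ, E) G) = ⁅Z, (Y : GroupLieAlgebra 𝓘(ℝ, E) G)⁆) :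
    g.form X' Y + g.form X Y' = 0 := by
  -- The form is extended to all of `𝔤` through a projection, so that it can be differentiated along
  -- `Ad (c t) X`. These curves stay in `p`, hence the choice of complement is irrelevant.
  obtain ⟨q, hq⟩ := p.exists_isCompl
  let π := p.projectionOnto q hq
  let f : GroupLieAlgebra 𝓘(ℝ, E) G →ₗ[ℝ] GroupLieAlgebra 𝓘(ℝ, E) G →ₗ[ℝ] ℝ :=
    g.form.compl₁₂ π π
  have hπ : ∀ V (hV : V ∈ p), π V = ⟨V, hV⟩ := fun V hV =>
    Submodule.projectionOnto_apply_left hq ⟨V, hV⟩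
  have hf : ∀ V V' (hV : V ∈ p) (hV' : V' ∈ p), f V V' = g.form ⟨V, hV⟩ ⟨V', hV'⟩ := by
    intro V V' hV hV'
    simp [f, hπ V hV, hπ V' hV']
  have key : f ⁅Z, (X : GroupLieAlgebra 𝓘(ℝ, E) G)⁆ Y + f X ⁅Z, (Y : GroupLieAlgebra 𝓘(ℝ, E) G)⁆
      = 0 := by
    clear hX' hY'
    refine lieAlgebraOf_induction (P := fun Z => f ⁅Z, (X : GroupLieAlgebra 𝓘(ℝ, E) G)⁆ Y +
      f X ⁅Z, (Y : GroupLieAlgebra 𝓘(ℝ, E) G)⁆ = 0) ?_ ?_ ?_ ?_ hZ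
    · intro Z c hcK hd hc0
      have h1 := hasDerivAt_bilin (V := E) f (hd X) (hd Y)
      have h2 : (fun s => f (Ad (c s) X) (Ad (c s) Y)) = fun _ => f X Y := by
        ext s
        rw [hf _ _ (hp _ (hcK s) X X.2) (hp _ (hcK s) Y Y.2), hf _ _ X.2 Y.2]
        exact g.invariant _ (hcK s) _ _ _ _ rfl rfl
      have h3 : HasDerivAt (fun s => f (Ad (c s) X) (Ad (c s) Y)) 0 0 := by
        rw [h2]; exact hasDerivAt_const _ _
      have h4 := h1.unique h3
      have e : ∀ V : GroupLieAlgebra 𝓘(ℝ, E) G, Ad (c 0) V = V := fun V => by rw [hc0, Ad_one]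
      rw [e, e] at h4
      exact h4
    · simp
    · intro Z Z' hZ hZ'
      simp only [add_lie, map_add, LinearMap.add_apply]
      linarith
    · intro r Z hZ
      simp only [smul_lie, map_smul, LinearMap.smul_apply, smul_eq_mul]
      rw [← mul_add, hZ, mul_zero]
  have hX'p : ⁅Z, (X : GroupLieAlgebra 𝓘(ℝ, E) G)⁆ ∈ p := hX' ▸ X'.2
  have hY'p : ⁅Z, (Y : GroupLieAlgebra 𝓘(ℝ, E) G)⁆ ∈ p := hY' ▸ Y'.2
  rw [hf _ _ hX'p Y.2, hf _ _ X.2 hY'p] at key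
  have e1 : X' = ⟨_, hX'p⟩ := Subtype.ext hX'
  have e2 : Y' = ⟨_, hY'p⟩ := Subtype.ext hY'
  rw [e1, e2]
  exact key

/-- `Ad(a)` as an automorphism of the Lie algebra. -/
def AdEquiv (a : G) : GroupLieAlgebra 𝓘(ℝ, E) G ≃ₗ⁅ℝ⁆ GroupLieAlgebra 𝓘(ℝ, E) G where
  toLinearMap := Ad a
  map_lie' {X Y} := Ad_lie a X Y
  invFun := Ad a⁻¹
  left_inv := Ad_inv_Ad a
  right_inv := Ad_Ad_inv a

omit [FiniteDimensional ℝ E] in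
theorem killingForm_Ad (a : G) (X Y : GroupLieAlgebra 𝓘(ℝ, E) G) :
    killingForm ℝ (GroupLieAlgebra 𝓘(ℝ, E) G) (Ad a X) (Ad a Y) =
      killingForm ℝ (GroupLieAlgebra 𝓘(ℝ, E) G) X Y :=
  LieAlgebra.killingForm_of_equiv_apply (AdEquiv a) X Y

end AdInvariance
end HomRicci

/-! ### Traces with respect to a scalar product -/

namespace HomRicci

section Trace

variable {V : Type*} [AddCommGroup V] [Module ℝ V] [FiniteDimensional ℝ V]

theorem ScalarProduct.exists_orthonormal_basis (g : ScalarProduct V) :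
    ∃ b : Module.Basis (Fin (Module.finrank ℝ V)) ℝ V,
      ∀ i j, g.form (b i) (b j) = if i = j then 1 else 0 := by
  let core : InnerProductSpace.Core ℝ V :=
    { inner := fun x y => g.form x y
      conj_inner_symm := fun x y => by simpa using g.symm y x
      re_inner_nonneg := fun x => by
        by_cases hx : x = 0
        · simp [hx]
        · simpa using (g.pos x hx).le
      add_left := fun x y z => by simp
      smul_left := fun x y r => by simp
      definite := fun x hx => by
        by_contra h
        exact (g.pos x h).ne' hx }
  let _ : NormedAddCommGroup V := core.toNormedAddCommGroup
  let _ : InnerProductSpace ℝ V := InnerProductSpace.ofCore core.toCore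
  let b := stdOrthonormalBasis ℝ V
  refine ⟨b.toBasis, fun i j => ?_⟩
  have := orthonormal_iff_ite.1 b.orthonormal i j
  rw [OrthonormalBasis.coe_toBasis]
  exact this

omit [FiniteDimensional ℝ V] in
theorem ScalarProduct.trace_eq_sum (g : ScalarProduct V) {n : ℕ} {b : Module.Basis (Fin n) ℝ V}
    (hb : ∀ i j, g.form (b i) (b j) = if i = j then 1 else 0) (T : V →ₗ[ℝ] V) :
    LinearMap.trace ℝ V T = ∑ i, g.form (T (b i)) (b i) := by
  have hr : ∀ v i, g.form v (b i) = b.repr v i := fun v i => by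
    conv_lhs => rw [← b.sum_repr v]
    rw [map_sum, LinearMap.sum_apply]
    simp [hb]
  rw [LinearMap.trace_eq_matrix_trace ℝ b, Matrix.trace]
  simp [LinearMap.toMatrix_apply, hr]

theorem ScalarProduct.trace_eq_zero_of_skew (g : ScalarProduct V) {T : V →ₗ[ℝ] V}
    (hT : ∀ X Y, g.form (T X) Y = -g.form X (T Y)) : LinearMap.trace ℝ V T = 0 := by
  obtain ⟨b, hb⟩ := g.exists_orthonormal_basis
  rw [g.trace_eq_sum hb]
  refine Finset.sum_eq_zero fun i _ => ?_
  have := hT (b i) (b i)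
  rw [g.symm (b i)] at this
  linarith

omit [FiniteDimensional ℝ V] in
theorem ScalarProduct.nonneg (g : ScalarProduct V) (X : V) : 0 ≤ g.form X X := by
  by_cases hX : X = 0
  · simp [hX]
  · exact (g.pos X hX).le

/-- `T'` is minus the adjoint of `T`, so the trace is minus a sum of squared lengths. The signs of
`B` and `D` in the Ricci tensor come from here. -/
theorem ScalarProduct.trace_comp_nonpos (g : ScalarProduct V) {T T' : V →ₗ[ℝ] V}
    (hT : ∀ X Y, g.form (T X) Y = -g.form X (T' Y)) : LinearMap.trace ℝ V (T ∘ₗ T') ≤ 0 := by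
  obtain ⟨b, hb⟩ := g.exists_orthonormal_basis
  rw [g.trace_eq_sum hb]
  refine Finset.sum_nonpos fun i _ => ?_
  rw [LinearMap.comp_apply, hT]
  linarith [g.nonneg (T' (b i))]

theorem ScalarProduct.abs_trace_le (g : ScalarProduct V) {T : V →ₗ[ℝ] V} {M : ℝ}
    (hT : ∀ X, g.form X X ≤ 1 → |g.form (T X) X| ≤ M) :
    |LinearMap.trace ℝ V T| ≤ Module.finrank ℝ V * M := by
  obtain ⟨b, hb⟩ := g.exists_orthonormal_basis
  rw [g.trace_eq_sum hb]
  refine (Finset.abs_sum_le_sum_abs _ _).trans ?_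
  refine (Finset.sum_le_card_nsmul _ _ M fun i _ => hT _ (by simp [hb])).trans ?_
  simp

omit [FiniteDimensional ℝ V] in
theorem ScalarProduct.eq_of_form_eq (g : ScalarProduct V) {X Y : V}
    (hXY : ∀ Z, g.form X Z = g.form Y Z) : X = Y := by
  by_contra hne
  have := g.pos (X - Y) (sub_ne_zero.2 hne)
  have e : g.form (X - Y) (X - Y) = 0 := by
    rw [map_sub g.form, LinearMap.sub_apply, hXY, sub_self]
  rw [e] at this
  exact this.false

end Trace

/-! ### Symmetries of the Nomizu curvature and of the Ricci tensor -/

section Curvature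

variable {L : Type*} [LieRing L] [LieAlgebra ℝ L] {p k : Submodule ℝ L} (h : IsCompl p k)

theorem brP_apply (X Y : p) : brP h X Y = p.projectionOnto k h ⁅(X : L), (Y : L)⁆ := rfl

theorem brP_swap (X Y : p) : brP h X Y = -brP h Y X := by
  rw [brP_apply, brP_apply, ← lie_skew, map_neg]

theorem isotropyTerm_swap (X Y Z : p) : isotropyTerm h X Y Z = -isotropyTerm h Y X Z := by
  simp only [isotropyTerm]
  rw [← lie_skew (X : L) (Y : L), map_neg, Submodule.coe_neg, neg_lie, map_neg]

theorem proj_add_proj (v : L) :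
    (p.projectionOnto k h v : L) + (k.projectionOnto p h.symm v : L) = v := by
  have := Submodule.projection_add_projection_eq_self h v
  simpa [Submodule.coe_projectionOnto_apply] using this

theorem jacobi_split (X Y Z : p) :
    brP h X (brP h Y Z) - isotropyTerm h Y Z X =
      p.projectionOnto k h ⁅(X : L), ⁅(Y : L), (Z : L)⁆⁆ := by
  conv_rhs => rw [← proj_add_proj h ⁅(Y : L), (Z : L)⁆, lie_add, map_add]
  rw [← lie_skew (X : L) (k.projectionOnto p h.symm _ : L), map_neg, ← sub_eq_add_neg]
  rfl

theorem jacobi_cyclic (X Y Z : p) :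
    brP h X (brP h Y Z) + brP h Y (brP h Z X) + brP h Z (brP h X Y) =
      isotropyTerm h X Y Z + isotropyTerm h Y Z X + isotropyTerm h Z X Y := by
  have e : p.projectionOnto k h ⁅(X : L), ⁅(Y : L), (Z : L)⁆⁆ +
      p.projectionOnto k h ⁅(Y : L), ⁅(Z : L), (X : L)⁆⁆ +
      p.projectionOnto k h ⁅(Z : L), ⁅(X : L), (Y : L)⁆⁆ = 0 := by
    rw [← map_add, ← map_add, lie_jacobi, map_zero]
  rw [← jacobi_split, ← jacobi_split, ← jacobi_split] at e
  rw [← sub_eq_zero, ← e]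
  abel

variable [FiniteDimensional ℝ L] (g : ScalarProduct p)

theorem nomizu_form (X Y Z : p) : g.form (nomizu h g X Y) Z =
    1 / 2 * (g.form (brP h X Y) Z + g.form (brP h Z X) Y + g.form (brP h Z Y) X) := by
  have : g.form (nomizu h g X Y) Z = koszul h g X Y Z :=
    LinearMap.BilinForm.apply_toDual_symm_apply (hB := g.nondegenerate) _ _
  rw [this]
  simp [koszul]
  ring

theorem nomizu_skew (X Y Z : p) :
    g.form (nomizu h g X Y) Z = -g.form Y (nomizu h g X Z) := by
  rw [g.symm Y, nomizu_form, nomizu_form, brP_swap h Y X, brP_swap h Y Z, brP_swap h Z X]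
  simp
  ring

theorem nomizu_torsion (X Y : p) : nomizu h g X Y - nomizu h g Y X = brP h X Y := by
  refine g.eq_of_form_eq fun Z => ?_
  rw [map_sub, LinearMap.sub_apply, nomizu_form, nomizu_form, brP_swap h Y X]
  simp
  ring

/-- Torsion-freeness of `Λ` cancels all terms containing the metric; what remains is the `𝔭`-part of
the Jacobi identity. -/
theorem bianchi (X Y Z : p) :
    curvature h g X Y Z + curvature h g Y Z X + curvature h g Z X Y = 0 := by
  have t : ∀ X Y, nomizu h g X Y = nomizu h g Y X + brP h X Y := fun X Y => by
    rw [← nomizu_torsion h g X Y]; abel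
  have e : curvature h g X Y Z + curvature h g Y Z X + curvature h g Z X Y =
      (brP h X (brP h Y Z) + brP h Y (brP h Z X) + brP h Z (brP h X Y)) -
      (isotropyTerm h X Y Z + isotropyTerm h Y Z X + isotropyTerm h Z X Y) := by
    simp only [curvature]
    rw [t Y Z, t Z X, t X Y]
    simp only [map_add]
    rw [t X (brP h Y Z), t Y (brP h Z X), t Z (brP h X Y)]
    abel
  rw [e, jacobi_cyclic, sub_self]

theorem curvature_swap (X Y Z : p) : curvature h g X Y Z = -curvature h g Y X Z := by
  simp only [curvature]
  rw [brP_swap h X Y, isotropyTerm_swap h X Y Z]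
  simp only [map_neg, LinearMap.neg_apply]
  abel

variable {h g}

/-- The scalar product `g` on `𝔭` is infinitesimally invariant under `𝔨`. -/
def IsotropySkew (h : IsCompl p k) (g : ScalarProduct p) : Prop :=
  ∀ X Y Z W, g.form (isotropyTerm h X Y Z) W = -g.form Z (isotropyTerm h X Y W)

theorem curvature_skew (hg : IsotropySkew h g) (X Y Z W : p) :
    g.form (curvature h g X Y Z) W = -g.form Z (curvature h g X Y W) := by
  simp only [curvature, map_sub, LinearMap.sub_apply]
  rw [hg, nomizu_skew h g (brP h X Y), nomizu_skew h g X, nomizu_skew h g Y,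
    nomizu_skew h g Y (nomizu h g X Z), nomizu_skew h g X Z]
  ring

/-- By the first Bianchi identity `Ric(X,Y) - Ric(Y,X)` is the trace of `-R(X,Y)`, and `R(X,Y)` is
skew once the isotropy acts by skew maps. Schur's lemma for symmetric forms can then be applied to
the Ricci tensor. -/
theorem ricci_symm (hg : IsotropySkew h g) (X Y : p) : ricci h g X Y = ricci h g Y X := by
  let T : p →ₗ[ℝ] p :=
    { toFun := fun Z => curvature h g X Y Z
      map_add' := fun Z Z' => by simp [curvature, isotropyTerm]; abel
      map_smul' := fun c Z => by simp [curvature, isotropyTerm, smul_sub] }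
  have hT : LinearMap.trace ℝ p T = 0 := g.trace_eq_zero_of_skew (curvature_skew hg X Y)
  have e : curvatureEnd h g X Y - curvatureEnd h g Y X = -T := by
    ext1 Z
    change curvature h g Z X Y - curvature h g Z Y X = -curvature h g X Y Z
    have := bianchi h g X Y Z
    rw [curvature_swap h g Y Z X] at this
    rw [eq_neg_iff_add_eq_zero, ← this]
    abel
  have := congrArg (LinearMap.trace ℝ p) e
  rw [map_sub, map_neg, hT, neg_zero, sub_eq_zero] at this
  exact this

variable (h g)

/-- The Ricci tensor as a bilinear form. -/
def ricciForm : p →ₗ[ℝ] p →ₗ[ℝ] ℝ :=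
  LinearMap.mk₂ ℝ (fun X Y => ricci h g X Y)
    (fun X X' Y => by
      rw [ricci, ricci, ricci, ← map_add]
      congr 1
      ext1 Z
      change curvature h g Z (X + X') Y = curvature h g Z X Y + curvature h g Z X' Y
      simp [curvature, isotropyTerm]
      abel)
    (fun c X Y => by
      rw [ricci, ricci, ← map_smul]
      congr 1
      ext1 Z
      change curvature h g Z (c • X) Y = c • curvature h g Z X Y
      simp [curvature, isotropyTerm, smul_sub])
    (fun X Y Y' => by
      rw [ricci, ricci, ricci, ← map_add]
      congr 1
      ext1 Z
      change curvature h g Z X (Y + Y') = curvature h g Z X Y + curvature h g Z X Y'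
      simp [curvature, isotropyTerm]
      abel)
    (fun c X Y => by
      rw [ricci, ricci, ← map_smul]
      congr 1
      ext1 Z
      change curvature h g Z X (c • Y) = c • curvature h g Z X Y
      simp [curvature, isotropyTerm, smul_sub])

theorem ricciForm_apply (X Y : p) : ricciForm h g X Y = ricci h g X Y := rfl

variable {h g}

theorem abs_ricci_le {M : ℝ} (hM : CurvatureBoundedBy h g M) {X : p} (hX : g.form X X ≤ 1) :
    |ricci h g X X| ≤ Module.finrank ℝ p * M :=
  g.abs_trace_le fun Z hZ => hM Z X X Z hZ hX hX hZ

/-- An automorphism of the Lie algebra which preserves `𝔭`, `𝔨` and the metric preserves the Ricci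
tensor. -/
theorem ricci_map (A : L →ₗ⁅ℝ⁆ L) (hk : ∀ Z ∈ k, A Z ∈ k) (σ : p ≃ₗ[ℝ] p)
    (hσ : ∀ X : p, (σ X : L) = A X) (hg : ∀ X Y, g.form (σ X) (σ Y) = g.form X Y) (X Y : p) :
    ricci h g (σ X) (σ Y) = ricci h g X Y := by
  have projA : ∀ v : L, A v = (σ (p.projectionOnto k h v) : L) +
      A (k.projectionOnto p h.symm v : L) := fun v => by
    conv_lhs => rw [← proj_add_proj h v, map_add, ← hσ]
  have hp : ∀ v : L, p.projectionOnto k h (A v) = σ (p.projectionOnto k h v) := fun v => by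
    rw [projA v, map_add, Submodule.projectionOnto_apply_left,
      Submodule.projectionOnto_apply_right h ⟨_, hk _ (SetLike.coe_mem _)⟩, add_zero]
  have hk' : ∀ v : L, (k.projectionOnto p h.symm (A v) : L) = A (k.projectionOnto p h.symm v) :=
    fun v => by
      rw [projA v, map_add, Submodule.projectionOnto_apply_right h.symm,
        Submodule.projectionOnto_apply_left h.symm ⟨_, hk _ (SetLike.coe_mem _)⟩, zero_add]
  have hbr : ∀ X Y, brP h (σ X) (σ Y) = σ (brP h X Y) := fun X Y => by
    rw [brP_apply, brP_apply, hσ, hσ, ← LieHom.map_lie, hp]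
  have hiso : ∀ X Y Z, isotropyTerm h (σ X) (σ Y) (σ Z) = σ (isotropyTerm h X Y Z) :=
    fun X Y Z => by
      simp only [isotropyTerm]
      rw [hσ, hσ, hσ, ← LieHom.map_lie, hk', ← LieHom.map_lie, hp]
  have hnom : ∀ X Y, nomizu h g (σ X) (σ Y) = σ (nomizu h g X Y) := fun X Y => by
    refine g.eq_of_form_eq fun Z => ?_
    obtain ⟨Z, rfl⟩ := σ.surjective Z
    rw [hg, nomizu_form, nomizu_form, hbr, hbr, hbr, hg, hg, hg]
  have hcurv : ∀ X Y Z, curvature h g (σ X) (σ Y) (σ Z) = σ (curvature h g X Y Z) :=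
    fun X Y Z => by
      simp only [curvature, map_sub, hnom, hbr, hiso]
  have e : curvatureEnd h g (σ X) (σ Y) = σ.conj (curvatureEnd h g X Y) := by
    ext1 Z
    rw [LinearEquiv.conj_apply_apply]
    obtain ⟨Z, rfl⟩ := σ.surjective Z
    rw [σ.symm_apply_apply]
    exact hcurv Z X Y
  rw [ricci, e, LinearMap.trace_conj', ricci]

end Curvature
end HomRicci

/-! ### Ricci curvature of a two-parameter family of split metrics -/

namespace HomRicci

section TwoSummands

variable {L : Type*} [LieRing L] [LieAlgebra ℝ L] {p k : Submodule ℝ L}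

/-- The algebraic data of an orthogonal splitting `𝔭 = 𝔭₁ ⊕ 𝔭₂` for which `𝔨 ⊕ 𝔭₁` is a
subalgebra; `β` is minus the Killing form on `𝔭`. -/
structure IsSplitting (h : IsCompl p k) {q₁ q₂ : Submodule ℝ p} (_ : IsCompl q₁ q₂)
    (β : ScalarProduct p) : Prop where
  skew : ∀ X Y Z, β.form (brP h X Y) Z = -β.form Y (brP h X Z)
  orthogonal : ∀ X ∈ q₁, ∀ Y ∈ q₂, β.form X Y = 0
  brP_mem : ∀ X ∈ q₁, ∀ Y ∈ q₁, brP h X Y ∈ q₁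
  isotropyTerm_eq_zero : ∀ X ∈ q₁, ∀ Y ∈ q₂, ∀ Z, isotropyTerm h X Y Z = 0

/-- `g = x₁ β|𝔭₁ ⊕ x₂ β|𝔭₂`. -/
def IsSplitMetric {q₁ q₂ : Submodule ℝ p} (hq : IsCompl q₁ q₂) (β g : ScalarProduct p)
    (x₁ x₂ : ℝ) : Prop :=
  ∀ X Y, g.form X Y = x₁ * β.form (q₁.projection q₂ hq X) (q₁.projection q₂ hq Y) +
    x₂ * β.form (q₂.projection q₁ hq.symm X) (q₂.projection q₁ hq.symm Y)

theorem brP_self (h : IsCompl p k) (X : p) : brP h X X = 0 := by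
  rw [brP_apply, lie_self, map_zero]

namespace IsSplitting

variable {h : IsCompl p k} {q₁ q₂ : Submodule ℝ p} {hq : IsCompl q₁ q₂} {β : ScalarProduct p}

local notation "P₁" => Submodule.projection q₁ q₂ hq
local notation "P₂" => Submodule.projection q₂ q₁ (IsCompl.symm hq)

variable (hq) in
theorem proj_add (X : p) : P₁ X + P₂ X = X :=
  Submodule.projection_add_projection_eq_self hq X

variable (hq) in
theorem proj_of_mem {X : p} (hX : X ∈ q₁) : P₁ X = X :=
  Submodule.projection_apply_of_mem_left hq hX

variable (hq) in
theorem proj_eq_zero {X : p} (hX : X ∈ q₂) : P₁ X = 0 :=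
  (Submodule.projection_apply_eq_zero_iff hq).2 hX

theorem form_proj₁_left (S : IsSplitting h hq β) (X Y : p) :
    β.form (P₁ X) Y = β.form (P₁ X) (P₁ Y) := by
  nth_rw 1 [← proj_add hq Y]
  rw [map_add, S.orthogonal _ (Submodule.projection_apply_mem hq X) _
      (Submodule.projection_apply_mem hq.symm Y), add_zero]

theorem form_proj₂_left (S : IsSplitting h hq β) (X Y : p) :
    β.form (P₂ X) Y = β.form (P₂ X) (P₂ Y) := by
  nth_rw 1 [← proj_add hq Y]
  rw [map_add, β.symm _ (P₁ Y), S.orthogonal _ (Submodule.projection_apply_mem hq Y) _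
      (Submodule.projection_apply_mem hq.symm X), zero_add]

theorem form_proj₁_right (S : IsSplitting h hq β) (X Y : p) :
    β.form X (P₁ Y) = β.form (P₁ X) (P₁ Y) := by
  rw [β.symm, S.form_proj₁_left, β.symm]

theorem form_proj₂_right (S : IsSplitting h hq β) (X Y : p) :
    β.form X (P₂ Y) = β.form (P₂ X) (P₂ Y) := by
  rw [β.symm, S.form_proj₂_left, β.symm]

/-- The map `brP h X` is `β`-skew and preserves `q₁`, hence it preserves the orthogonal space `q₂`.
-/
theorem brP_mem₁₂ (S : IsSplitting h hq β) {X Y : p} (hX : X ∈ q₁) (hY : Y ∈ q₂) :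
    brP h X Y ∈ q₂ := by
  rw [← Submodule.projection_apply_eq_zero_iff hq]
  by_contra hne
  have := β.pos _ hne
  rw [← S.form_proj₁_right, S.skew, β.symm,
    S.orthogonal _ (S.brP_mem _ hX _ (Submodule.projection_apply_mem hq _)) _ hY] at this
  simp at this

theorem brP_mem₂₁ (S : IsSplitting h hq β) {X Y : p} (hX : X ∈ q₂) (hY : Y ∈ q₁) :
    brP h X Y ∈ q₂ := by
  rw [brP_swap]
  exact q₂.neg_mem (S.brP_mem₁₂ hY hX)

theorem isSplitMetric_self (S : IsSplitting h hq β) : IsSplitMetric hq β β 1 1 := by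
  intro X Y
  rw [one_mul, one_mul, ← S.form_proj₁_left, ← S.form_proj₂_left, ← LinearMap.add_apply, ← map_add,
    proj_add hq]

variable [FiniteDimensional ℝ L] {g : ScalarProduct p} {x₁ x₂ : ℝ}

/-- In Koszul's formula, skewness of `brP` for `β` moves `Z` out of the brackets in the last two
terms. Their sum pairs `Z` with `x₂ - x₁` times a vector of `q₂`; there `g` is `x₂ β`, so dividing
by `x₂` leaves only the ratio `x₁ / x₂`. -/
theorem nomizu_eq (S : IsSplitting h hq β) (hg : IsSplitMetric hq β g x₁ x₂) (hx₂ : 0 < x₂)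
    (X Y : p) : nomizu h g X Y = (1 / 2 : ℝ) • brP h X Y +
      ((1 - x₁ / x₂) / 2) • (brP h (P₁ X) (P₂ Y) - brP h (P₂ X) (P₁ Y)) := by
  have hgβ : ∀ V Y, g.form V Y = β.form V (x₁ • P₁ Y + x₂ • P₂ Y) := fun V Y => by
    rw [hg, map_add, map_smul, map_smul, S.form_proj₁_right V, S.form_proj₂_right V, smul_eq_mul,
      smul_eq_mul]
  have hW : brP h (P₁ X) (P₂ Y) - brP h (P₂ X) (P₁ Y) ∈ q₂ :=
    q₂.sub_mem (S.brP_mem₁₂ (Submodule.projection_apply_mem hq X)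
      (Submodule.projection_apply_mem hq.symm Y))
      (S.brP_mem₂₁ (Submodule.projection_apply_mem hq.symm X) (Submodule.projection_apply_mem hq Y))
  have hgW : ∀ W ∈ q₂, ∀ Z, g.form W Z = x₂ * β.form Z W := fun W hW Z => by
    have e : β.form W (P₂ Z) = β.form Z W := by
      rw [S.form_proj₂_right, ← S.form_proj₂_left, proj_of_mem hq.symm hW, β.symm]
    rw [hg, proj_eq_zero hq hW, proj_of_mem hq.symm hW, e, map_zero, LinearMap.zero_apply, mul_zero,
      zero_add]
  have hbr : brP h X (x₁ • P₁ Y + x₂ • P₂ Y) + brP h Y (x₁ • P₁ X + x₂ • P₂ X) =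
      (x₂ - x₁) • (brP h (P₁ X) (P₂ Y) - brP h (P₂ X) (P₁ Y)) := by
    have aux : ∀ X₁ X₂ Y₁ Y₂ : p,
        brP h (X₁ + X₂) (x₁ • Y₁ + x₂ • Y₂) + brP h (Y₁ + Y₂) (x₁ • X₁ + x₂ • X₂) =
        (x₂ - x₁) • (brP h X₁ Y₂ - brP h X₂ Y₁) := fun X₁ X₂ Y₁ Y₂ => by
      rw [brP_swap h (Y₁ + Y₂)]
      simp only [map_add, map_smul, LinearMap.add_apply, LinearMap.smul_apply]
      module
    simpa only [proj_add hq] using aux (P₁ X) (P₂ X) (P₁ Y) (P₂ Y)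
  refine g.eq_of_form_eq fun Z => ?_
  rw [nomizu_form, hgβ (brP h Z X) Y, hgβ (brP h Z Y) X, brP_swap h Z X, brP_swap h Z Y]
  simp only [map_neg, LinearMap.neg_apply]
  rw [S.skew, S.skew, neg_neg, neg_neg, add_assoc, ← map_add, hbr]
  simp only [map_add g.form, map_smul g.form, LinearMap.add_apply, LinearMap.smul_apply,
    smul_eq_mul]
  rw [hgW _ hW, map_smul, smul_eq_mul]
  field_simp

theorem nomizu₁₁ (S : IsSplitting h hq β) (hg : IsSplitMetric hq β g x₁ x₂) (hx₂ : 0 < x₂)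
    {X Y : p} (hX : X ∈ q₁) (hY : Y ∈ q₁) : nomizu h g X Y = (1 / 2 : ℝ) • brP h X Y := by
  rw [S.nomizu_eq hg hx₂, proj_eq_zero hq.symm hX, proj_eq_zero hq.symm hY]
  simp

theorem nomizu₂₂ (S : IsSplitting h hq β) (hg : IsSplitMetric hq β g x₁ x₂) (hx₂ : 0 < x₂)
    {X Y : p} (hX : X ∈ q₂) (hY : Y ∈ q₂) : nomizu h g X Y = (1 / 2 : ℝ) • brP h X Y := by
  rw [S.nomizu_eq hg hx₂, proj_eq_zero hq hX, proj_eq_zero hq hY]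
  simp

theorem nomizu₁₂ (S : IsSplitting h hq β) (hg : IsSplitMetric hq β g x₁ x₂) (hx₂ : 0 < x₂)
    {X Y : p} (hX : X ∈ q₁) (hY : Y ∈ q₂) :
    nomizu h g X Y = (1 - x₁ / x₂ / 2) • brP h X Y := by
  rw [S.nomizu_eq hg hx₂, proj_eq_zero hq.symm hX, proj_eq_zero hq hY, proj_of_mem hq hX,
    proj_of_mem hq.symm hY]
  simp only [map_zero, sub_zero]
  module

theorem nomizu₂₁ (S : IsSplitting h hq β) (hg : IsSplitMetric hq β g x₁ x₂) (hx₂ : 0 < x₂)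
    {X Y : p} (hX : X ∈ q₂) (hY : Y ∈ q₁) :
    nomizu h g X Y = (x₁ / x₂ / 2) • brP h X Y := by
  rw [S.nomizu_eq hg hx₂, proj_eq_zero hq hX, proj_eq_zero hq.symm hY, proj_of_mem hq.symm hX,
    proj_of_mem hq hY]
  simp only [map_zero, zero_sub]
  module

theorem curvature₁₁ (S : IsSplitting h hq β) (hg : IsSplitMetric hq β g x₁ x₂) (hx₂ : 0 < x₂)
    {X Z : p} (hX : X ∈ q₁) (hZ : Z ∈ q₁) :
    curvature h g Z X X = (1 / 4 : ℝ) • brP h X (brP h Z X) - isotropyTerm h Z X X := by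
  have hZX := S.brP_mem Z hZ X hX
  have hXX := brP_self h X
  rw [curvature, S.nomizu₁₁ hg hx₂ hX hX, S.nomizu₁₁ hg hx₂ hZ hX, map_smul, map_smul,
    S.nomizu₁₁ hg hx₂ hX hZX, S.nomizu₁₁ hg hx₂ hZX hX, hXX, brP_swap h (brP h Z X) X]
  simp only [map_zero]
  module

/-- With `y = x₁ / x₂`, the coefficient is `-(y/2)(1 - y/2) + y/2 = y²/4`. This cancellation is the
reason why the Ricci tensor on `𝔭₁` has no term linear in `y`. -/
theorem curvature₂₁ (S : IsSplitting h hq β) (hg : IsSplitMetric hq β g x₁ x₂) (hx₂ : 0 < x₂)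
    {X Z : p} (hX : X ∈ q₁) (hZ : Z ∈ q₂) :
    curvature h g Z X X = ((x₁ / x₂) ^ 2 / 4) • brP h X (brP h Z X) := by
  have hZX := S.brP_mem₂₁ hZ hX
  have hXX := brP_self h X
  rw [curvature, isotropyTerm_swap, S.isotropyTerm_eq_zero X hX Z hZ, S.nomizu₁₁ hg hx₂ hX hX,
    S.nomizu₂₁ hg hx₂ hZ hX, map_smul, map_smul,
    S.nomizu₁₂ hg hx₂ hX hZX, S.nomizu₂₁ hg hx₂ hZX hX, hXX, brP_swap h (brP h Z X) X]
  simp only [map_zero]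
  module

theorem curvature₁₂ (S : IsSplitting h hq β) (hg : IsSplitMetric hq β g x₁ x₂) (hx₂ : 0 < x₂)
    {X Z : p} (hX : X ∈ q₂) (hZ : Z ∈ q₁) :
    curvature h g Z X X = (x₁ / x₂ / 4) • brP h X (brP h Z X) := by
  have hZX := S.brP_mem₁₂ hZ hX
  have hXX := brP_self h X
  rw [curvature, S.isotropyTerm_eq_zero Z hZ X hX, S.nomizu₂₂ hg hx₂ hX hX,
    S.nomizu₁₂ hg hx₂ hZ hX, map_smul, map_smul,
    S.nomizu₂₂ hg hx₂ hX hZX, S.nomizu₂₂ hg hx₂ hZX hX, hXX, brP_swap h (brP h Z X) X]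
  simp only [map_zero]
  module

theorem curvature₂₂ (S : IsSplitting h hq β) (hg : IsSplitMetric hq β g x₁ x₂) (hx₂ : 0 < x₂)
    {X Z : p} (hX : X ∈ q₂) (hZ : Z ∈ q₂) :
    curvature h g Z X X = (-(3 / 4) * (x₁ / x₂)) • brP h X (P₁ (brP h Z X)) +
      brP h X (P₁ (brP h Z X)) + (1 / 4 : ℝ) • brP h X (P₂ (brP h Z X))
      - isotropyTerm h Z X X := by
  have hXX := brP_self h X
  have hW₁ := Submodule.projection_apply_mem hq (brP h Z X)
  have hW₂ := Submodule.projection_apply_mem hq.symm (brP h Z X)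
  have hW := proj_add hq (brP h Z X)
  rw [curvature, S.nomizu₂₂ hg hx₂ hX hX, S.nomizu₂₂ hg hx₂ hZ hX, map_smul, map_smul, hXX]
  generalize P₁ (brP h Z X) = W₁ at *
  generalize P₂ (brP h Z X) = W₂ at *
  rw [← hW, map_add, map_add, LinearMap.add_apply, S.nomizu₂₁ hg hx₂ hX hW₁,
    S.nomizu₂₂ hg hx₂ hX hW₂, S.nomizu₁₂ hg hx₂ hW₁ hX, S.nomizu₂₂ hg hx₂ hW₂ hX,
    brP_swap h W₁ X, brP_swap h W₂ X]
  simp only [map_zero]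
  module

omit [FiniteDimensional ℝ L] in
theorem ext_split {T T' : p →ₗ[ℝ] p} (hq : IsCompl q₁ q₂) (h₁ : ∀ Z ∈ q₁, T Z = T' Z)
    (h₂ : ∀ Z ∈ q₂, T Z = T' Z) : T = T' := by
  ext1 Z
  rw [← Submodule.projection_add_projection_eq_self hq Z, map_add, map_add,
    h₁ _ (Submodule.projection_apply_mem hq Z), h₂ _ (Submodule.projection_apply_mem hq.symm Z)]

theorem curvatureEnd_apply (X Y Z : p) : curvatureEnd h g X Y Z = curvature h g Z X Y := rfl

/-- On `𝔭₁`, the Ricci tensor is a quadratic polynomial in `x₁ / x₂` without linear term. -/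
theorem ricci₁ (S : IsSplitting h hq β) {X : p} (hX : X ∈ q₁) :
    ∃ A B : ℝ, 0 ≤ B ∧ ∀ (g : ScalarProduct p) (x₁ x₂ : ℝ), IsSplitMetric hq β g x₁ x₂ → 0 < x₂ →
      ricci h g X X = A + B * (x₁ / x₂) ^ 2 := by
  let a := brP h X
  -- All dependence on `y` comes from `Z ∈ q₂`, where the curvature endomorphism is `-(y²/4) U`;
  -- hence `B = -tr U / 4`, and its sign is that of a squared skew map.
  let U : p →ₗ[ℝ] p := a ∘ₗ a ∘ₗ P₂
  have hU : LinearMap.trace ℝ p U ≤ 0 := by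
    have e : U = (a ∘ₗ P₂ ∘ₗ a) ∘ₗ P₂ := by
      refine ext_split hq (fun Z hZ => ?_) fun Z hZ => ?_
      · simp [U, proj_eq_zero hq.symm hZ]
      · simp only [U, LinearMap.comp_apply]
        rw [proj_of_mem hq.symm hZ, proj_of_mem hq.symm (S.brP_mem₁₂ hX hZ)]
    have skew : ∀ V W, β.form ((P₂ ∘ₗ a ∘ₗ P₂) V) W = -β.form V ((P₂ ∘ₗ a ∘ₗ P₂) W) := fun V W => by
      simp only [LinearMap.comp_apply]
      rw [S.form_proj₂_left, ← S.form_proj₂_right, S.skew, S.form_proj₂_left, S.form_proj₂_right V]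
    have e'' : (P₂ ∘ₗ a ∘ₗ P₂) ∘ₗ (P₂ ∘ₗ a ∘ₗ P₂) = P₂ ∘ₗ (a ∘ₗ P₂ ∘ₗ a ∘ₗ P₂) := by
      ext1 Z
      simp only [LinearMap.comp_apply]
      rw [proj_of_mem hq.symm (Submodule.projection_apply_mem hq.symm (a (P₂ Z)))]
    have hle := β.trace_comp_nonpos skew
    rw [e'', LinearMap.trace_comp_comm'] at hle
    refine le_of_eq_of_le (congrArg _ ?_) hle
    rw [e]
    ext1 Z
    simp only [LinearMap.comp_apply]
    rw [proj_of_mem hq.symm (Submodule.projection_apply_mem hq.symm Z)]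
  -- The metric `β`, whose ratio is `1 / 1`, serves as reference: adding back the `y`-dependent part
  -- gives the same endomorphism for `g` and for `β`.
  have hc : ∀ (g : ScalarProduct p) (x₁ x₂ : ℝ), IsSplitMetric hq β g x₁ x₂ → 0 < x₂ →
      curvatureEnd h g X X + ((x₁ / x₂) ^ 2 / 4) • U =
        curvatureEnd h β X X + ((1 / 1 : ℝ) ^ 2 / 4) • U := by
    intro g x₁ x₂ hg hx₂
    refine ext_split hq (fun Z hZ => ?_) fun Z hZ => ?_
    · simp only [LinearMap.add_apply, LinearMap.smul_apply, LinearMap.comp_apply, U,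
        curvatureEnd_apply]
      rw [proj_eq_zero hq.symm hZ, S.curvature₁₁ hg hx₂ hX hZ,
        S.curvature₁₁ S.isSplitMetric_self one_pos hX hZ]
      simp
    · simp only [LinearMap.add_apply, LinearMap.smul_apply, LinearMap.comp_apply, U,
        curvatureEnd_apply]
      rw [proj_of_mem hq.symm hZ, S.curvature₂₁ hg hx₂ hX hZ,
        S.curvature₂₁ S.isSplitMetric_self one_pos hX hZ, brP_swap h Z X]
      simp only [map_neg, a]
      module
  refine ⟨ricci h β X X + LinearMap.trace ℝ p U / 4, -LinearMap.trace ℝ p U / 4, by linarith,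
    fun g x₁ x₂ hg hx₂ => ?_⟩
  have := congrArg (LinearMap.trace ℝ p) (hc g x₁ x₂ hg hx₂)
  simp only [map_add, map_smul, smul_eq_mul] at this
  rw [ricci, ricci]
  linarith

/-- On `𝔭₂`, the Ricci tensor is a non-increasing affine function of `x₁ / x₂`. -/
theorem ricci₂ (S : IsSplitting h hq β) {X : p} (hX : X ∈ q₂) :
    ∃ C D : ℝ, 0 ≤ D ∧ ∀ (g : ScalarProduct p) (x₁ x₂ : ℝ), IsSplitMetric hq β g x₁ x₂ → 0 < x₂ →
      ricci h g X X = C - D * (x₁ / x₂) := by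
  let a := brP h X
  -- The `y`-dependent part of the curvature endomorphism is `-(y/4) a ∘ a ∘ P₁` on `q₁` and `(3y/4)
  -- U` on `q₂`.
  let U : p →ₗ[ℝ] p := a ∘ₗ P₁ ∘ₗ a ∘ₗ P₂
  have hU : LinearMap.trace ℝ p U ≤ 0 := by
    have skew : ∀ V W, β.form ((P₂ ∘ₗ a ∘ₗ P₁) V) W = -β.form V ((P₁ ∘ₗ a ∘ₗ P₂) W) := fun V W => by
      simp only [LinearMap.comp_apply]
      rw [S.form_proj₂_left, ← S.form_proj₂_right, S.skew, S.form_proj₁_left, S.form_proj₁_right V]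
    have e'' : (P₂ ∘ₗ a ∘ₗ P₁) ∘ₗ (P₁ ∘ₗ a ∘ₗ P₂) = P₂ ∘ₗ (a ∘ₗ P₁ ∘ₗ a ∘ₗ P₂) := by
      ext1 Z
      simp only [LinearMap.comp_apply]
      rw [proj_of_mem hq (Submodule.projection_apply_mem hq (a (P₂ Z)))]
    have hle := β.trace_comp_nonpos skew
    rw [e'', LinearMap.trace_comp_comm'] at hle
    refine le_of_eq_of_le (congrArg _ ?_) hle
    ext1 Z
    simp only [U, LinearMap.comp_apply]
    rw [proj_of_mem hq.symm (Submodule.projection_apply_mem hq.symm Z)]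
  -- Cyclicity of the trace, together with `a q₁ ⊆ q₂`, identifies the two traces. The total is
  -- `(y/2) tr U`, so `D = -tr U / 2`.
  have hU' : LinearMap.trace ℝ p (a ∘ₗ a ∘ₗ P₁) = LinearMap.trace ℝ p U := by
    rw [LinearMap.trace_comp_comm', LinearMap.comp_assoc]
    congr 1
    refine ext_split hq (fun Z hZ => ?_) fun Z hZ => ?_
    · simp only [U, LinearMap.comp_apply]
      rw [proj_eq_zero hq.symm hZ, proj_eq_zero hq (S.brP_mem₂₁ hX hZ)]
      simp
    · simp only [U, LinearMap.comp_apply]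
      rw [proj_of_mem hq.symm hZ]
  have hc : ∀ (g : ScalarProduct p) (x₁ x₂ : ℝ), IsSplitMetric hq β g x₁ x₂ → 0 < x₂ →
      curvatureEnd h g X X + (x₁ / x₂ / 4) • (a ∘ₗ a ∘ₗ P₁) - (3 / 4 * (x₁ / x₂)) • U =
        curvatureEnd h β X X + ((1 / 1 : ℝ) / 4) • (a ∘ₗ a ∘ₗ P₁) -
          (3 / 4 * (1 / 1 : ℝ)) • U := by
    intro g x₁ x₂ hg hx₂
    refine ext_split hq (fun Z hZ => ?_) fun Z hZ => ?_
    · simp only [LinearMap.add_apply, LinearMap.sub_apply, LinearMap.smul_apply,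
        LinearMap.comp_apply, U, curvatureEnd_apply]
      rw [proj_of_mem hq hZ, proj_eq_zero hq.symm hZ, S.curvature₁₂ hg hx₂ hX hZ,
        S.curvature₁₂ S.isSplitMetric_self one_pos hX hZ, brP_swap h Z X]
      simp only [map_neg, map_zero, a]
      module
    · simp only [LinearMap.add_apply, LinearMap.sub_apply, LinearMap.smul_apply,
        LinearMap.comp_apply, U, curvatureEnd_apply]
      rw [proj_eq_zero hq hZ, proj_of_mem hq.symm hZ, S.curvature₂₂ hg hx₂ hX hZ,
        S.curvature₂₂ S.isSplitMetric_self one_pos hX hZ, brP_swap h Z X]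
      simp only [map_neg, map_zero, a]
      module
  refine ⟨ricci h β X X - LinearMap.trace ℝ p U / 2, -LinearMap.trace ℝ p U / 2, by linarith,
    fun g x₁ x₂ hg hx₂ => ?_⟩
  have := congrArg (LinearMap.trace ℝ p) (hc g x₁ x₂ hg hx₂)
  simp only [map_add, map_sub, map_smul, smul_eq_mul, hU'] at this
  rw [ricci, ricci]
  linarith

end IsSplitting
end TwoSummands
end HomRicci

/-! ### Schur's lemma for real representations -/

namespace HomRicci

section Schur

/-- Spectral theorem for the `Q`-symmetric operator representing `f`. The real eigenvalue it
provides replaces algebraic closedness in Schur's argument. -/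
theorem ScalarProduct.exists_eigenvector {V : Type*} [AddCommGroup V] [Module ℝ V]
    [FiniteDimensional ℝ V] [Nontrivial V] (Q : ScalarProduct V) (f : V →ₗ[ℝ] V →ₗ[ℝ] ℝ)
    (hf : ∀ X Y, f X Y = f Y X) : ∃ (c : ℝ) (X : V), X ≠ 0 ∧ ∀ Y, f X Y = c * Q.form X Y := by
  let S : V →ₗ[ℝ] V := (LinearMap.BilinForm.toDual Q.form Q.nondegenerate).symm.toLinearMap ∘ₗ f
  have hS : ∀ X Y, Q.form (S X) Y = f X Y := fun X Y =>
    LinearMap.BilinForm.apply_toDual_symm_apply (hB := Q.nondegenerate) _ _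
  by_contra! hne
  let core : InnerProductSpace.Core ℝ V :=
    { inner := fun x y => Q.form x y
      conj_inner_symm := fun x y => by simpa using Q.symm y x
      re_inner_nonneg := fun x => by simpa using Q.nonneg x
      add_left := fun x y z => by simp
      smul_left := fun x y r => by simp
      definite := fun x hx => by
        by_contra h
        exact (Q.pos x h).ne' hx }
  let _ : NormedAddCommGroup V := core.toNormedAddCommGroup
  let _ : InnerProductSpace ℝ V := InnerProductSpace.ofCore core.toCore
  have hsymm : S.IsSymmetric := fun X Y => by
    change Q.form (S X) Y = Q.form X (S Y)
    rw [hS, Q.symm, hS, hf]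
  have hsub : Subsingleton V := hsymm.subsingleton_of_no_eigenvalue_finiteDimensional fun μ => by
    rw [Submodule.eq_bot_iff]
    intro X hX
    by_contra hX0
    obtain ⟨Y, hY⟩ := hne μ X hX0
    rw [Module.End.mem_eigenspace_iff] at hX
    exact hY (by rw [← hS, hX]; simp)
  exact not_subsingleton V hsub

variable {E : Type*} [NormedAddCommGroup E] [NormedSpace ℝ E]
  {G : Type*} [TopologicalSpace G] [ChartedSpace E G] [Group G] {K : Subgroup G}
  {q q' : Submodule ℝ (GroupLieAlgebra 𝓘(ℝ, E) G)}

/-- An `Ad(K)`-invariant pairing of two subspaces. -/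
def IsAdInvariantForm (K : Subgroup G) (f : q →ₗ[ℝ] q' →ₗ[ℝ] ℝ) : Prop :=
  ∀ a ∈ K, ∀ (X X' : q) (Y Y' : q'),
    (X' : GroupLieAlgebra 𝓘(ℝ, E) G) = Ad a (X : GroupLieAlgebra 𝓘(ℝ, E) G) →
    (Y' : GroupLieAlgebra 𝓘(ℝ, E) G) = Ad a (Y : GroupLieAlgebra 𝓘(ℝ, E) G) →
    f X' Y' = f X Y

theorem IsAdInvariantForm.restrict {p q q' : Submodule ℝ (GroupLieAlgebra 𝓘(ℝ, E) G)}
    {f : p →ₗ[ℝ] p →ₗ[ℝ] ℝ} (hf : IsAdInvariantForm K f) (hq : q ≤ p) (hq' : q' ≤ p) :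
    IsAdInvariantForm K (f.compl₁₂ (Submodule.inclusion hq) (Submodule.inclusion hq')) :=
  fun a ha X X' Y Y' hX hY => hf a ha (Submodule.inclusion hq X) (Submodule.inclusion hq X')
    (Submodule.inclusion hq' Y) (Submodule.inclusion hq' Y') hX hY

/-- The restriction of a scalar product to a subspace. -/
def ScalarProduct.restrict {V : Type*} [AddCommGroup V] [Module ℝ V] {q p : Submodule ℝ V}
    (g : ScalarProduct p) (hq : q ≤ p) : ScalarProduct q where
  form := g.form.compl₁₂ (Submodule.inclusion hq) (Submodule.inclusion hq)
  symm X Y := g.symm _ _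
  pos X hX := g.pos _ fun h => hX ((Submodule.inclusion_injective hq) (by rw [h, map_zero]))

variable [LieGroup 𝓘(ℝ, E) ∞ G]

theorem exists_Ad_eq (hq : IsAdInvariant K q) {a : G} (ha : a ∈ K) (Y' : q) :
    ∃ Y : q, (Y' : GroupLieAlgebra 𝓘(ℝ, E) G) = Ad a (Y : GroupLieAlgebra 𝓘(ℝ, E) G) :=
  ⟨⟨Ad a⁻¹ Y', hq _ (K.inv_mem ha) _ Y'.2⟩, (Ad_Ad_inv a _).symm⟩

variable [FiniteDimensional ℝ E]

/-- Schur's lemma for symmetric forms. -/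
theorem schur_form (hq : IsAdIrreducible K q) (Q : ScalarProduct q)
    (hQ : IsAdInvariantForm K Q.form) (f : q →ₗ[ℝ] q →ₗ[ℝ] ℝ) (hf : ∀ X Y, f X Y = f Y X)
    (hfK : IsAdInvariantForm K f) : ∃ c : ℝ, ∀ X Y, f X Y = c * Q.form X Y := by
  have : Nontrivial q := Submodule.nontrivial_iff_ne_bot.2 hq.2.1
  obtain ⟨c, X₀, hX₀, hX₀c⟩ := Q.exists_eigenvector f hf
  refine ⟨c, ?_⟩
  let W : Submodule ℝ q := LinearMap.ker (f - c • Q.form)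
  have hW : ∀ X, X ∈ W ↔ ∀ Y, f X Y = c * Q.form X Y := fun X => by
    simp only [W, LinearMap.mem_ker, LinearMap.ext_iff, LinearMap.sub_apply, LinearMap.smul_apply,
      smul_eq_mul, sub_eq_zero]
  have hinv : IsAdInvariant K (W.map q.subtype) := by
    rintro a ha _ ⟨X, hX, rfl⟩
    refine ⟨⟨Ad a X, hq.1 a ha _ X.2⟩, ?_, rfl⟩
    refine (hW _).2 fun Y' => ?_
    obtain ⟨Y, hY⟩ := exists_Ad_eq hq.1 ha Y'
    rw [hfK a ha X _ Y Y' rfl hY, hQ a ha X _ Y Y' rfl hY]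
    exact (hW X).1 hX Y
  rcases hq.2.2 _ (Submodule.map_subtype_le q W) hinv with h | h
  · have : (X₀ : GroupLieAlgebra 𝓘(ℝ, E) G) ∈ W.map q.subtype := ⟨X₀, (hW X₀).2 hX₀c, rfl⟩
    rw [h, Submodule.mem_bot] at this
    exact absurd (Subtype.ext this) hX₀
  · intro X
    have : (X : GroupLieAlgebra 𝓘(ℝ, E) G) ∈ W.map q.subtype := by rw [h]; exact X.2
    obtain ⟨X', hX', e⟩ := this
    rw [← Subtype.ext e]
    exact (hW X').1 hX'

/-- Schur's lemma for pairings of inequivalent representations. -/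
theorem schur_pairing (hq : IsAdIrreducible K q) (hq' : IsAdIrreducible K q')
    (hne : ¬ AdEquivalent K q q') (Q : ScalarProduct q') (hQ : IsAdInvariantForm K Q.form)
    (f : q →ₗ[ℝ] q' →ₗ[ℝ] ℝ) (hf : IsAdInvariantForm K f) (X : q) (Y : q') : f X Y = 0 := by
  -- Represented through `Q`, the pairing becomes an equivariant map; by irreducibility it is zero
  -- or an isomorphism, and the latter is excluded by inequivalence.
  let φ : q →ₗ[ℝ] q' :=
    (LinearMap.BilinForm.toDual Q.form Q.nondegenerate).symm.toLinearMap ∘ₗ f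
  have hφ : ∀ X Y, Q.form (φ X) Y = f X Y := fun X Y =>
    LinearMap.BilinForm.apply_toDual_symm_apply (hB := Q.nondegenerate) _ _
  have hequiv : ∀ a ∈ K, ∀ X X' : q,
      (X' : GroupLieAlgebra 𝓘(ℝ, E) G) = Ad a (X : GroupLieAlgebra 𝓘(ℝ, E) G) →
      (φ X' : GroupLieAlgebra 𝓘(ℝ, E) G) = Ad a (φ X : GroupLieAlgebra 𝓘(ℝ, E) G) := by
    intro a ha X X' hX'
    have : φ X' = ⟨Ad a (φ X), hq'.1 a ha _ (φ X).2⟩ := by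
      refine Q.eq_of_form_eq fun Y' => ?_
      obtain ⟨Y, hY⟩ := exists_Ad_eq hq'.1 ha Y'
      rw [hφ, hf a ha X X' Y Y' hX' hY, hQ a ha (φ X) _ Y Y' rfl hY, hφ]
    rw [this]
  have hzero : φ = 0 → f X Y = 0 := fun h => by rw [← hφ, h]; simp
  have hker : IsAdInvariant K ((LinearMap.ker φ).map q.subtype) := by
    rintro a ha _ ⟨X, hX, rfl⟩
    refine ⟨⟨Ad a X, hq.1 a ha _ X.2⟩, ?_, rfl⟩
    have h := hequiv a ha X ⟨Ad a X, hq.1 a ha _ X.2⟩ rfl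
    rw [LinearMap.mem_ker.1 hX, Submodule.coe_zero, map_zero] at h
    exact LinearMap.mem_ker.2 (Subtype.ext h)
  have hrange : IsAdInvariant K ((LinearMap.range φ).map q'.subtype) := by
    rintro a ha _ ⟨_, ⟨X, rfl⟩, rfl⟩
    exact ⟨_, ⟨⟨Ad a X, hq.1 a ha _ X.2⟩, rfl⟩, hequiv a ha X _ rfl⟩
  rcases hq.2.2 _ (Submodule.map_subtype_le q _) hker with hk | hk
  · rcases hq'.2.2 _ (Submodule.map_subtype_le q' _) hrange with hr | hr
    · refine hzero (LinearMap.range_eq_bot.1 ?_)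
      exact Submodule.map_injective_of_injective q'.injective_subtype
        (hr.trans (Submodule.map_bot _).symm)
    · refine absurd ⟨LinearEquiv.ofBijective φ ⟨?_, ?_⟩, fun a ha X X' h => hequiv a ha X X' h⟩ hne
      · rw [← LinearMap.ker_eq_bot]
        exact Submodule.map_injective_of_injective q.injective_subtype
          (hk.trans (Submodule.map_bot _).symm)
      · rw [← LinearMap.range_eq_top]
        refine Submodule.map_injective_of_injective q'.injective_subtype ?_
        rw [hr, Submodule.map_subtype_top]
  · refine hzero (LinearMap.ker_eq_top.1 ?_)
    refine Submodule.map_injective_of_injective q.injective_subtype ?_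
    rw [hk, Submodule.map_subtype_top]

end Schur
end HomRicci

/-! ### Projections to the summands and diagonal metrics -/

namespace HomRicci

theorem InvariantMetric.ext_form {E : Type*} [NormedAddCommGroup E] [NormedSpace ℝ E]
    {G : Type*} [TopologicalSpace G] [ChartedSpace E G] [Group G] {K : Subgroup G}
    {p : Submodule ℝ (GroupLieAlgebra 𝓘(ℝ, E) G)} {g g' : InvariantMetric K p}
    (h : ∀ X Y, g.form X Y = g'.form X Y) : g = g' := by
  obtain ⟨⟨f, _, _⟩, _⟩ := g
  obtain ⟨⟨f', _, _⟩, _⟩ := g'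
  have : f = f' := LinearMap.ext₂ h
  subst this
  rfl

namespace IsTwoSummandSpace

variable {E : Type*} [NormedAddCommGroup E] [NormedSpace ℝ E]
  [CompleteSpace E]
  {G : Type*} [TopologicalSpace G] [ChartedSpace E G] [Group G] [LieGroup 𝓘(ℝ, E) ∞ G]
  {K H : Subgroup G} {p₁ p₂ : Submodule ℝ (GroupLieAlgebra 𝓘(ℝ, E) G)}

local notation "𝔤" => GroupLieAlgebra 𝓘(ℝ, E) G
local notation "κ" => killingForm ℝ (GroupLieAlgebra 𝓘(ℝ, E) G)

variable (p₁ p₂) in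
/-- `𝔭₁` as a subspace of `𝔭`. -/
abbrev left : Submodule ℝ ↥(p₁ ⊔ p₂) := p₁.comap (p₁ ⊔ p₂).subtype

variable (p₁ p₂) in
/-- `𝔭₂` as a subspace of `𝔭`. -/
abbrev right : Submodule ℝ ↥(p₁ ⊔ p₂) := p₂.comap (p₁ ⊔ p₂).subtype

theorem isCompl_left_right (hM : IsTwoSummandSpace K H p₁ p₂) :
    IsCompl (left p₁ p₂) (right p₁ p₂) := by
  constructor
  · rw [Submodule.disjoint_def]
    intro X h₁ h₂
    exact Subtype.ext (Submodule.disjoint_def.1 hM.disjoint X h₁ h₂)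
  · rw [codisjoint_iff_le_sup]
    rintro ⟨X, hX⟩ -
    obtain ⟨Y, hY, Z, hZ, rfl⟩ := Submodule.mem_sup.1 hX
    exact Submodule.mem_sup.2 ⟨⟨Y, le_sup_left (a := p₁) hY⟩, hY,
      ⟨Z, le_sup_right (a := p₁) hZ⟩, hZ, rfl⟩

/-- The projection of `𝔭` to `𝔭₁`. -/
def proj₁ (hM : IsTwoSummandSpace K H p₁ p₂) : ↥(p₁ ⊔ p₂) →ₗ[ℝ] ↥(p₁ ⊔ p₂) :=
  (left p₁ p₂).projection (right p₁ p₂) hM.isCompl_left_right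

/-- The projection of `𝔭` to `𝔭₂`. -/
def proj₂ (hM : IsTwoSummandSpace K H p₁ p₂) : ↥(p₁ ⊔ p₂) →ₗ[ℝ] ↥(p₁ ⊔ p₂) :=
  (right p₁ p₂).projection (left p₁ p₂) hM.isCompl_left_right.symm

section Projections

variable (hM : IsTwoSummandSpace K H p₁ p₂)

theorem proj₁_mem (X : ↥(p₁ ⊔ p₂)) : (hM.proj₁ X : 𝔤) ∈ p₁ :=
  Submodule.projection_apply_mem hM.isCompl_left_right X

theorem proj₂_mem (X : ↥(p₁ ⊔ p₂)) : (hM.proj₂ X : 𝔤) ∈ p₂ :=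
  Submodule.projection_apply_mem hM.isCompl_left_right.symm X

theorem proj₁_add_proj₂ (X : ↥(p₁ ⊔ p₂)) : hM.proj₁ X + hM.proj₂ X = X :=
  Submodule.projection_add_projection_eq_self hM.isCompl_left_right X

theorem proj₁_of_mem {X : ↥(p₁ ⊔ p₂)} (hX : (X : 𝔤) ∈ p₁) : hM.proj₁ X = X :=
  Submodule.projection_apply_of_mem_left hM.isCompl_left_right hX

theorem proj₂_of_mem {X : ↥(p₁ ⊔ p₂)} (hX : (X : 𝔤) ∈ p₂) : hM.proj₂ X = X :=
  Submodule.projection_apply_of_mem_left hM.isCompl_left_right.symm hX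

theorem proj₁_eq_zero {X : ↥(p₁ ⊔ p₂)} (hX : (X : 𝔤) ∈ p₂) : hM.proj₁ X = 0 :=
  (Submodule.projection_apply_eq_zero_iff hM.isCompl_left_right).2 hX

theorem proj₂_eq_zero {X : ↥(p₁ ⊔ p₂)} (hX : (X : 𝔤) ∈ p₁) : hM.proj₂ X = 0 :=
  (Submodule.projection_apply_eq_zero_iff hM.isCompl_left_right.symm).2 hX

theorem proj₁_Ad {a : G} (ha : a ∈ K) {X X' : ↥(p₁ ⊔ p₂)} (hX : (X' : 𝔤) = Ad a (X : 𝔤)) :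
    (hM.proj₁ X' : 𝔤) = Ad a (hM.proj₁ X : 𝔤) ∧ (hM.proj₂ X' : 𝔤) = Ad a (hM.proj₂ X : 𝔤) := by
  have h₁ := hM.irreducible₁.1 a ha _ (hM.proj₁_mem X)
  have h₂ := hM.irreducible₂.1 a ha _ (hM.proj₂_mem X)
  have e : X' = ⟨_, le_sup_left (a := p₁) h₁⟩ + ⟨_, le_sup_right (a := p₁) h₂⟩ := by
    refine Subtype.ext ?_
    rw [hX]
    conv_lhs => rw [← hM.proj₁_add_proj₂ X]
    rw [Submodule.coe_add, map_add]
    rfl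
  constructor
  · rw [e, map_add, hM.proj₁_of_mem (X := ⟨_, le_sup_left (a := p₁) h₁⟩) h₁,
      hM.proj₁_eq_zero (X := ⟨_, le_sup_right (a := p₁) h₂⟩) h₂, add_zero]
  · rw [e, map_add, hM.proj₂_eq_zero (X := ⟨_, le_sup_left (a := p₁) h₁⟩) h₁,
      hM.proj₂_of_mem (X := ⟨_, le_sup_right (a := p₁) h₂⟩) h₂, zero_add]

theorem isAdInvariant (hM : IsTwoSummandSpace K H p₁ p₂) : IsAdInvariant K (p₁ ⊔ p₂) :=
  hM.irreducible₁.1.sup hM.irreducible₂.1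

end Projections

theorem _root_.HomRicci.IsDiagonal.form_eq (hM : IsTwoSummandSpace K H p₁ p₂)
    {Q g : InvariantMetric K (p₁ ⊔ p₂)} {x₁ x₂ : ℝ} (hg : IsDiagonal Q g x₁ x₂)
    (X Y : ↥(p₁ ⊔ p₂)) : g.form X Y =
      x₁ * Q.form (hM.proj₁ X) (hM.proj₁ Y) + x₂ * Q.form (hM.proj₂ X) (hM.proj₂ Y) := by
  have e₁ := hg.2.2.1 _ _ (hM.proj₁_mem X) (hM.proj₁_mem Y)
  have e₂ := hg.2.2.2.1 _ _ (hM.proj₂_mem X) (hM.proj₂_mem Y)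
  have e₃ := hg.2.2.2.2 _ _ (hM.proj₁_mem X) (hM.proj₂_mem Y)
  have e₄ := hg.2.2.2.2 _ _ (hM.proj₁_mem Y) (hM.proj₂_mem X)
  rw [g.symm] at e₄
  conv_lhs => rw [← hM.proj₁_add_proj₂ X, ← hM.proj₁_add_proj₂ Y]
  simp only [map_add, LinearMap.add_apply]
  rw [e₁, e₂, e₃, e₄]
  ring

theorem isDiagonal_of_form_eq (hM : IsTwoSummandSpace K H p₁ p₂)
    {Q g : InvariantMetric K (p₁ ⊔ p₂)} {x₁ x₂ : ℝ} (h₁ : 0 < x₁) (h₂ : 0 < x₂)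
    (hg : ∀ X Y, g.form X Y =
      x₁ * Q.form (hM.proj₁ X) (hM.proj₁ Y) + x₂ * Q.form (hM.proj₂ X) (hM.proj₂ Y)) :
    IsDiagonal Q g x₁ x₂ := by
  refine ⟨h₁, h₂, fun X Y hX hY => ?_, fun X Y hX hY => ?_, fun X Y hX hY => ?_⟩
  · rw [hg, hM.proj₁_of_mem hX, hM.proj₁_of_mem hY, hM.proj₂_eq_zero hX]
    simp
  · rw [hg, hM.proj₂_of_mem hX, hM.proj₂_of_mem hY, hM.proj₁_eq_zero hX]
    simp
  · rw [hg, hM.proj₁_eq_zero hY, hM.proj₂_eq_zero hX]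
    simp

theorem form_proj_pos (hM : IsTwoSummandSpace K H p₁ p₂) (Q : InvariantMetric K (p₁ ⊔ p₂))
    {c₁ c₂ : ℝ} (h₁ : 0 < c₁) (h₂ : 0 < c₂) {X : ↥(p₁ ⊔ p₂)} (hX : X ≠ 0) :
    0 < c₁ * Q.form (hM.proj₁ X) (hM.proj₁ X) + c₂ * Q.form (hM.proj₂ X) (hM.proj₂ X) := by
  have n₁ := mul_nonneg h₁.le (Q.nonneg (hM.proj₁ X))
  have n₂ := mul_nonneg h₂.le (Q.nonneg (hM.proj₂ X))
  by_cases h : hM.proj₁ X = 0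
  · have : hM.proj₂ X ≠ 0 := fun h' => hX (by rw [← hM.proj₁_add_proj₂ X, h, h', add_zero])
    linarith [mul_pos h₂ (Q.pos _ this)]
  · linarith [mul_pos h₁ (Q.pos _ h)]

/-- The metric `x₁ Q|𝔭₁ ⊕ x₂ Q|𝔭₂`. -/
def diagonalMetric (hM : IsTwoSummandSpace K H p₁ p₂) (Q : InvariantMetric K (p₁ ⊔ p₂))
    {x₁ x₂ : ℝ} (h₁ : 0 < x₁) (h₂ : 0 < x₂) : InvariantMetric K (p₁ ⊔ p₂) where
  form := x₁ • Q.form.compl₁₂ hM.proj₁ hM.proj₁ + x₂ • Q.form.compl₁₂ hM.proj₂ hM.proj₂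
  symm X Y := by
    simp [Q.symm (hM.proj₁ X), Q.symm (hM.proj₂ X)]
  pos X hX := by
    simpa using hM.form_proj_pos Q h₁ h₂ hX
  invariant a ha X X' Y Y' hX hY := by
    have e₁ := Q.invariant a ha _ _ _ _ (hM.proj₁_Ad ha hX).1 (hM.proj₁_Ad ha hY).1
    have e₂ := Q.invariant a ha _ _ _ _ (hM.proj₁_Ad ha hX).2 (hM.proj₁_Ad ha hY).2
    simp [e₁, e₂]

theorem diagonalMetric_form (hM : IsTwoSummandSpace K H p₁ p₂) (Q : InvariantMetric K (p₁ ⊔ p₂))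
    {x₁ x₂ : ℝ} (h₁ : 0 < x₁) (h₂ : 0 < x₂) (X Y : ↥(p₁ ⊔ p₂)) :
    (hM.diagonalMetric Q h₁ h₂).form X Y =
      x₁ * Q.form (hM.proj₁ X) (hM.proj₁ Y) + x₂ * Q.form (hM.proj₂ X) (hM.proj₂ Y) := by
  simp [diagonalMetric]

theorem isDiagonal_diagonalMetric (hM : IsTwoSummandSpace K H p₁ p₂)
    (Q : InvariantMetric K (p₁ ⊔ p₂)) {x₁ x₂ : ℝ} (h₁ : 0 < x₁) (h₂ : 0 < x₂) :
    IsDiagonal Q (hM.diagonalMetric Q h₁ h₂) x₁ x₂ :=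
  hM.isDiagonal_of_form_eq h₁ h₂ (hM.diagonalMetric_form Q h₁ h₂)

theorem _root_.HomRicci.IsDiagonal.unique (hM : IsTwoSummandSpace K H p₁ p₂)
    {Q g g' : InvariantMetric K (p₁ ⊔ p₂)} {x₁ x₂ : ℝ} (hg : IsDiagonal Q g x₁ x₂)
    (hg' : IsDiagonal Q g' x₁ x₂) : g = g' :=
  InvariantMetric.ext_form fun X Y => by rw [hg.form_eq hM, hg'.form_eq hM]

variable [FiniteDimensional ℝ E]

/-- A pairing of `𝔭₁` and `𝔭₂` which is invariant under `Ad(K)` vanishes. -/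
theorem form_eq_zero (hM : IsTwoSummandSpace K H p₁ p₂) (Q : InvariantMetric K (p₁ ⊔ p₂))
    {f : ↥(p₁ ⊔ p₂) →ₗ[ℝ] ↥(p₁ ⊔ p₂) →ₗ[ℝ] ℝ} (hf : IsAdInvariantForm K f) {X Y : ↥(p₁ ⊔ p₂)} (hX : (X : 𝔤) ∈ p₁) (hY : (Y : 𝔤) ∈ p₂) :
    f X Y = 0 :=
  schur_pairing hM.irreducible₁ hM.irreducible₂ hM.inequivalent
    (Q.toScalarProduct.restrict le_sup_right)
    (IsAdInvariantForm.restrict (f := Q.form) Q.invariant le_sup_right le_sup_right) _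
    (hf.restrict le_sup_left le_sup_right) ⟨X, hX⟩ ⟨Y, hY⟩

/-- A symmetric invariant form on `𝔭` is a combination of the restrictions of `Q`. -/
theorem exists_form_eq (hM : IsTwoSummandSpace K H p₁ p₂) (Q : InvariantMetric K (p₁ ⊔ p₂))
    {f : ↥(p₁ ⊔ p₂) →ₗ[ℝ] ↥(p₁ ⊔ p₂) →ₗ[ℝ] ℝ} (hs : ∀ X Y, f X Y = f Y X)
    (hf : IsAdInvariantForm K f) : ∃ c₁ c₂ : ℝ, ∀ X Y, f X Y =
      c₁ * Q.form (hM.proj₁ X) (hM.proj₁ Y) + c₂ * Q.form (hM.proj₂ X) (hM.proj₂ Y) := by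
  obtain ⟨c₁, hc₁⟩ := schur_form hM.irreducible₁ (Q.toScalarProduct.restrict le_sup_left)
    (IsAdInvariantForm.restrict (f := Q.form) Q.invariant le_sup_left le_sup_left) _
    (fun X Y => hs _ _) (hf.restrict le_sup_left le_sup_left)
  obtain ⟨c₂, hc₂⟩ := schur_form hM.irreducible₂ (Q.toScalarProduct.restrict le_sup_right)
    (IsAdInvariantForm.restrict (f := Q.form) Q.invariant le_sup_right le_sup_right) _
    (fun X Y => hs _ _) (hf.restrict le_sup_right le_sup_right)
  refine ⟨c₁, c₂, fun X Y => ?_⟩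
  have e₁ : f (hM.proj₁ X) (hM.proj₁ Y) = c₁ * Q.form (hM.proj₁ X) (hM.proj₁ Y) :=
    hc₁ ⟨_, hM.proj₁_mem X⟩ ⟨_, hM.proj₁_mem Y⟩
  have e₂ : f (hM.proj₂ X) (hM.proj₂ Y) = c₂ * Q.form (hM.proj₂ X) (hM.proj₂ Y) :=
    hc₂ ⟨_, hM.proj₂_mem X⟩ ⟨_, hM.proj₂_mem Y⟩
  have e₃ := hM.form_eq_zero Q hf (hM.proj₁_mem X) (hM.proj₂_mem Y)
  have e₄ := hM.form_eq_zero Q hf (hM.proj₁_mem Y) (hM.proj₂_mem X)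
  rw [hs] at e₄
  conv_lhs => rw [← hM.proj₁_add_proj₂ X, ← hM.proj₁_add_proj₂ Y]
  simp only [map_add, LinearMap.add_apply]
  rw [e₁, e₂, e₃, e₄]
  ring

/-- Every invariant metric is diagonal. -/
theorem exists_isDiagonal (hM : IsTwoSummandSpace K H p₁ p₂) (Q g : InvariantMetric K (p₁ ⊔ p₂)) :
    ∃ x₁ x₂ : ℝ, IsDiagonal Q g x₁ x₂ := by
  obtain ⟨x₁, x₂, h⟩ := hM.exists_form_eq Q (f := g.form) g.symm g.invariant
  refine ⟨x₁, x₂, hM.isDiagonal_of_form_eq ?_ ?_ h⟩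
  · obtain ⟨X, hX, hX0⟩ := (Submodule.ne_bot_iff _).1 hM.irreducible₁.2.1
    let X' : ↥(p₁ ⊔ p₂) := ⟨X, le_sup_left (a := p₁) hX⟩
    have hX' : X' ≠ 0 := fun h => hX0 (congrArg Subtype.val h)
    have hg := g.pos X' hX'
    rw [h, hM.proj₁_of_mem (X := X') hX, hM.proj₂_eq_zero (X := X') hX] at hg
    exact pos_of_mul_pos_left (by simpa using hg) (Q.nonneg X')
  · obtain ⟨X, hX, hX0⟩ := (Submodule.ne_bot_iff _).1 hM.irreducible₂.2.1
    let X' : ↥(p₁ ⊔ p₂) := ⟨X, le_sup_right (a := p₁) hX⟩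
    have hX' : X' ≠ 0 := fun h => hX0 (congrArg Subtype.val h)
    have hg := g.pos X' hX'
    rw [h, hM.proj₂_of_mem (X := X') hX, hM.proj₁_eq_zero (X := X') hX] at hg
    exact pos_of_mul_pos_left (by simpa using hg) (Q.nonneg X')

end IsTwoSummandSpace
end HomRicci

/-! ### The Killing form and the Ricci tensor of `G/K` -/

namespace HomRicci
namespace IsTwoSummandSpace

variable {E : Type*} [NormedAddCommGroup E] [NormedSpace ℝ E] [FiniteDimensional ℝ E]
  [CompleteSpace E]
  {G : Type*} [TopologicalSpace G] [ChartedSpace E G] [Group G] [LieGroup 𝓘(ℝ, E) ∞ G]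
  {K H : Subgroup G} {p₁ p₂ : Submodule ℝ (GroupLieAlgebra 𝓘(ℝ, E) G)}

local notation "𝔤" => GroupLieAlgebra 𝓘(ℝ, E) G
local notation "κ" => killingForm ℝ (GroupLieAlgebra 𝓘(ℝ, E) G)

/-- Only `𝔨 ⊥ 𝔭` is assumed. Orthogonality of `𝔭₁` and `𝔭₂` holds because the Killing form is an
`Ad(K)`-invariant pairing of inequivalent irreducible representations. -/
theorem killingForm_orthogonal (hM : IsTwoSummandSpace K H p₁ p₂)
    (Q : InvariantMetric K (p₁ ⊔ p₂)) {X Y : 𝔤} (hX : X ∈ p₁) (hY : Y ∈ p₂) : κ X Y = 0 := by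
  let f : ↥(p₁ ⊔ p₂) →ₗ[ℝ] ↥(p₁ ⊔ p₂) →ₗ[ℝ] ℝ :=
    LinearMap.compl₁₂ κ (p₁ ⊔ p₂).subtype (p₁ ⊔ p₂).subtype
  have hf : IsAdInvariantForm K f := by
    intro a _ X X' Y Y' hX hY
    change κ X' Y' = κ X Y
    rw [hX, hY, killingForm_Ad]
  exact hM.form_eq_zero Q hf (X := ⟨X, le_sup_left (a := p₁) hX⟩)
    (Y := ⟨Y, le_sup_right (a := p₁) hY⟩) hX hY

theorem exists_killing_product (hM : IsTwoSummandSpace K H p₁ p₂)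
    (Q : InvariantMetric K (p₁ ⊔ p₂)) (hQ : IsBackground Q) :
    ∃ b₁ b₂ : ℝ, 0 < b₁ ∧ 0 < b₂ ∧ ∃ β : ScalarProduct ↥(p₁ ⊔ p₂), (∀ X Y, β.form X Y = -κ X Y) ∧
      ∀ X Y, β.form X Y =
        b₁ * Q.form (hM.proj₁ X) (hM.proj₁ Y) + b₂ * Q.form (hM.proj₂ X) (hM.proj₂ Y) := by
  obtain ⟨b₁, b₂, hb₁, hb₂, h₁, h₂⟩ := hQ
  have key : ∀ X Y : ↥(p₁ ⊔ p₂), -κ X Y =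
      b₁ * Q.form (hM.proj₁ X) (hM.proj₁ Y) + b₂ * Q.form (hM.proj₂ X) (hM.proj₂ Y) := by
    intro X Y
    rw [← h₁ _ _ (hM.proj₁_mem X) (hM.proj₁_mem Y), ← h₂ _ _ (hM.proj₂_mem X) (hM.proj₂_mem Y)]
    conv_lhs => rw [← hM.proj₁_add_proj₂ X, ← hM.proj₁_add_proj₂ Y]
    simp only [Submodule.coe_add, map_add, LinearMap.add_apply]
    rw [hM.killingForm_orthogonal Q (hM.proj₁_mem X) (hM.proj₂_mem Y),
      LieModule.traceForm_comm ℝ 𝔤 𝔤 (hM.proj₂ X),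
      hM.killingForm_orthogonal Q (hM.proj₁_mem Y) (hM.proj₂_mem X)]
    ring
  refine ⟨b₁, b₂, hb₁, hb₂,
    ⟨-LinearMap.compl₁₂ κ (p₁ ⊔ p₂).subtype (p₁ ⊔ p₂).subtype, fun X Y => ?_, fun X hX => ?_⟩,
    fun X Y => rfl, key⟩
  · change -κ X Y = -κ Y X
    rw [LieModule.traceForm_comm]
  · change 0 < -κ X X
    rw [key]
    exact hM.form_proj_pos Q hb₁ hb₂ hX

omit [FiniteDimensional ℝ E] in
theorem killingForm_projectionOnto (hM : IsTwoSummandSpace K H p₁ p₂) (V : 𝔤) (Z : ↥(p₁ ⊔ p₂)) :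
    κ ((p₁ ⊔ p₂).projectionOnto _ hM.isCompl V) Z = κ V Z := by
  conv_rhs => rw [← proj_add_proj hM.isCompl V]
  have h := hM.orthogonal Z Z.2 _
    (SetLike.coe_mem ((lieAlgebraOf K).projectionOnto _ hM.isCompl.symm V))
  rw [LieModule.traceForm_comm] at h
  rw [map_add, LinearMap.add_apply]
  exact (add_eq_left.2 h).symm

/-- The radical of the Killing form commutes with `𝔭`. -/
theorem lie_eq_zero_of_radical (hM : IsTwoSummandSpace K H p₁ p₂) {β : ScalarProduct ↥(p₁ ⊔ p₂)}
    (hβ : ∀ X Y, β.form X Y = -κ X Y) {Z V : 𝔤} (hZ : Z ∈ lieAlgebraOf K)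
    (hrad : ∀ W, κ Z W = 0) (hV : V ∈ p₁ ⊔ p₂) : ⁅Z, V⁆ = 0 := by
  have hmem : ⁅Z, V⁆ ∈ p₁ ⊔ p₂ := hM.isAdInvariant.lie_mem hZ hV
  -- Invariance gives `κ ⁅Z, V⁆ ⁅Z, V⁆ = κ Z ⁅V, ⁅Z, V⁆⁆ = 0`, while `-κ` is positive definite on
  -- `𝔭`, which contains `⁅Z, V⁆`.
  by_contra hne
  have := β.pos ⟨_, hmem⟩ fun h => hne (congrArg Subtype.val h)
  rw [hβ, LieModule.traceForm_apply_lie_apply] at this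
  have h0 := hrad ⁅V, ⁅Z, V⁆⁆
  change LieModule.traceForm ℝ 𝔤 𝔤 Z ⁅V, ⁅Z, V⁆⁆ = 0 at h0
  rw [h0] at this
  simp at this

/-- The subgroup `H` enters in `brP_mem`, since `𝔥 = 𝔨 ⊕ 𝔭₁` is closed under brackets. For
`isotropyTerm_eq_zero`, `κ(⁅X, Y⁆, W) = κ(X, ⁅Y, W⁆) = 0` for `W ∈ 𝔨`, as `⁅Y, W⁆ ∈ 𝔭₂`. Thus `⁅X,
Y⁆_𝔨` is orthogonal to `𝔨` as well as to `𝔭`: it lies in the radical of the Killing form, and so it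
commutes with `𝔭`. -/
theorem isSplitting (hM : IsTwoSummandSpace K H p₁ p₂) (Q : InvariantMetric K (p₁ ⊔ p₂))
    {β : ScalarProduct ↥(p₁ ⊔ p₂)} (hβ : ∀ X Y, β.form X Y = -κ X Y) :
    IsSplitting hM.isCompl hM.isCompl_left_right β where
  skew X Y Z := by
    rw [hβ, hβ, brP_apply, hM.killingForm_projectionOnto, brP_apply,
      LieModule.traceForm_comm ℝ 𝔤 𝔤 (Y : 𝔤), hM.killingForm_projectionOnto,
      LieModule.traceForm_comm ℝ 𝔤 𝔤 _ (Y : 𝔤), ← lie_skew (X : 𝔤) (Y : 𝔤), map_neg,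
      LinearMap.neg_apply, LieModule.traceForm_apply_lie_apply]
  orthogonal X hX Y hY := by
    rw [hβ, neg_eq_zero]
    exact hM.killingForm_orthogonal Q hX hY
  brP_mem X hX Y hY := by
    have hk : lieAlgebraOf K ⊔ p₁ = lieAlgebraOf (E := E) H := hM.lieAlgebra_H.symm
    have hXH : (X : 𝔤) ∈ lieAlgebraOf H := hk ▸ Submodule.mem_sup_right hX
    have hYH : (Y : 𝔤) ∈ lieAlgebraOf H := hk ▸ Submodule.mem_sup_right hY
    have hXY : ⁅(X : 𝔤), (Y : 𝔤)⁆ ∈ lieAlgebraOf H := Ad_mem_lieAlgebraOf.lie_mem hXH hYH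
    rw [← hk] at hXY
    obtain ⟨Z, hZ, W, hW, e⟩ := Submodule.mem_sup.1 hXY
    change (brP hM.isCompl X Y : 𝔤) ∈ p₁
    rw [brP_apply, ← e, map_add, Submodule.projectionOnto_apply_right hM.isCompl ⟨Z, hZ⟩, zero_add,
      Submodule.projectionOnto_apply_left hM.isCompl ⟨W, le_sup_left (a := p₁) hW⟩]
    exact hW
  isotropyTerm_eq_zero X hX Y hY Z := by
    rw [isotropyTerm]
    have hk := SetLike.coe_mem
      ((lieAlgebraOf K).projectionOnto _ hM.isCompl.symm ⁅(X : 𝔤), (Y : 𝔤)⁆)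
    rw [hM.lie_eq_zero_of_radical hβ hk (fun W => ?_) Z.2, map_zero]
    rw [← proj_add_proj hM.isCompl W, map_add, LieModule.traceForm_comm ℝ 𝔤 𝔤 _
      ((p₁ ⊔ p₂).projectionOnto _ hM.isCompl W : 𝔤),
      hM.orthogonal _ (SetLike.coe_mem _) _ hk, zero_add]
    set W' := (lieAlgebraOf K).projectionOnto _ hM.isCompl.symm W
    have e : κ ((lieAlgebraOf K).projectionOnto _ hM.isCompl.symm ⁅(X : 𝔤), (Y : 𝔤)⁆ : 𝔤) W' =
        κ ⁅(X : 𝔤), (Y : 𝔤)⁆ W' := by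
      conv_rhs => rw [← proj_add_proj hM.isCompl ⁅(X : 𝔤), (Y : 𝔤)⁆]
      rw [map_add, LinearMap.add_apply, hM.orthogonal _ (SetLike.coe_mem _) _ W'.2, zero_add]
    rw [e, LieModule.traceForm_apply_lie_apply, ← lie_skew, map_neg, neg_eq_zero]
    exact hM.killingForm_orthogonal Q hX (hM.irreducible₂.1.lie_mem W'.2 hY)

theorem isotropySkew (hM : IsTwoSummandSpace K H p₁ p₂) (g : InvariantMetric K (p₁ ⊔ p₂)) :
    IsotropySkew hM.isCompl g.toScalarProduct := by
  intro X Y Z W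
  have hk := SetLike.coe_mem ((lieAlgebraOf K).projectionOnto _ hM.isCompl.symm ⁅(X : 𝔤), (Y : 𝔤)⁆)
  have e : ∀ V : ↥(p₁ ⊔ p₂), (isotropyTerm hM.isCompl X Y V : 𝔤) =
      ⁅((lieAlgebraOf K).projectionOnto _ hM.isCompl.symm ⁅(X : 𝔤), (Y : 𝔤)⁆ : 𝔤), (V : 𝔤)⁆ := by
    intro V
    exact congrArg Subtype.val (Submodule.projectionOnto_apply_left hM.isCompl
      ⟨_, hM.isAdInvariant.lie_mem hk V.2⟩)
  exact eq_neg_of_add_eq_zero_left (g.skew hM.isAdInvariant hk Z W _ _ (e Z) (e W))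

/-- `Ad(a)` as an automorphism of an invariant subspace. -/
def _root_.HomRicci.IsAdInvariant.equiv {p : Submodule ℝ 𝔤} (hp : IsAdInvariant K p) {a : G}
    (ha : a ∈ K) : p ≃ₗ[ℝ] p where
  toLinearMap := (Ad a).restrict fun X hX => hp a ha X hX
  invFun X := ⟨Ad a⁻¹ X, hp _ (K.inv_mem ha) X X.2⟩
  left_inv _ := Subtype.ext (Ad_inv_Ad a _)
  right_inv _ := Subtype.ext (Ad_Ad_inv a _)

theorem ricci_isAdInvariantForm (hM : IsTwoSummandSpace K H p₁ p₂)
    (g : InvariantMetric K (p₁ ⊔ p₂)) :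
    IsAdInvariantForm K (ricciForm hM.isCompl g.toScalarProduct) := by
  intro a ha X X' Y Y' hX hY
  have eX : X' = hM.isAdInvariant.equiv ha X := Subtype.ext hX
  have eY : Y' = hM.isAdInvariant.equiv ha Y := Subtype.ext hY
  rw [ricciForm_apply, ricciForm_apply, eX, eY]
  exact ricci_map (AdEquiv a).toLieHom (fun Z hZ => Ad_mem_lieAlgebraOf a ha Z hZ)
    (hM.isAdInvariant.equiv ha) (fun _ => rfl)
    (fun X Y => g.invariant a ha X _ Y _ rfl rfl) X Y

/-- The Ricci tensor of the diagonal metrics. -/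
theorem exists_ricci_eq (hM : IsTwoSummandSpace K H p₁ p₂) {Q : InvariantMetric K (p₁ ⊔ p₂)}
    (hQ : IsBackground Q) : ∃ A B C D : ℝ, 0 ≤ B ∧ 0 ≤ D ∧
      ∀ (g : InvariantMetric K (p₁ ⊔ p₂)) (x₁ x₂ : ℝ), IsDiagonal Q g x₁ x₂ → ∀ X Y,
        ricci hM.isCompl g.toScalarProduct X Y =
          (A + B * (x₁ / x₂) ^ 2) * Q.form (hM.proj₁ X) (hM.proj₁ Y) +
          (C - D * (x₁ / x₂)) * Q.form (hM.proj₂ X) (hM.proj₂ Y) := by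
  obtain ⟨b₁, b₂, hb₁, hb₂, β, hβ, hβQ⟩ := hM.exists_killing_product Q hQ
  have S := hM.isSplitting Q hβ
  obtain ⟨X₁, hX₁, hX₁0⟩ := (Submodule.ne_bot_iff _).1 hM.irreducible₁.2.1
  obtain ⟨X₂, hX₂, hX₂0⟩ := (Submodule.ne_bot_iff _).1 hM.irreducible₂.2.1
  -- By Schur's lemma one vector in each summand determines the whole Ricci tensor.
  let V₁ : ↥(p₁ ⊔ p₂) := ⟨X₁, le_sup_left (a := p₁) hX₁⟩
  let V₂ : ↥(p₁ ⊔ p₂) := ⟨X₂, le_sup_right (a := p₁) hX₂⟩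
  have hV₁ : 0 < Q.form V₁ V₁ := Q.pos _ fun h => hX₁0 (congrArg Subtype.val h)
  have hV₂ : 0 < Q.form V₂ V₂ := Q.pos _ fun h => hX₂0 (congrArg Subtype.val h)
  obtain ⟨A, B, hB, hAB⟩ := S.ricci₁ (X := V₁) hX₁
  obtain ⟨C, D, hD, hCD⟩ := S.ricci₂ (X := V₂) hX₂
  refine ⟨A / Q.form V₁ V₁, B * (b₂ / b₁) ^ 2 / Q.form V₁ V₁, C / Q.form V₂ V₂,
    D * (b₂ / b₁) / Q.form V₂ V₂, by positivity, by positivity, fun g x₁ x₂ hg X Y => ?_⟩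
  -- Relative to `β`, which is `bᵢ Q` on `𝔭ᵢ`, the scales are `xᵢ / bᵢ`; the ratio therefore
  -- acquires the factor `b₂ / b₁`, visible in the witnesses for `B` and `D`.
  have hsplit : IsSplitMetric hM.isCompl_left_right β g.toScalarProduct (x₁ / b₁) (x₂ / b₂) := by
    intro X Y
    rw [hg.form_eq hM]
    change _ = x₁ / b₁ * β.form (hM.proj₁ X) (hM.proj₁ Y) +
      x₂ / b₂ * β.form (hM.proj₂ X) (hM.proj₂ Y)
    rw [hβQ, hβQ, hM.proj₁_of_mem (hM.proj₁_mem X), hM.proj₁_of_mem (hM.proj₁_mem Y),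
      hM.proj₂_eq_zero (hM.proj₁_mem X), hM.proj₂_of_mem (hM.proj₂_mem X),
      hM.proj₂_of_mem (hM.proj₂_mem Y), hM.proj₁_eq_zero (hM.proj₂_mem X)]
    simp
    field_simp
  have hx₂ := hg.2.1
  have hAB' := hAB _ _ _ hsplit (by positivity)
  have hCD' := hCD _ _ _ hsplit (by positivity)
  obtain ⟨c₁, c₂, hc⟩ := hM.exists_form_eq Q (f := ricciForm hM.isCompl g.toScalarProduct)
    (ricci_symm (hM.isotropySkew g)) (hM.ricci_isAdInvariantForm g)
  have h₁ := hc V₁ V₁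
  have h₂ := hc V₂ V₂
  rw [hM.proj₁_of_mem (X := V₁) hX₁, hM.proj₂_eq_zero (X := V₁) hX₁, ricciForm_apply, hAB'] at h₁
  rw [hM.proj₂_of_mem (X := V₂) hX₂, hM.proj₁_eq_zero (X := V₂) hX₂, ricciForm_apply, hCD'] at h₂
  have hy : x₁ / b₁ / (x₂ / b₂) = b₂ / b₁ * (x₁ / x₂) := by
    field_simp
  rw [hy] at h₁ h₂
  have e₁ : c₁ = A / Q.form V₁ V₁ + B * (b₂ / b₁) ^ 2 / Q.form V₁ V₁ * (x₁ / x₂) ^ 2 := by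
    rw [← mul_div_cancel_right₀ c₁ hV₁.ne', eq_sub_of_add_eq h₁.symm]
    simp only [map_zero]
    ring
  have e₂ : c₂ = C / Q.form V₂ V₂ - D * (b₂ / b₁) / Q.form V₂ V₂ * (x₁ / x₂) := by
    rw [← mul_div_cancel_right₀ c₂ hV₂.ne', eq_sub_of_add_eq' h₂.symm]
    simp only [map_zero]
    ring
  rw [← ricciForm_apply, hc, e₁, e₂]

end IsTwoSummandSpace
end HomRicci

/-! ### The planar system: uniqueness and absence of ancient solutions -/

namespace HomRicci

/-- An autonomous equation `u' = f(u)` with `f` continuous, positive and bounded has a solution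
through the origin that is a bijection of the line. -/
theorem exists_scalar_flow {f : ℝ → ℝ} (hf : Continuous f) (hpos : ∀ s, 0 < f s) {M : ℝ}
    (hM : ∀ s, f s ≤ M) : ∃ u : ℝ → ℝ, u 0 = 0 ∧ StrictMono u ∧ Function.Surjective u ∧
      ∀ t, HasDerivAt u (f (u t)) t := by
  -- Separation of variables: `τ s` is the time needed to reach `s`, and the solution is its
  -- inverse. The bound `f ≤ M` makes `τ` grow at least linearly, hence surjective.
  let τ : ℝ → ℝ := fun s => ∫ x in (0 : ℝ)..s, (f x)⁻¹
  have hfi : Continuous fun s => (f s)⁻¹ := hf.inv₀ fun s => (hpos s).ne'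
  have hτ : ∀ s, HasDerivAt τ (f s)⁻¹ s := fun s => hfi.integral_hasStrictDerivAt 0 s |>.hasDerivAt
  have hτ0 : τ 0 = 0 := intervalIntegral.integral_same
  have hτc : Continuous τ := continuous_iff_continuousAt.2 fun s => (hτ s).continuousAt
  have hmono : StrictMono τ := strictMono_of_hasDerivAt_pos hτ fun s => inv_pos.2 (hpos s)
  have hMpos : 0 < M := (hpos 0).trans_le (hM 0)
  have hlin : Monotone fun s => τ s - M⁻¹ * s := by
    refine monotone_of_hasDerivAt_nonneg
      (fun s => (hτ s).sub ((hasDerivAt_id s).const_mul M⁻¹)) fun s => ?_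
    have := inv_anti₀ (hpos s) (hM s)
    simpa using this
  have htop : Tendsto τ atTop atTop := by
    refine tendsto_atTop_mono' _ ?_ (tendsto_id.const_mul_atTop (inv_pos.2 hMpos))
    filter_upwards [eventually_ge_atTop 0] with s hs
    have := hlin hs
    simp only [hτ0] at this
    simp only [id]
    linarith
  have hbot : Tendsto τ atBot atBot := by
    refine tendsto_atBot_mono' _ ?_ (tendsto_id.const_mul_atBot (inv_pos.2 hMpos))
    filter_upwards [eventually_le_atBot 0] with s hs
    have := hlin hs
    simp only [hτ0] at this
    simp only [id]
    linarith
  let e := hmono.orderIsoOfSurjective τ (hτc.surjective htop hbot)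
  have he : ∀ s, e s = τ s := fun _ => rfl
  refine ⟨e.symm, ?_, e.symm.strictMono, e.symm.surjective, fun t => ?_⟩
  · rw [OrderIso.symm_apply_eq, he, hτ0]
  · have := HasDerivAt.of_local_left_inverse (f := τ) (g := e.symm) (a := t)
      e.symm.continuous.continuousAt (hτ (e.symm t)) (inv_pos.2 (hpos _)).ne'
      (Eventually.of_forall fun s => e.apply_symm_apply s)
    rwa [inv_inv] at this

/-- If the metrics with `y = x₁/x₂` are Einstein exactly for `y ∈ {y₁, y₂}`, this determines the
constant coefficients of the Ricci tensor. -/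
theorem coefficients_of_einstein_iff {A B C D y₁ y₂ : ℝ} (hB : 0 ≤ B) (hD : 0 ≤ D) (hy₁ : 0 < y₁)
    (hy : y₁ < y₂) (h : ∀ y, 0 < y → (A + B * y ^ 2 = y * (C - D * y) ↔ y = y₁ ∨ y = y₂)) :
    0 < B + D ∧ A = (B + D) * (y₁ * y₂) ∧ C = (B + D) * (y₁ + y₂) := by
  have e₁ := (h y₁ hy₁).2 (Or.inl rfl)
  have e₂ := (h y₂ (hy₁.trans hy)).2 (Or.inr rfl)
  have hC : C = (B + D) * (y₁ + y₂) := by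
    refine mul_left_cancel₀ (sub_pos.2 hy).ne' ?_
    linear_combination e₁ - e₂
  have hA : A = (B + D) * (y₁ * y₂) := by
    rw [hC] at e₁
    linear_combination e₁
  -- If `B + D = 0`, all four coefficients vanish and every `y > 0` is a root, for instance `y₁ +
  -- y₂`, which is larger than both.
  refine ⟨lt_of_le_of_ne (add_nonneg hB hD) fun h0 => ?_, hA, hC⟩
  have hB0 : B = 0 := by linarith
  have hD0 : D = 0 := by linarith
  rcases (h (y₁ + y₂) (by linarith)).1 (by rw [hA, hC, hB0, hD0]; ring) with h' | h' <;> linarith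

/-- The Ricci flow `x₁' = -2 (A + B y²)`, `x₂' = -2 (C - D y)`, `y = x₁ / x₂`, for diagonal
metrics. -/
structure IsDiagonalFlow (A B C D : ℝ) (x₁ x₂ : ℝ → ℝ) (J : Set ℝ) : Prop where
  pos₁ : ∀ t ∈ J, 0 < x₁ t
  pos₂ : ∀ t ∈ J, 0 < x₂ t
  deriv₁ : ∀ t ∈ J, HasDerivWithinAt x₁ (-2 * (A + B * (x₁ t / x₂ t) ^ 2)) J t
  deriv₂ : ∀ t ∈ J, HasDerivWithinAt x₂ (-2 * (C - D * (x₁ t / x₂ t))) J t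

namespace IsDiagonalFlow

variable {A B C D : ℝ} {x₁ x₂ z₁ z₂ : ℝ → ℝ} {J : Set ℝ}

theorem mono {J' : Set ℝ} (h : IsDiagonalFlow A B C D x₁ x₂ J) (hJ : J' ⊆ J) :
    IsDiagonalFlow A B C D x₁ x₂ J' where
  pos₁ t ht := h.pos₁ t (hJ ht)
  pos₂ t ht := h.pos₂ t (hJ ht)
  deriv₁ t ht := (h.deriv₁ t (hJ ht)).mono hJ
  deriv₂ t ht := (h.deriv₂ t (hJ ht)).mono hJ

theorem continuousOn₁ (h : IsDiagonalFlow A B C D x₁ x₂ J) : ContinuousOn x₁ J :=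
  fun t ht => (h.deriv₁ t ht).continuousWithinAt

theorem continuousOn₂ (h : IsDiagonalFlow A B C D x₁ x₂ J) : ContinuousOn x₂ J :=
  fun t ht => (h.deriv₂ t ht).continuousWithinAt

theorem exists_bounds {f : ℝ → ℝ} {a b : ℝ} (hab : a ≤ b) (hf : ContinuousOn f (Icc a b))
    (hpos : ∀ t ∈ Icc a b, 0 < f t) : ∃ m M, 0 < m ∧ ∀ t ∈ Icc a b, f t ∈ Icc m M := by
  obtain ⟨s, hs, hmin⟩ := isCompact_Icc.exists_isMinOn (nonempty_Icc.2 hab) hf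
  obtain ⟨s', _, hmax⟩ := isCompact_Icc.exists_isMaxOn (nonempty_Icc.2 hab) hf
  exact ⟨f s, f s', hpos s hs, fun t ht => ⟨hmin ht, hmax ht⟩⟩

/-- On a compact time interval both solutions stay in a compact convex box away from `x₂ = 0`, where
the vector field is `C¹` and so Lipschitz. -/
theorem eqOn_Icc {b : ℝ} (hb : 0 ≤ b) {T : ℝ} (hbT : b < T)
    (h : IsDiagonalFlow A B C D x₁ x₂ (Ico 0 T))
    (h' : IsDiagonalFlow A B C D z₁ z₂ (Ico 0 T)) (h₁ : x₁ 0 = z₁ 0) (h₂ : x₂ 0 = z₂ 0) :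
    EqOn (fun t => (x₁ t, x₂ t)) (fun t => (z₁ t, z₂ t)) (Icc 0 b) := by
  have hsub : Icc 0 b ⊆ Ico 0 T := fun t ht => ⟨ht.1, ht.2.trans_lt hbT⟩
  obtain ⟨m₁, M₁, hm₁, B₁⟩ := exists_bounds hb (h.continuousOn₁.mono hsub)
    fun t ht => h.pos₁ t (hsub ht)
  obtain ⟨m₂, M₂, hm₂, B₂⟩ := exists_bounds hb (h.continuousOn₂.mono hsub)
    fun t ht => h.pos₂ t (hsub ht)
  obtain ⟨m₃, M₃, hm₃, B₃⟩ := exists_bounds hb (h'.continuousOn₁.mono hsub)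
    fun t ht => h'.pos₁ t (hsub ht)
  obtain ⟨m₄, M₄, hm₄, B₄⟩ := exists_bounds hb (h'.continuousOn₂.mono hsub)
    fun t ht => h'.pos₂ t (hsub ht)
  let S : Set (ℝ × ℝ) := Icc (min m₁ m₃) (max M₁ M₃) ×ˢ Icc (min m₂ m₄) (max M₂ M₄)
  let v : ℝ × ℝ → ℝ × ℝ :=
    fun q => (-2 * (A + B * (q.1 / q.2) ^ 2), -2 * (C - D * (q.1 / q.2)))
  have hv : ContDiffOn ℝ 1 v S := by
    have hd : ContDiffOn ℝ 1 (fun q : ℝ × ℝ => q.1 / q.2) S :=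
      contDiffOn_fst.div contDiffOn_snd fun q hq => ((lt_min hm₂ hm₄).trans_le hq.2.1).ne'
    exact (contDiffOn_const.mul (contDiffOn_const.add (contDiffOn_const.mul (hd.pow 2)))).prodMk
      (contDiffOn_const.mul (contDiffOn_const.sub (contDiffOn_const.mul hd)))
  obtain ⟨L, hL⟩ := hv.exists_lipschitzOnWith one_ne_zero
    ((convex_Icc _ _).prod (convex_Icc _ _)) (isCompact_Icc.prod isCompact_Icc)
  have hnhds : ∀ t ∈ Ico 0 b, Ico 0 T ∈ 𝓝[≥] t := fun t ht =>
    mem_of_superset (Ico_mem_nhdsGE (ht.2.trans hbT)) (Ico_subset_Ico_left ht.1)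
  refine ODE_solution_unique_of_mem_Icc_right (v := fun _ => v) (s := fun _ => S) (K := L)
    (fun _ _ => hL) ((h.continuousOn₁.prodMk h.continuousOn₂).mono hsub) (fun t ht => ?_)
    (fun t ht => ?_) ((h'.continuousOn₁.prodMk h'.continuousOn₂).mono hsub) (fun t ht => ?_)
    (fun t ht => ?_) (Prod.ext h₁ h₂)
  · have ht' := hsub (Ico_subset_Icc_self ht)
    exact ((h.deriv₁ t ht').prodMk (h.deriv₂ t ht')).mono_of_mem_nhdsWithin (hnhds t ht)
  · have ht' := Ico_subset_Icc_self ht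
    exact ⟨Icc_subset_Icc (min_le_left _ _) (le_max_left _ _) (B₁ t ht'),
      Icc_subset_Icc (min_le_left _ _) (le_max_left _ _) (B₂ t ht')⟩
  · have ht' := hsub (Ico_subset_Icc_self ht)
    exact ((h'.deriv₁ t ht').prodMk (h'.deriv₂ t ht')).mono_of_mem_nhdsWithin (hnhds t ht)
  · have ht' := Ico_subset_Icc_self ht
    exact ⟨Icc_subset_Icc (min_le_right _ _) (le_max_right _ _) (B₃ t ht'),
      Icc_subset_Icc (min_le_right _ _) (le_max_right _ _) (B₄ t ht')⟩

theorem unique {T : ℝ} (h : IsDiagonalFlow A B C D x₁ x₂ (Ico 0 T))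
    (h' : IsDiagonalFlow A B C D z₁ z₂ (Ico 0 T)) (h₁ : x₁ 0 = z₁ 0) (h₂ : x₂ 0 = z₂ 0) {t : ℝ}
    (ht : t ∈ Ico 0 T) : x₁ t = z₁ t ∧ x₂ t = z₂ t :=
  Prod.ext_iff.1 (eqOn_Icc ht.1 ht.2 h h' h₁ h₂ (right_mem_Icc.2 ht.1))

/-- The equation for `y = x₁ / x₂`. -/
theorem hasDerivWithinAt_div {y₁ y₂ : ℝ}
    (h : IsDiagonalFlow ((B + D) * (y₁ * y₂)) B ((B + D) * (y₁ + y₂)) D x₁ x₂ J) {t : ℝ}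
    (ht : t ∈ J) : HasDerivWithinAt (fun t => x₁ t / x₂ t)
      (-(2 * (B + D) * (x₁ t / x₂ t - y₁) * (x₁ t / x₂ t - y₂) / x₂ t)) J t := by
  have hx₂ := (h.pos₂ t ht).ne'
  refine ((h.deriv₁ t ht).div (h.deriv₂ t ht) hx₂).congr_deriv ?_
  field_simp
  ring

/-- Backwards in time, `y` stays above `y(0)` if `y(0) > y₂`. -/
theorem le_div_of_nonpos {y₁ y₂ T : ℝ} (ha : 0 < B + D) (hy : y₁ < y₂) (hT : 0 < T)
    (h : IsDiagonalFlow ((B + D) * (y₁ * y₂)) B ((B + D) * (y₁ + y₂)) D x₁ x₂ (Iio T))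
    (hy₀ : y₂ < x₁ 0 / x₂ 0) {t : ℝ} (ht : t ≤ 0) : x₁ 0 / x₂ 0 ≤ x₁ t / x₂ t := by
  by_contra! hlt
  -- A barrier with `y₂ < c < y(0)` and `y(t) ≤ c`: on the level `c > y₂` the derivative of `y` is
  -- negative, so `y` cannot cross it upwards between `t` and `0`.
  set c := max (x₁ t / x₂ t) ((y₂ + x₁ 0 / x₂ 0) / 2) with hc
  have hc₂ : y₂ < c := lt_of_lt_of_le (by linarith) (le_max_right _ _)
  have hc₀ : c < x₁ 0 / x₂ 0 := max_lt hlt (by linarith)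
  refine hc₀.not_ge (image_le_of_deriv_right_lt_deriv_boundary (f := fun t => x₁ t / x₂ t)
    (f' := fun t => -(2 * (B + D) * (x₁ t / x₂ t - y₁) * (x₁ t / x₂ t - y₂) / x₂ t))
    (B := fun _ => c) (B' := fun _ => 0) (a := t) (b := 0) (fun s hs => ?_) (fun s hs => ?_)
    (le_max_left _ _) (fun s => hasDerivAt_const s c) (fun s hs e => ?_) (right_mem_Icc.2 ht))
  · exact ((h.hasDerivWithinAt_div (hs.2.trans_lt hT)).continuousWithinAt).mono
      fun r hr => hr.2.trans_lt hT
  · exact (h.hasDerivWithinAt_div (hs.2.trans hT)).mono_of_mem_nhdsWithin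
      (mem_nhdsWithin_of_mem_nhds (Iio_mem_nhds (hs.2.trans hT)))
  · have hx := h.pos₂ s (hs.2.trans hT)
    rw [e, neg_lt_zero]
    have : 0 < c - y₁ := by linarith
    have : 0 < c - y₂ := by linarith
    positivity

/-- There is no ancient solution with `y(0) > y₂`. -/
theorem not_ancient {y₁ y₂ T : ℝ} (hD : 0 ≤ D) (ha : 0 < B + D) (hy₁ : 0 < y₁)
    (hy : y₁ < y₂) (hT : 0 < T)
    (h : IsDiagonalFlow ((B + D) * (y₁ * y₂)) B ((B + D) * (y₁ + y₂)) D x₁ x₂ (Iio T))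
    (hy₀ : y₂ < x₁ 0 / x₂ 0) : False := by
  set a := B + D
  set C := a * (y₁ + y₂) with hCdef
  have hC : 0 < C := mul_pos ha (by linarith)
  have hlt : ∀ {t : ℝ}, t ≤ 0 → t < T := fun ht => ht.trans_lt hT
  have hu : ∀ {t : ℝ}, t ≤ 0 → y₂ < x₁ t / x₂ t := fun ht =>
    hy₀.trans_le (h.le_div_of_nonpos ha hy hT hy₀ ht)
  have hd : ∀ {f : ℝ → ℝ} {f' t : ℝ}, t < T → HasDerivWithinAt f f' (Iio T) t →
      HasDerivAt f f' t := fun ht hf => hf.hasDerivAt (Iio_mem_nhds ht)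
  -- `x₂' = -2 (C - D y) ≥ -2 C` because `D y ≥ 0`.
  have hx₂ : ∀ {t : ℝ}, t ≤ 0 → x₂ t ≤ x₂ 0 - 2 * C * t := by
    have hm : MonotoneOn (fun t => x₂ t + 2 * C * t) (Iio T) := by
      refine monotoneOn_of_hasDerivWithinAt_nonneg (convex_Iio T)
        (f' := fun t => -2 * (C - D * (x₁ t / x₂ t)) + 2 * C * 1) ?_ ?_ ?_
      · exact h.continuousOn₂.add (by fun_prop)
      · intro t ht
        rw [interior_Iio] at ht ⊢
        exact (h.deriv₂ t ht).add ((hasDerivWithinAt_id t _).const_mul _)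
      · intro t ht
        rw [interior_Iio] at ht
        have := mul_nonneg hD (div_pos (h.pos₁ t ht) (h.pos₂ t ht)).le
        linarith
    intro t ht
    have := hm (hlt ht) hT ht
    simp only [mul_zero, add_zero] at this
    linarith
  have hpos : ∀ {t : ℝ}, t ≤ 0 → 0 < x₂ 0 - 2 * C * t := fun ht =>
    (h.pos₂ _ (hlt ht)).trans_le (hx₂ ht)
  -- The derivative of `-1 / (y - y₂)` is at most `-2a / x₂`, hence at most `-2a / (x₂(0) - 2Ct)`,
  -- which is the derivative of `(a / C) log (x₂(0) - 2Ct)`.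
  have hanti : AntitoneOn
      (fun t => -(x₁ t / x₂ t - y₂)⁻¹ - a / C * Real.log (x₂ 0 - 2 * C * t)) (Iic 0) := by
    have hderiv : ∀ t ∈ Iic (0 : ℝ), HasDerivAt
        (fun t => -(x₁ t / x₂ t - y₂)⁻¹ - a / C * Real.log (x₂ 0 - 2 * C * t))
        (-(-(-(2 * a * (x₁ t / x₂ t - y₁) * (x₁ t / x₂ t - y₂) / x₂ t)) / (x₁ t / x₂ t - y₂) ^ 2) -
          a / C * (-(2 * C * 1) / (x₂ 0 - 2 * C * t))) t := by
      intro t ht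
      have h₁ := (hd (hlt ht) (h.hasDerivWithinAt_div (hlt ht))).sub_const y₂
      have h₂ := ((hasDerivAt_id t).const_mul (2 * C)).const_sub (x₂ 0)
      exact (h₁.inv (sub_pos.2 (hu ht)).ne').neg.sub ((h₂.log (hpos ht).ne').const_mul _)
    refine antitoneOn_of_hasDerivWithinAt_nonpos (convex_Iic 0)
      (fun t ht => (hderiv t ht).continuousAt.continuousWithinAt)
      (fun t ht => (hderiv t (interior_subset ht)).hasDerivWithinAt) fun t ht => ?_
    have ht' : t ≤ 0 := interior_subset (s := Iic (0 : ℝ)) ht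
    have hu' := sub_pos.2 (hu ht')
    have hx := h.pos₂ t (hlt ht')
    have e₁ : -(-(-(2 * a * (x₁ t / x₂ t - y₁) * (x₁ t / x₂ t - y₂) / x₂ t)) /
        (x₁ t / x₂ t - y₂) ^ 2) =
        -(2 * a / x₂ t + 2 * a * (y₂ - y₁) / (x₂ t * (x₁ t / x₂ t - y₂))) := by
      generalize x₁ t / x₂ t = y at *
      field_simp
      ring
    have e₂ : a / C * (-(2 * C * 1) / (x₂ 0 - 2 * C * t)) = -(2 * a / (x₂ 0 - 2 * C * t)) := by
      have := hpos ht'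
      field_simp
    rw [e₁, e₂]
    have i₁ : 2 * a / (x₂ 0 - 2 * C * t) ≤ 2 * a / x₂ t :=
      div_le_div_of_nonneg_left (by linarith) hx (hx₂ ht')
    have i₂ : 0 ≤ 2 * a * (y₂ - y₁) / (x₂ t * (x₁ t / x₂ t - y₂)) :=
      div_nonneg (mul_nonneg (by linarith) (by linarith)) (mul_pos hx hu').le
    linarith
  set u₀ := x₁ 0 / x₂ 0 - y₂
  have hu₀ : 0 < u₀ := sub_pos.2 hy₀
  -- The time `t` is chosen with `log (x₂(0) - 2Ct) = L`. There the logarithm has grown by exactly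
  -- enough to force `1 / (y(t) - y₂) ≤ 0`.
  set L := Real.log (x₂ 0) + C / a * u₀⁻¹ with hL
  set t := (x₂ 0 - Real.exp L) / (2 * C) with htdef
  have hx₀ : 0 < x₂ 0 := h.pos₂ 0 hT
  have ht : t ≤ 0 := by
    refine div_nonpos_of_nonpos_of_nonneg ?_ (by linarith)
    rw [sub_nonpos, ← Real.log_le_iff_le_exp hx₀, hL]
    have : 0 < C / a * u₀⁻¹ := by positivity
    linarith
  have hte : x₂ 0 - 2 * C * t = Real.exp L := by
    rw [htdef]
    field_simp
    ring
  have := hanti (a := t) (b := 0) ht self_mem_Iic ht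
  simp only [mul_zero, sub_zero] at this
  rw [hte, Real.log_exp, hL] at this
  have hut : 0 < (x₁ t / x₂ t - y₂)⁻¹ := inv_pos.2 (sub_pos.2 (hu ht))
  have e : a / C * (Real.log (x₂ 0) + C / a * u₀⁻¹) = a / C * Real.log (x₂ 0) + u₀⁻¹ := by
    field_simp
  rw [e] at this
  linarith

end IsDiagonalFlow
end HomRicci

/-! ### The planar system: the shrinking solution -/

namespace HomRicci
namespace IsDiagonalFlow

/-- The auxiliary quantities `s` and `r = s ^ q` along the flow: `r = (y - y₂) / (y - y₁)`
satisfies `r' = -p r / x₂` with `x₂ = c (1 - r) ^ θ s`. -/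
theorem exists_parameter {c p q θ s₀ : ℝ} (hc : 0 < c) (hp : 0 < p) (hq : 0 < q) (hθ : 0 ≤ θ)
    (hs₀ : 0 < s₀) (hr : s₀ ^ q < 1) : ∃ T : ℝ, 0 < T ∧ ∃ s : ℝ → ℝ, Continuous s ∧ s 0 = s₀ ∧
      s T = 0 ∧ ∀ t ∈ Ico 0 T, 0 < s t ∧ s t ^ q < 1 ∧
        HasDerivAt s (-(p / q / (c * (1 - s t ^ q) ^ θ))) t := by
  -- Clamping to `[0, s₀]` makes the speed continuous, positive and bounded on the whole line; the
  -- solution stays in this interval for the times considered, so the clamp has no effect on it.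
  let pr : ℝ → ℝ := fun x => max 0 (min x s₀)
  have hpr₀ : ∀ x, 0 ≤ pr x := fun x => le_max_left _ _
  have hpr₁ : ∀ x, pr x ≤ s₀ := fun x => max_le hs₀.le (min_le_right _ _)
  have hprc : Continuous pr := by fun_prop
  have hR : ∀ x, pr x ^ q ≤ s₀ ^ q := fun x => Real.rpow_le_rpow (hpr₀ x) (hpr₁ x) hq.le
  have hb : ∀ x, 0 < 1 - pr x ^ q := fun x => by linarith [hR x]
  have hs₁ : 0 < 1 - s₀ ^ q := by linarith
  let f : ℝ → ℝ := fun x => p / q / (c * (1 - pr x ^ q) ^ θ)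
  have hf : Continuous f := by
    refine continuous_const.div (continuous_const.mul ?_)
      fun x => (mul_pos hc (Real.rpow_pos_of_pos (hb x) θ)).ne'
    exact (continuous_const.sub (hprc.rpow_const fun _ => Or.inr hq.le)).rpow_const
      fun _ => Or.inr hθ
  have hfpos : ∀ x, 0 < f x := fun x =>
    div_pos (div_pos hp hq) (mul_pos hc (Real.rpow_pos_of_pos (hb x) θ))
  have hfM : ∀ x, f x ≤ p / q / (c * (1 - s₀ ^ q) ^ θ) := fun x => by
    refine div_le_div_of_nonneg_left (by positivity)
      (mul_pos hc (Real.rpow_pos_of_pos hs₁ θ)) (mul_le_mul_of_nonneg_left ?_ hc.le)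
    exact Real.rpow_le_rpow hs₁.le (by linarith [hR x]) hθ
  obtain ⟨u, hu₀, hmono, hsurj, hu⟩ := exists_scalar_flow hf hfpos hfM
  obtain ⟨T, hT⟩ := hsurj s₀
  have hTpos : 0 < T := hmono.lt_iff_lt.1 (by rwa [hu₀, hT])
  -- The flow `u` increases from `0` and reaches `s₀` at time `T`; reversing time gives a solution
  -- that starts at `s₀` and hits `0`.
  refine ⟨T, hTpos, fun t => u (T - t), ?_, by simp [hT], by simp [hu₀], fun t ht => ?_⟩
  · exact (continuous_iff_continuousAt.2 fun t => (hu t).continuousAt).comp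
      (continuous_const.sub continuous_id)
  · have h₁ : 0 < u (T - t) := hu₀ ▸ hmono (sub_pos.2 ht.2)
    have h₂ : u (T - t) ≤ s₀ := hT ▸ hmono.monotone (sub_le_self T ht.1)
    have e : pr (u (T - t)) = u (T - t) := by
      simp only [pr, min_eq_left h₂, max_eq_right h₁.le]
    refine ⟨h₁, (Real.rpow_le_rpow h₁.le h₂ hq.le).trans_lt hr, ?_⟩
    have := (hu (T - t)).comp_const_sub T t
    simp only [f, e] at this
    exact this

/-- For `r = (y - y₂) / (y - y₁)` one has `y = y₂ + δ r / (1 - r)` and `(log r)' = -2aδ / x₂`, hence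
`d log x₂ / d log r = (C - D y) / (aδ) = γ - θ r / (1 - r)`. This integrates to `x₂ = c (1 - r)^θ
r^γ`. Passing to `s = r^γ` removes the singularity of the equation at `r = 0`. -/
theorem exists_shrinking {B D y₁ y₂ a₁ a₂ : ℝ} (hB : 0 ≤ B) (hD : 0 ≤ D) (ha : 0 < B + D)
    (hy₁ : 0 < y₁) (hy : y₁ < y₂) (ha₂ : 0 < a₂) (hy₀ : y₂ < a₁ / a₂) :
    ∃ T : ℝ, 0 < T ∧ ∃ x₁ x₂ : ℝ → ℝ, x₁ 0 = a₁ ∧ x₂ 0 = a₂ ∧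
      IsDiagonalFlow ((B + D) * (y₁ * y₂)) B ((B + D) * (y₁ + y₂)) D x₁ x₂ (Ico 0 T) ∧
      Tendsto x₁ (𝓝[<] T) (𝓝 0) ∧ Tendsto x₂ (𝓝[<] T) (𝓝 0) ∧
      Tendsto (fun t => x₁ t / x₂ t) (𝓝[<] T) (𝓝 y₂) := by
  set a := B + D with hadef
  set δ := y₂ - y₁ with hδ
  have hδ₀ : 0 < δ := sub_pos.2 hy
  set y₀ := a₁ / a₂ with hy₀def
  set r₀ := (y₀ - y₂) / (y₀ - y₁) with hr₀def
  have hden : 0 < y₀ - y₁ := by linarith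
  have hr₀ : 0 < r₀ := div_pos (by linarith) hden
  have hr₁ : r₀ < 1 := (div_lt_one hden).2 (by linarith)
  -- Positivity of this exponent, which makes `x₂` vanish with `r`, rests on `a (y₁ + y₂) - D y₂ = a
  -- y₁ + B y₂`.
  set γ := (a * (y₁ + y₂) - D * y₂) / (a * δ) with hγdef
  have hγ : 0 < γ := by
    refine div_pos ?_ (mul_pos ha hδ₀)
    have e : a * (y₁ + y₂) - D * y₂ = a * y₁ + B * y₂ := by rw [hadef]; ring
    rw [e]
    have := mul_nonneg hB (hy₁.trans hy).le
    have := mul_pos ha hy₁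
    linarith
  set θ := D / a with hθdef
  have hθ : 0 ≤ θ := div_nonneg hD ha.le
  set s₀ := r₀ ^ γ with hs₀def
  have hs₀ : 0 < s₀ := Real.rpow_pos_of_pos hr₀ γ
  have hs₀r : s₀ ^ γ⁻¹ = r₀ := Real.rpow_rpow_inv hr₀.le hγ.ne'
  have hθ₀ : 0 < (1 - r₀) ^ θ := Real.rpow_pos_of_pos (by linarith) θ
  set c := a₂ / ((1 - r₀) ^ θ * s₀) with hcdef
  have hc : 0 < c := div_pos ha₂ (mul_pos hθ₀ hs₀)
  obtain ⟨T, hT, s, hsc, hs0, hsT, hs⟩ := exists_parameter (p := 2 * a * δ) (q := γ⁻¹) hc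
    (by positivity) (inv_pos.2 hγ) hθ hs₀ (by rwa [hs₀r])
  let r : ℝ → ℝ := fun t => s t ^ γ⁻¹
  let y : ℝ → ℝ := fun t => (y₂ - y₁ * r t) / (1 - r t)
  let x₂ : ℝ → ℝ := fun t => c * ((1 - r t) ^ θ * s t)
  have hrc : Continuous r := hsc.rpow_const fun _ => Or.inr (inv_pos.2 hγ).le
  have hr0 : r 0 = r₀ := by simp only [r, hs0, hs₀r]
  have hrT : r T = 0 := by simp only [r, hsT, Real.zero_rpow (inv_pos.2 hγ).ne']
  have hx₂0 : x₂ 0 = a₂ := by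
    simp only [x₂, hr0, hs0, hcdef]
    field_simp
  have hy0 : y 0 = y₀ := by
    have : y₀ - y₁ - (y₀ - y₂) ≠ 0 := by
      rw [sub_sub_sub_cancel_left]
      exact hδ₀.ne'
    simp only [y, hr0, hr₀def]
    rw [one_sub_div hden.ne', mul_div_assoc', sub_div' hden.ne', div_div_div_cancel_right₀ hden.ne',
      div_eq_iff this]
    ring
  have hxc : Continuous x₂ := continuous_const.mul
    (((continuous_const.sub hrc).rpow_const fun _ => Or.inr hθ).mul hsc)
  have hxT : Tendsto x₂ (𝓝[<] T) (𝓝 0) := by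
    have h : x₂ T = 0 := by simp only [x₂, hsT, mul_zero]
    exact h ▸ (hxc.tendsto T).mono_left nhdsWithin_le_nhds
  have hyT : Tendsto y (𝓝[<] T) (𝓝 y₂) := by
    have h : y T = y₂ := by simp only [y, hrT, mul_zero, sub_zero, div_one]
    have hca : ContinuousAt y T := by
      refine ContinuousAt.div ?_ ?_ ?_
      · exact (continuous_const.sub (continuous_const.mul hrc)).continuousAt
      · exact (continuous_const.sub hrc).continuousAt
      · simp only [hrT, sub_zero, ne_eq, one_ne_zero, not_false_eq_true]
    exact h ▸ hca.tendsto.mono_left nhdsWithin_le_nhds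
  have hpos : ∀ t ∈ Ico 0 T, 0 < s t ∧ 0 < r t ∧ r t < 1 ∧ 0 < x₂ t ∧ 0 < y t := by
    intro t ht
    obtain ⟨h₁, h₂, -⟩ := hs t ht
    have h₂' : r t < 1 := h₂
    have h₃ : 0 < 1 - r t := by linarith
    refine ⟨h₁, Real.rpow_pos_of_pos h₁ _, h₂, mul_pos hc (mul_pos (Real.rpow_pos_of_pos h₃ θ) h₁),
      div_pos ?_ h₃⟩
    have := mul_lt_mul_of_pos_left h₂' hy₁
    linarith
  have hdr : ∀ t ∈ Ico 0 T, HasDerivAt r (-(2 * a * δ * r t / x₂ t)) t := by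
    intro t ht
    obtain ⟨h₁, h₂, h₃, h₄, -⟩ := hpos t ht
    refine ((hs t ht).2.2.rpow_const (p := γ⁻¹) (Or.inl h₁.ne')).congr_deriv ?_
    have h₃' := Real.rpow_pos_of_pos (sub_pos.2 h₃) θ
    rw [Real.rpow_sub_one h₁.ne']
    change -(2 * a * δ / γ⁻¹ / (c * (1 - r t) ^ θ)) * γ⁻¹ * (r t / s t) =
      -(2 * a * δ * r t / (c * ((1 - r t) ^ θ * s t)))
    field_simp
  have hdx : ∀ t ∈ Ico 0 T, HasDerivAt x₂ (-2 * (a * (y₁ + y₂) - D * y t)) t := by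
    intro t ht
    obtain ⟨h₁, h₂, h₃, h₄, -⟩ := hpos t ht
    have h₃' := sub_pos.2 h₃
    have h₃'' := Real.rpow_pos_of_pos h₃' θ
    refine (((((hdr t ht).const_sub 1).rpow_const (p := θ) (Or.inl h₃'.ne')).mul
      (hs t ht).2.2).const_mul c).congr_deriv ?_
    rw [Real.rpow_sub_one h₃'.ne']
    change c * (- -(2 * a * δ * r t / (c * ((1 - r t) ^ θ * s t))) * θ *
      ((1 - r t) ^ θ / (1 - r t)) * s t + (1 - r t) ^ θ *
        -(2 * a * δ / γ⁻¹ / (c * (1 - r t) ^ θ))) =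
      -2 * (a * (y₁ + y₂) - D * ((y₂ - y₁ * r t) / (1 - r t)))
    rw [hθdef, hγdef]
    generalize (1 - r t) ^ (D / a) = w at *
    generalize r t = r at *
    have : a ≠ 0 := ha.ne'
    field_simp
    rw [hδ]
    ring
  have hdy : ∀ t ∈ Ico 0 T, HasDerivAt y (-(2 * a * (y t - y₁) * (y t - y₂) / x₂ t)) t := by
    intro t ht
    obtain ⟨h₁, h₂, h₃, h₄, -⟩ := hpos t ht
    have h₃' := sub_pos.2 h₃
    refine ((((hdr t ht).const_mul y₁).const_sub y₂).div ((hdr t ht).const_sub 1)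
      h₃'.ne').congr_deriv ?_
    simp only [y]
    field_simp
    rw [hδ]
    ring
  have hquot : ∀ t ∈ Ico 0 T, y t * x₂ t / x₂ t = y t := fun t ht =>
    mul_div_cancel_right₀ _ (hpos t ht).2.2.2.1.ne'
  refine ⟨T, hT, fun t => y t * x₂ t, x₂, ?_, hx₂0, ⟨fun t ht => ?_, fun t ht => ?_,
    fun t ht => ?_, fun t ht => ?_⟩, ?_, hxT, ?_⟩
  · simp only [hy0, hx₂0, hy₀def]
    field_simp
  · exact mul_pos (hpos t ht).2.2.2.2 (hpos t ht).2.2.2.1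
  · exact (hpos t ht).2.2.2.1
  · refine (((hdy t ht).mul (hdx t ht)).congr_deriv ?_).hasDerivWithinAt
    rw [hquot t ht]
    have := (hpos t ht).2.2.2.1.ne'
    field_simp
    rw [hadef]
    ring
  · rw [hquot t ht]
    exact (hdx t ht).hasDerivWithinAt
  · simpa using hyT.mul hxT
  · refine hyT.congr' ?_
    filter_upwards [Ico_mem_nhdsLT hT] with t ht using (hquot t ht).symm

end IsDiagonalFlow
end HomRicci

/-! ### Translation between invariant metrics and the planar system -/

namespace HomRicci
namespace IsTwoSummandSpace

variable {E : Type*} [NormedAddCommGroup E] [NormedSpace ℝ E] [FiniteDimensional ℝ E]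
  [CompleteSpace E]
  {G : Type*} [TopologicalSpace G] [ChartedSpace E G] [Group G] [LieGroup 𝓘(ℝ, E) ∞ G]
  {K H : Subgroup G} {p₁ p₂ : Submodule ℝ (GroupLieAlgebra 𝓘(ℝ, E) G)}

theorem _root_.HomRicci.ScalarProduct.exists_unit_vector {V : Type*} [AddCommGroup V] [Module ℝ V]
    (Q : ScalarProduct V) {W : Submodule ℝ V} {X : V} (hX : X ∈ W) (h0 : X ≠ 0) :
    ∃ Y ∈ W, Q.form Y Y = 1 := by
  have h := Q.pos X h0
  have hs := Real.mul_self_sqrt h.le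
  have hs' := Real.sqrt_pos.2 h
  refine ⟨(√(Q.form X X))⁻¹ • X, W.smul_mem _ hX, ?_⟩
  simp only [map_smul, LinearMap.smul_apply, smul_eq_mul]
  field_simp
  rw [pow_two, hs]

omit [FiniteDimensional ℝ E] in
theorem exists_unit_vectors (hM : IsTwoSummandSpace K H p₁ p₂) (Q : InvariantMetric K (p₁ ⊔ p₂)) :
    ∃ V₁ V₂ : ↥(p₁ ⊔ p₂), hM.proj₁ V₁ = V₁ ∧ hM.proj₂ V₁ = 0 ∧ hM.proj₁ V₂ = 0 ∧
      hM.proj₂ V₂ = V₂ ∧ Q.form V₁ V₁ = 1 ∧ Q.form V₂ V₂ = 1 := by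
  obtain ⟨X₁, hX₁, hX₁0⟩ := (Submodule.ne_bot_iff _).1 hM.irreducible₁.2.1
  obtain ⟨X₂, hX₂, hX₂0⟩ := (Submodule.ne_bot_iff _).1 hM.irreducible₂.2.1
  obtain ⟨V₁, m₁, u₁⟩ := Q.exists_unit_vector (W := left p₁ p₂)
    (X := ⟨X₁, le_sup_left (a := p₁) hX₁⟩) hX₁ fun h => hX₁0 (congrArg Subtype.val h)
  obtain ⟨V₂, m₂, u₂⟩ := Q.exists_unit_vector (W := right p₁ p₂)
    (X := ⟨X₂, le_sup_right (a := p₁) hX₂⟩) hX₂ fun h => hX₂0 (congrArg Subtype.val h)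
  exact ⟨V₁, V₂, hM.proj₁_of_mem m₁, hM.proj₂_eq_zero m₁, hM.proj₁_eq_zero m₂,
    hM.proj₂_of_mem m₂, u₁, u₂⟩

/-- `Ric` of the diagonal metrics is given by the constants `A`, `B`, `C`, `D`. -/
def HasRicciCoefficients (hM : IsTwoSummandSpace K H p₁ p₂) (Q : InvariantMetric K (p₁ ⊔ p₂))
    (A B C D : ℝ) : Prop :=
  ∀ (g : InvariantMetric K (p₁ ⊔ p₂)) (x₁ x₂ : ℝ), IsDiagonal Q g x₁ x₂ → ∀ X Y,
    ricci hM.isCompl g.toScalarProduct X Y =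
      (A + B * (x₁ / x₂) ^ 2) * Q.form (hM.proj₁ X) (hM.proj₁ Y) +
      (C - D * (x₁ / x₂)) * Q.form (hM.proj₂ X) (hM.proj₂ Y)

namespace HasRicciCoefficients

variable {hM : IsTwoSummandSpace K H p₁ p₂} {Q : InvariantMetric K (p₁ ⊔ p₂)} {A B C D : ℝ}

theorem isEinstein_iff (hR : HasRicciCoefficients hM Q A B C D)
    {g : InvariantMetric K (p₁ ⊔ p₂)} {x₁ x₂ : ℝ} (hg : IsDiagonal Q g x₁ x₂) :
    IsEinstein hM.isCompl g.toScalarProduct ↔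
      A + B * (x₁ / x₂) ^ 2 = x₁ / x₂ * (C - D * (x₁ / x₂)) := by
  have hx₁ := hg.1
  have hx₂ := hg.2.1
  constructor
  · rintro ⟨c, hc⟩
    obtain ⟨V₁, V₂, e₁, e₂, e₃, e₄, u₁, u₂⟩ := hM.exists_unit_vectors Q
    have h₁ := hc V₁ V₁
    have h₂ := hc V₂ V₂
    rw [hR g x₁ x₂ hg, hg.form_eq hM, e₁, e₂, u₁] at h₁
    rw [hR g x₁ x₂ hg, hg.form_eq hM, e₃, e₄, u₂] at h₂
    simp only [map_zero, mul_one, mul_zero, add_zero, zero_add] at h₁ h₂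
    rw [h₁, h₂]
    field_simp
  · intro h
    refine ⟨(C - D * (x₁ / x₂)) / x₂, fun X Y => ?_⟩
    rw [hR g x₁ x₂ hg, hg.form_eq hM, h]
    field_simp

theorem isRicciFlowOn (hR : HasRicciCoefficients hM Q A B C D) {x₁ x₂ : ℝ → ℝ} {J : Set ℝ}
    (h : IsDiagonalFlow A B C D x₁ x₂ J) {g : ℝ → InvariantMetric K (p₁ ⊔ p₂)}
    (hg : ∀ t ∈ J, IsDiagonal Q (g t) (x₁ t) (x₂ t)) : IsRicciFlowOn hM.isCompl g J := by
  intro t ht X Y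
  have hd := ((h.deriv₁ t ht).mul_const (Q.form (hM.proj₁ X) (hM.proj₁ Y))).add
    ((h.deriv₂ t ht).mul_const (Q.form (hM.proj₂ X) (hM.proj₂ Y)))
  refine (hd.congr (fun s hs => (hg s hs).form_eq hM X Y)
    ((hg t ht).form_eq hM X Y)).congr_deriv ?_
  rw [hR (g t) _ _ (hg t ht)]
  ring

theorem isDiagonalFlow (hR : HasRicciCoefficients hM Q A B C D) {x₁ x₂ : ℝ → ℝ} {J : Set ℝ}
    {g : ℝ → InvariantMetric K (p₁ ⊔ p₂)} (h : IsRicciFlowOn hM.isCompl g J)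
    (hg : ∀ t ∈ J, IsDiagonal Q (g t) (x₁ t) (x₂ t)) : IsDiagonalFlow A B C D x₁ x₂ J := by
  obtain ⟨V₁, V₂, e₁, e₂, e₃, e₄, u₁, u₂⟩ := hM.exists_unit_vectors Q
  have f₁ : ∀ t ∈ J, x₁ t = (g t).form V₁ V₁ := fun t ht => by
    rw [(hg t ht).form_eq hM, e₁, e₂, u₁, map_zero, mul_one, mul_zero, add_zero]
  have f₂ : ∀ t ∈ J, x₂ t = (g t).form V₂ V₂ := fun t ht => by
    rw [(hg t ht).form_eq hM, e₃, e₄, u₂, map_zero, mul_one, mul_zero, zero_add]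
  refine ⟨fun t ht => (hg t ht).1, fun t ht => (hg t ht).2.1, fun t ht => ?_, fun t ht => ?_⟩
  · refine ((h t ht V₁ V₁).congr f₁ (f₁ t ht)).congr_deriv ?_
    rw [hR (g t) _ _ (hg t ht), e₁, e₂, u₁, map_zero, mul_one, mul_zero, add_zero]
  · refine ((h t ht V₂ V₂).congr f₂ (f₂ t ht)).congr_deriv ?_
    rw [hR (g t) _ _ (hg t ht), e₃, e₄, u₂, map_zero, mul_one, mul_zero, zero_add]

/-- A bound on the curvature bounds the first scale from below. -/
theorem le_of_curvatureBoundedBy (hR : HasRicciCoefficients hM Q A B C D) (hB : 0 ≤ B)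
    {g : InvariantMetric K (p₁ ⊔ p₂)} {x₁ x₂ : ℝ} (hg : IsDiagonal Q g x₁ x₂) {M : ℝ}
    (hb : CurvatureBoundedBy hM.isCompl g.toScalarProduct M) :
    A ≤ Module.finrank ℝ ↥(p₁ ⊔ p₂) * M * x₁ := by
  obtain ⟨V₁, V₂, e₁, e₂, e₃, e₄, u₁, u₂⟩ := hM.exists_unit_vectors Q
  have hx₁ := hg.1
  have hs := Real.mul_self_sqrt hx₁.le
  have hs' := Real.sqrt_pos.2 hx₁
  -- This vector has `g`-length one, and `Ric` takes the value `(A + B y²) / x₁ ≥ A / x₁` on it.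
  have h1 : g.form ((√x₁)⁻¹ • V₁) ((√x₁)⁻¹ • V₁) ≤ 1 := by
    rw [hg.form_eq hM]
    simp only [map_smul, LinearMap.smul_apply, smul_eq_mul, e₁, e₂, u₁, map_zero]
    refine le_of_eq ?_
    field_simp
    rw [pow_two, hs]
    ring
  have h2 := (le_abs_self _).trans (abs_ricci_le hb h1)
  rw [hR g x₁ x₂ hg] at h2
  simp only [map_smul, LinearMap.smul_apply, smul_eq_mul, e₁, e₂, u₁, map_zero, mul_zero,
    add_zero, mul_one] at h2
  rw [← mul_inv, hs, ← div_eq_mul_inv, div_le_iff₀ hx₁] at h2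
  have : 0 ≤ B * (x₁ / x₂) ^ 2 := mul_nonneg hB (sq_nonneg _)
  linarith

end HasRicciCoefficients

end IsTwoSummandSpace
end HomRicci

end

/-! ### The theorem -/

theorem mainTheorem4
    {E : Type*} [NormedAddCommGroup E] [NormedSpace ℝ E] [FiniteDimensional ℝ E]
    [CompleteSpace E]
    {G : Type*} [TopologicalSpace G] [ChartedSpace E G] [Group G] [LieGroup 𝓘(ℝ, E) ∞ G]
    (K H : Subgroup G) (p₁ p₂ : Submodule ℝ (GroupLieAlgebra 𝓘(ℝ, E) G))
    (hM : HomRicci.IsTwoSummandSpace K H p₁ p₂)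
    (Q : HomRicci.InvariantMetric K (p₁ ⊔ p₂)) (hQ : HomRicci.IsBackground Q)
    (y₁ y₂ : ℝ) (hy₁ : 0 < y₁) (hy : y₁ < y₂)
    (hE : ∀ (g : HomRicci.InvariantMetric K (p₁ ⊔ p₂)) (x₁ x₂ : ℝ),
      HomRicci.IsDiagonal Q g x₁ x₂ →
        (HomRicci.IsEinstein hM.isCompl g.toScalarProduct ↔ x₁ / x₂ = y₁ ∨ x₁ / x₂ = y₂))
    (g₀ : HomRicci.InvariantMetric K (p₁ ⊔ p₂)) (a₁ a₂ : ℝ)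
    (hg₀ : HomRicci.IsDiagonal Q g₀ a₁ a₂) (hy₀ : y₂ < a₁ / a₂) :
    (∃ T : ℝ, 0 < T ∧ ∃ g : ℝ → HomRicci.InvariantMetric K (p₁ ⊔ p₂),
      HomRicci.IsRicciFlowOn hM.isCompl g (Ico 0 T) ∧ g 0 = g₀ ∧
      -- the curvature is unbounded as `t → T`
      (∀ M : ℝ, ∃ᶠ t in 𝓝[<] T,
        ¬ HomRicci.CurvatureBoundedBy hM.isCompl (g t).toScalarProduct M) ∧
      -- uniqueness, and `[0, T)` is the longest interval on which a solution exists
      (∀ (T' : ℝ) (g' : ℝ → HomRicci.InvariantMetric K (p₁ ⊔ p₂)), 0 < T' →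
        HomRicci.IsRicciFlowOn hM.isCompl g' (Ico 0 T') → g' 0 = g₀ →
          T' ≤ T ∧ ∀ t ∈ Ico 0 T', g' t = g t) ∧
      -- the metric stays diagonal, shrinks to zero, and `y(t) → y₂`
      ∃ x₁ x₂ : ℝ → ℝ, (∀ t ∈ Ico 0 T, HomRicci.IsDiagonal Q (g t) (x₁ t) (x₂ t)) ∧
        Tendsto x₁ (𝓝[<] T) (𝓝 0) ∧ Tendsto x₂ (𝓝[<] T) (𝓝 0) ∧
        Tendsto (fun t => x₁ t / x₂ t) (𝓝[<] T) (𝓝 y₂)) ∧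
    -- there is no ancient solution through the given initial metric
    ¬ ∃ T' : ℝ, 0 < T' ∧ ∃ g : ℝ → HomRicci.InvariantMetric K (p₁ ⊔ p₂),
      HomRicci.IsRicciFlowOn hM.isCompl g (Iio T') ∧ g 0 = g₀ := by
  obtain ⟨A, B, C, D, hB, hD, hR⟩ := hM.exists_ricci_eq hQ
  replace hR : HomRicci.IsTwoSummandSpace.HasRicciCoefficients hM Q A B C D := hR
  -- Every `y > 0` is realized by the diagonal metric with scales `y` and `1`, so the hypothesis on
  -- Einstein metrics determines all positive roots of the quadratic.
  obtain ⟨ha, rfl, rfl⟩ := HomRicci.coefficients_of_einstein_iff (A := A) (C := C) hB hD hy₁ hy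
    fun y hy => by
      have hd := hM.isDiagonal_diagonalMetric Q hy one_pos
      have := hE _ _ _ hd
      rwa [hR.isEinstein_iff hd, div_one] at this
  have huniq : ∀ {x₁ x₂ : ℝ}, HomRicci.IsDiagonal Q g₀ x₁ x₂ → x₁ = a₁ ∧ x₂ = a₂ := by
    intro x₁ x₂ h
    obtain ⟨V₁, V₂, e₁, e₂, e₃, e₄, u₁, u₂⟩ := hM.exists_unit_vectors Q
    have h₁ := h.form_eq hM V₁ V₁
    have h₂ := h.form_eq hM V₂ V₂
    rw [hg₀.form_eq hM, e₁, e₂, u₁] at h₁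
    rw [hg₀.form_eq hM, e₃, e₄, u₂] at h₂
    simp only [map_zero, mul_one, mul_zero, add_zero, zero_add] at h₁ h₂
    exact ⟨h₁.symm, h₂.symm⟩
  constructor
  · obtain ⟨T, hT, x₁, x₂, i₁, i₂, hx, l₁, l₂, l₃⟩ :=
      HomRicci.IsDiagonalFlow.exists_shrinking hB hD ha hy₁ hy hg₀.2.1 hy₀
    classical
    let g : ℝ → HomRicci.InvariantMetric K (p₁ ⊔ p₂) := fun t =>
      if h : 0 < x₁ t ∧ 0 < x₂ t then hM.diagonalMetric Q h.1 h.2 else g₀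
    have hg : ∀ t ∈ Ico 0 T, HomRicci.IsDiagonal Q (g t) (x₁ t) (x₂ t) := by
      intro t ht
      have h : 0 < x₁ t ∧ 0 < x₂ t := ⟨hx.pos₁ t ht, hx.pos₂ t ht⟩
      simp only [g, dif_pos h]
      exact hM.isDiagonal_diagonalMetric Q h.1 h.2
    have h0 : (0 : ℝ) ∈ Ico 0 T := left_mem_Ico.2 hT
    refine ⟨T, hT, g, hR.isRicciFlowOn hx hg, (i₁ ▸ i₂ ▸ hg 0 h0).unique hM hg₀, fun M => ?_,
      fun T' g' hT' hflow hinit => ?_, x₁, x₂, hg, l₁, l₂, l₃⟩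
    -- A curvature bound `M` at time `t` gives `A ≤ dim 𝔭 · M · x₁(t)`. The right side tends to `0`
    -- while `A = (B + D) y₁ y₂ > 0`, so every bound eventually fails.
    · refine Eventually.frequently ?_
      have hlim : Tendsto (fun t => Module.finrank ℝ ↥(p₁ ⊔ p₂) * M * x₁ t) (𝓝[<] T) (𝓝 0) := by
        simpa using l₁.const_mul (Module.finrank ℝ ↥(p₁ ⊔ p₂) * M)
      have hA : 0 < (B + D) * (y₁ * y₂) := mul_pos ha (mul_pos hy₁ (hy₁.trans hy))
      filter_upwards [hlim.eventually_lt_const hA, Ico_mem_nhdsLT hT] with t ht htT hb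
      exact ht.not_ge (hR.le_of_curvatureBoundedBy hB (hg t htT) hb)
    · choose z₁ z₂ hz using fun t => hM.exists_isDiagonal Q (g' t)
      have hzf := hR.isDiagonalFlow hflow fun t _ => hz t
      obtain ⟨j₁, j₂⟩ := huniq (hinit ▸ hz 0)
      have heq : ∀ t ∈ Ico 0 (min T T'), z₁ t = x₁ t ∧ z₂ t = x₂ t := fun t ht =>
        (hzf.mono (Ico_subset_Ico_right (min_le_right _ _))).unique
          (hx.mono (Ico_subset_Ico_right (min_le_left _ _))) (j₁.trans i₁.symm)
          (j₂.trans i₂.symm) ht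
      -- A solution living beyond `T` agrees with `g` before `T`, so by continuity its first scale
      -- vanishes at `T`, contradicting positive definiteness.
      have hle : T' ≤ T := by
        by_contra! hlt
        have hTm : T ∈ Ico 0 T' := ⟨hT.le, hlt⟩
        have hc : Tendsto z₁ (𝓝[<] T) (𝓝 (z₁ T)) :=
          ((hzf.deriv₁ T hTm).hasDerivAt (Ico_mem_nhds hT hlt)).continuousAt.tendsto.mono_left
            nhdsWithin_le_nhds
        have hc' : Tendsto z₁ (𝓝[<] T) (𝓝 0) := by
          refine l₁.congr' ?_
          filter_upwards [Ico_mem_nhdsLT hT] with t ht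
          exact (heq t (by rwa [min_eq_left hlt.le])).1.symm
        exact (hzf.pos₁ T hTm).ne' (tendsto_nhds_unique hc hc')
      refine ⟨hle, fun t ht => ?_⟩
      obtain ⟨k₁, k₂⟩ := heq t (by rwa [min_eq_right hle])
      exact (k₁ ▸ k₂ ▸ hz t).unique hM (hg t ⟨ht.1, ht.2.trans_le hle⟩)
  · rintro ⟨T', hT', g, hflow, hinit⟩
    choose z₁ z₂ hz using fun t => hM.exists_isDiagonal Q (g t)
    have hzf := hR.isDiagonalFlow hflow fun t _ => hz t
    obtain ⟨j₁, j₂⟩ := huniq (hinit ▸ hz 0)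
    exact hzf.not_ancient hD ha hy₁ hy hT' (by rwa [j₁, j₂])
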